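/- Let $D\subset\mathbb R^d$, $d\ge 1$, be a bounded open set and let $V:=H^1_0(D)$ be the closure of $C_c^\infty(D)$ in $H^1(D)$, with the norm $\|v\|_V:=\|\nabla v\|_{L^2(D)}$. Let $f\in H^{-1}(D)=V^*$ and let $(\psi_j)_{j\ge1}$ be a sequence in $L^\infty(D)$. Let $\gamma$ be the countable tensor product of the standard Gaussian measure, on $U:=\mathbb R^{\mathbb N}$ with its product $\sigma$-algebra. For $y\in U$ such that the partial sums of $\sum_{j\ge1}y_j\psi_j$ converge in $L^\infty(D)$, let $b(y)$ be the limit and let $u(y)\in V$ be the weak solution of $-\mathrm{div}(e^{b(y)}\nabla u(y))=f$, that is, $$\int_D e^{b(y)}\,\nabla u(y)\cdot\nabla v\,dx=f(v)\qquad\text{for all }v\in V ;$$ for other $y$ put $u(y):=0$. Let $\mathcal F$ be the set of finitely supported sequences $\nu=(\nu_j)_{j\ge1}$ of nonnegative integers, let $H_k$ be the univariate Hermite polynomials, normalized in $L^2$ of the standard Gaussian measure, and for $\nu\in\mathcal F$ put $$H_\nu(y):=\prod_{j\ge1}H_{\nu_j}(y_j),\qquad u_\nu:=\int_U u(y)H_\nu(y)\,d\gamma(y)\in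 V .$$ **Theorem.** Let $0<p<2$ and $q:=\frac{2p}{2-p}$. Assume that there is a sequence $(\rho_j)_{j\ge1}$ of positive numbers such that $$\operatorname*{ess\,sup}_{x\in D}\sum_{j\ge1}\rho_j|\psi_j(x)|<\infty\qquad\text{and}\qquad(\rho_j^{-1})_{j\ge1}\in\ell^q(\mathbb N).$$ Then for $\gamma$-almost every $y\in U$ the series $\sum_j y_j\psi_j$ converges in $L^\infty(D)$ and the equation has exactly one weak solution, $u(y)$. The map $y\mapsto u(y)$ belongs to $L^k(U,V,\gamma)$ for all real $0\le k<\infty$ (in particular it is strongly $\gamma$-measurable). Moreover, $(\|u_\nu\|_V)_{\nu\in\mathcal F}\in\ell^p(\mathcal F)$. In particular, best $n$-term Hermite approximations converge in $L^2(U,V,\gamma)$ with rate $n^{-s}$, where $s:=\frac1p-\frac12=\frac1q$: for every $n\geq 0$ there is a set $\Lambda_n\subset\mathcal F$ of $n$ indices corresponding to the $n$ largest values of $\|u_\nu\|_V$, and there is a constant $C$ such that for all $n\ge1$ and every such set $\Lambda_n$ (ties being broken arbitrarily) $$\Big\|u-\sum_{\nu\in\Lambda_n}u_\nu H_\nu\Big\|_{L^2(U,V,\gamma)}\le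 C\,n^{-s}.$$ -/

import Mathlib

open MeasureTheory ProbabilityTheory Filter Topology
open scoped ENNReal NNReal ContDiff InnerProductSpace

noncomputable section

namespace LognormalPDE

/-! ### The domain `D` and the space `V = H¹₀(D)` -/

/-- A bounded open subset of `ℝ^d`. -/
structure BoundedOpenSet (d : ℕ) where
  carrier : Set (EuclideanSpace ℝ (Fin d))
  isOpen : IsOpen carrier
  isBounded : Bornology.IsBounded carrier

variable {d : ℕ}

/-- Lebesgue measure on `D`. -/
def BoundedOpenSet.measure (D : BoundedOpenSet d) : Measure (EuclideanSpace ℝ (Fin d)) :=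
  volume.restrict D.carrier

/-- Test functions: `φ ∈ C_c^∞(D)`. -/
structure IsTestFunction (D : BoundedOpenSet d) (φ : EuclideanSpace ℝ (Fin d) → ℝ) : Prop where
  contDiff : ContDiff ℝ ∞ φ
  hasCompactSupport : HasCompactSupport φ
  tsupport_subset : tsupport φ ⊆ D.carrier

/-- `L²(D)`. -/
abbrev L2 (D : BoundedOpenSet d) : Type := Lp ℝ 2 D.measure

/-- `L²(D; ℝ^d)`. -/
abbrev L2Vec (D : BoundedOpenSet d) : Type := Lp (EuclideanSpace ℝ (Fin d)) 2 D.measure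

/-- `L^∞(D)`. -/
abbrev LInf (D : BoundedOpenSet d) : Type := Lp ℝ ∞ D.measure

theorem gradient_add' {φ χ : EuclideanSpace ℝ (Fin d) → ℝ} (hφ : ContDiff ℝ ∞ φ)
    (hχ : ContDiff ℝ ∞ χ) (x : EuclideanSpace ℝ (Fin d)) :
    gradient (φ + χ) x = gradient φ x + gradient χ x := by
  have h1 := (hφ.differentiable (by simp)) x
  have h2 := (hχ.differentiable (by simp)) x
  simp only [gradient]
  rw [fderiv_add h1 h2, map_add]

theorem gradient_smul' {φ : EuclideanSpace ℝ (Fin d) → ℝ} (hφ : ContDiff ℝ ∞ φ)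
    (c : ℝ) (x : EuclideanSpace ℝ (Fin d)) :
    gradient (c • φ) x = c • gradient φ x := by
  have h1 := (hφ.differentiable (by simp)) x
  simp only [gradient]
  rw [fderiv_const_smul h1]
  simp

/-- The space of pairs `(φ, ∇φ)`, `φ ∈ C_c^∞(D)`, inside `L²(D) × L²(D; ℝ^d)`. -/
def testGraph (D : BoundedOpenSet d) : Submodule ℝ (L2 D × L2Vec D) where
  carrier := {w | ∃ φ, IsTestFunction D φ ∧ w.1 =ᵐ[D.measure] φ ∧
    w.2 =ᵐ[D.measure] gradient φ}
  zero_mem' := by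
    refine ⟨0, ⟨contDiff_const, HasCompactSupport.zero, by simp⟩, Lp.coeFn_zero _ _ _, ?_⟩
    refine (Lp.coeFn_zero _ _ _).trans (Eventually.of_forall fun x => ?_)
    simp only [gradient, Pi.zero_apply]
    have : (0 : EuclideanSpace ℝ (Fin d) → ℝ) = fun _ => 0 := rfl
    rw [this]; simp
  add_mem' := by
    rintro v w ⟨φ, hφ, h1, h2⟩ ⟨χ, hχ, h3, h4⟩
    refine ⟨φ + χ, ⟨hφ.contDiff.add hχ.contDiff,
      hφ.hasCompactSupport.add hχ.hasCompactSupport, ?_⟩, ?_, ?_⟩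
    · exact (tsupport_add φ χ).trans (Set.union_subset hφ.tsupport_subset hχ.tsupport_subset)
    · filter_upwards [Lp.coeFn_add v.1 w.1, h1, h3] with x a b c
      exact a.trans (by rw [Pi.add_apply, Pi.add_apply, b, c])
    · filter_upwards [Lp.coeFn_add v.2 w.2, h2, h4] with x a b c
      rw [gradient_add' hφ.contDiff hχ.contDiff]
      exact a.trans (by rw [Pi.add_apply, b, c])
  smul_mem' := by
    rintro c w ⟨φ, hφ, h1, h2⟩
    refine ⟨c • φ, ⟨contDiff_const.smul hφ.contDiff, hφ.hasCompactSupport.smul_left, ?_⟩, ?_, ?_⟩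
    · exact (closure_mono (Function.support_const_smul_subset c φ)).trans hφ.tsupport_subset
    · filter_upwards [Lp.coeFn_smul c w.1, h1] with x a b
      simp [a, b]
    · filter_upwards [Lp.coeFn_smul c w.2, h2] with x a b
      rw [gradient_smul' hφ.contDiff]
      simp [a, b]

/-- `H¹₀(D)`, the closure of `C_c^∞(D)` in `H¹(D)`.  An element is recorded as the pair
`(v, ∇v) ∈ L²(D) × L²(D; ℝ^d)` of a function and its (weak) gradient. -/
def H10 (D : BoundedOpenSet d) : Type := (testGraph D).topologicalClosure

instance (D : BoundedOpenSet d) : AddCommGroup (H10 D) :=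
  inferInstanceAs (AddCommGroup (testGraph D).topologicalClosure)

instance (D : BoundedOpenSet d) : Module ℝ (H10 D) :=
  inferInstanceAs (Module ℝ (testGraph D).topologicalClosure)

/-- The underlying `L²` function of an element of `H¹₀(D)`. -/
def H10.toL2 {D : BoundedOpenSet d} : H10 D →ₗ[ℝ] L2 D :=
  (LinearMap.fst ℝ (L2 D) (L2Vec D)).comp (testGraph D).topologicalClosure.subtype

/-- The weak gradient of an element of `H¹₀(D)`. -/
def H10.grad {D : BoundedOpenSet d} : H10 D →ₗ[ℝ] L2Vec D :=
  (LinearMap.snd ℝ (L2 D) (L2Vec D)).comp (testGraph D).topologicalClosure.subtype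

theorem norm_sq_L2 {F : Type*} [NormedAddCommGroup F] [InnerProductSpace ℝ F]
    {D : BoundedOpenSet d} (g : Lp F 2 D.measure) :
    ‖g‖ ^ 2 = ∫ x, ‖g x‖ ^ 2 ∂D.measure := by
  rw [← real_inner_self_eq_norm_sq, L2.inner_def]
  simp

theorem poincare_aux {φ : EuclideanSpace ℝ (Fin d) → ℝ} {R : ℝ}
    (hφc : ContDiff ℝ ∞ φ) (hφs : HasCompactSupport φ)
    (hR : ∀ x, φ x ≠ 0 → ‖x‖ ≤ R) (L : EuclideanSpace ℝ (Fin d) →L[ℝ] ℝ)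
    (e : EuclideanSpace ℝ (Fin d)) (hLe : L e = 1) (hLn : ∀ x, |L x| ≤ ‖x‖) (hne : ‖e‖ = 1) :
    ∫ x, φ x ^ 2 ≤ (2 * R) ^ 2 * ∫ x, ‖fderiv ℝ φ x‖ ^ 2 := by
  have hdiff : Differentiable ℝ φ := hφc.differentiable (by simp)
  have hcφ : Continuous φ := hφc.continuous
  have hcd : Continuous (fderiv ℝ φ) := hφc.continuous_fderiv (by simp)
  have hsd : HasCompactSupport (fderiv ℝ φ) := hφs.fderiv ℝ
  have i1 : Integrable (fun x => φ x ^ 2) := by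
    refine Continuous.integrable_of_hasCompactSupport (by fun_prop) ?_
    refine hφs.mono fun x hx => ?_
    rw [Function.mem_support] at hx ⊢
    contrapose! hx
    rw [hx]; ring
  have i2 : Integrable (fun x => ‖fderiv ℝ φ x‖ ^ 2) := by
    refine Continuous.integrable_of_hasCompactSupport (by fun_prop) ?_
    refine hsd.mono fun x hx => ?_
    rw [Function.mem_support] at hx ⊢
    contrapose! hx
    rw [hx, norm_zero]; ring
  have hder : ∀ x, fderiv ℝ (fun x => φ x ^ 2) x e = 2 * φ x * fderiv ℝ φ x e := fun x => by
    rw [((hdiff x).hasFDerivAt.pow 2).fderiv]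
    simp
  have i3 : Integrable (fun x => L x * fderiv ℝ (fun x => φ x ^ 2) x e) := by
    simp only [hder]
    refine Continuous.integrable_of_hasCompactSupport (by fun_prop) ?_
    refine hφs.mono fun x hx => ?_
    rw [Function.mem_support] at hx ⊢
    contrapose! hx
    rw [hx]; ring
  have i4 : Integrable (fun x => L x * φ x ^ 2) := by
    refine Continuous.integrable_of_hasCompactSupport (by fun_prop) ?_
    refine hφs.mono fun x hx => ?_
    rw [Function.mem_support] at hx ⊢
    contrapose! hx
    rw [hx]; ring
  have i5 : Integrable (fun x => fderiv ℝ (fun x => L x) x e * φ x ^ 2) := by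
    simpa [hLe] using i1
  have hibp := integral_mul_fderiv_eq_neg_fderiv_mul_of_integrable (μ := volume) (𝕜 := ℝ)
    (f := fun x => L x) (g := fun x => φ x ^ 2) (v := e) i5 i3 i4 (fun x _ => L.differentiableAt)
    (fun x _ => (hdiff x).pow 2)
  have hmain : ∫ x, φ x ^ 2 = ∫ x, -(L x * fderiv ℝ (fun x => φ x ^ 2) x e) := by
    rw [integral_neg, hibp]
    simp [hLe]
  have hpt : ∀ x, -(L x * fderiv ℝ (fun x => φ x ^ 2) x e) ≤
      φ x ^ 2 / 2 + 2 * R ^ 2 * ‖fderiv ℝ φ x‖ ^ 2 := fun x => by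
    rw [hder]
    by_cases hx : φ x = 0
    · simp only [hx]
      have : 0 ≤ 2 * R ^ 2 * ‖fderiv ℝ φ x‖ ^ 2 := by positivity
      linarith
    · have a1 : |L x| ≤ R := (hLn x).trans (hR x hx)
      have a2 : |fderiv ℝ φ x e| ≤ ‖fderiv ℝ φ x‖ := by
        simpa [hne] using (fderiv ℝ φ x).le_opNorm e
      have a3 : |L x * fderiv ℝ φ x e| ≤ R * ‖fderiv ℝ φ x‖ := by
        rw [abs_mul]
        exact mul_le_mul a1 a2 (abs_nonneg _) ((abs_nonneg _).trans a1)
      have a4 : (L x * fderiv ℝ φ x e) ^ 2 ≤ (R * ‖fderiv ℝ φ x‖) ^ 2 := by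
        rw [← sq_abs]
        exact pow_le_pow_left₀ (abs_nonneg _) a3 2
      linarith [sq_nonneg (φ x + 2 * (L x * fderiv ℝ φ x e))]
  have hle := integral_mono i3.neg ((i1.div_const 2).add (i2.const_mul (2 * R ^ 2))) hpt
  have hle' : ∫ x, φ x ^ 2 ≤
      (∫ x, φ x ^ 2) / 2 + 2 * R ^ 2 * ∫ x, ‖fderiv ℝ φ x‖ ^ 2 := by
    rw [← integral_div, ← integral_const_mul, ← integral_add (i1.div_const 2) (i2.const_mul _)]
    exact hmain.le.trans hle
  linarith

/-- Poincaré's inequality for test functions. -/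
theorem poincare_test [NeZero d] (D : BoundedOpenSet d) {R : ℝ}
    (hD : ∀ x ∈ D.carrier, ‖x‖ ≤ R) {φ : EuclideanSpace ℝ (Fin d) → ℝ}
    (hφ : IsTestFunction D φ) :
    ∫ x, ‖φ x‖ ^ 2 ∂D.measure ≤ (2 * R) ^ 2 * ∫ x, ‖gradient φ x‖ ^ 2 ∂D.measure := by
  have hzero : ∀ x, x ∉ D.carrier → φ x = 0 := fun x hx =>
    image_eq_zero_of_notMem_tsupport fun h => hx (hφ.tsupport_subset h)
  have hgz : ∀ x, x ∉ D.carrier → fderiv ℝ φ x = 0 := fun x hx => by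
    by_contra h
    exact hx (hφ.tsupport_subset (support_fderiv_subset ℝ h))
  have e1 : ∫ x, ‖φ x‖ ^ 2 ∂D.measure = ∫ x, φ x ^ 2 := by
    simp only [Real.norm_eq_abs, sq_abs]
    exact setIntegral_eq_integral_of_forall_compl_eq_zero fun x hx => by simp [hzero x hx]
  have e2 : ∫ x, ‖gradient φ x‖ ^ 2 ∂D.measure = ∫ x, ‖fderiv ℝ φ x‖ ^ 2 := by
    simp only [gradient, LinearIsometryEquiv.norm_map]
    exact setIntegral_eq_integral_of_forall_compl_eq_zero fun x hx => by simp [hgz x hx]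
  rw [e1, e2]
  refine poincare_aux hφ.contDiff hφ.hasCompactSupport (fun x hx => hD x ?_)
    (EuclideanSpace.proj (0 : Fin d)) (EuclideanSpace.single (0 : Fin d) 1) (by simp)
    (fun x => PiLp.norm_apply_le x 0) (by simp)
  by_contra h
  exact hx (hzero x h)

/-- Poincaré's inequality on `H¹₀(D)`. -/
theorem exists_poincare [NeZero d] (D : BoundedOpenSet d) :
    ∃ K : ℝ, 0 ≤ K ∧ ∀ v : H10 D, ‖v.toL2‖ ≤ K * ‖v.grad‖ := by
  obtain ⟨R, hR0, hR⟩ := D.isBounded.exists_pos_norm_le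
  refine ⟨2 * R, by positivity, fun v => ?_⟩
  have hcl : IsClosed {w : L2 D × L2Vec D | ‖w.1‖ ≤ 2 * R * ‖w.2‖} :=
    isClosed_le (by fun_prop) (by fun_prop)
  refine closure_minimal (s := (testGraph D : Set (L2 D × L2Vec D))) ?_ hcl v.2
  rintro w ⟨φ, hφ, h1, h2⟩
  have := poincare_test D hR hφ
  have e1 : ‖w.1‖ ^ 2 = ∫ x, ‖φ x‖ ^ 2 ∂D.measure := by
    rw [norm_sq_L2]
    exact integral_congr_ae (h1.mono fun x hx => by simp only [hx])
  have e2 : ‖w.2‖ ^ 2 = ∫ x, ‖gradient φ x‖ ^ 2 ∂D.measure := by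
    rw [norm_sq_L2]
    exact integral_congr_ae (h2.mono fun x hx => by simp only [hx])
  rw [← e1, ← e2, ← mul_pow] at this
  exact (abs_le_of_sq_le_sq' this (by positivity)).2

theorem H10.grad_injective [NeZero d] (D : BoundedOpenSet d) :
    Function.Injective (H10.grad (D := D)) := by
  rw [← LinearMap.ker_eq_bot, LinearMap.ker_eq_bot']
  intro v hv
  obtain ⟨K, -, hK⟩ := exists_poincare D
  have h1 : v.toL2 = 0 := by
    have := hK v
    rw [hv, norm_zero, mul_zero] at this
    exact norm_le_zero_iff.1 this
  exact Subtype.ext (Prod.ext h1 hv)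

/-- The norm of `V = H¹₀(D)` is `‖v‖_V = ‖∇v‖_{L²(D)}`. -/
instance [NeZero d] (D : BoundedOpenSet d) : NormedAddCommGroup (H10 D) :=
  NormedAddCommGroup.induced (H10 D) (L2Vec D) H10.grad (H10.grad_injective D)

theorem H10.norm_eq [NeZero d] {D : BoundedOpenSet d} (v : H10 D) : ‖v‖ = ‖v.grad‖ := rfl

/-- The inner product of `V = H¹₀(D)` is `⟪v, w⟫_V = ∫_D ∇v · ∇w`. -/
instance [NeZero d] (D : BoundedOpenSet d) : InnerProductSpace ℝ (H10 D) where
  norm_smul_le c v := by rw [H10.norm_eq, H10.norm_eq, map_smul]; exact norm_smul_le _ _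
  inner v w := ⟪v.grad, w.grad⟫_ℝ
  norm_sq_eq_re_inner v := by rw [H10.norm_eq]; exact norm_sq_eq_re_inner _
  conj_inner_symm v w := inner_conj_symm _ _
  add_left u v w := by rw [map_add]; exact inner_add_left _ _ _
  smul_left v w c := by rw [map_smul]; exact inner_smul_left _ _ _

/-- `V` is a Hilbert space. -/
instance [NeZero d] (D : BoundedOpenSet d) : CompleteSpace (H10 D) := by
  obtain ⟨K, hK0, hK⟩ := exists_poincare D
  refine Metric.complete_of_cauchySeq_tendsto fun s hs => ?_
  have hg : CauchySeq fun n => (s n).grad := by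
    rw [Metric.cauchySeq_iff] at hs ⊢
    intro ε hε
    obtain ⟨N, hN⟩ := hs ε hε
    refine ⟨N, fun m hm n hn => ?_⟩
    have := hN m hm n hn
    rwa [dist_eq_norm, H10.norm_eq, map_sub, ← dist_eq_norm] at this
  have hf : CauchySeq fun n => (s n).toL2 := by
    rw [Metric.cauchySeq_iff] at hs ⊢
    intro ε hε
    obtain ⟨N, hN⟩ := hs (ε / (K + 1)) (by positivity)
    refine ⟨N, fun m hm n hn => ?_⟩
    have h1 := hN m hm n hn
    rw [dist_eq_norm, H10.norm_eq, lt_div_iff₀ (by positivity)] at h1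
    rw [dist_eq_norm, ← map_sub]
    have h2 := hK (s m - s n)
    nlinarith [norm_nonneg (s m - s n).grad]
  obtain ⟨g, hg⟩ := cauchySeq_tendsto_of_complete hg
  obtain ⟨w, hw⟩ := cauchySeq_tendsto_of_complete hf
  have hmem : (w, g) ∈ (testGraph D).topologicalClosure :=
    (testGraph D).isClosed_topologicalClosure.mem_of_tendsto (hw.prodMk_nhds hg)
      (Eventually.of_forall fun n => (s n).2)
  let l : H10 D := (⟨(w, g), hmem⟩ : (testGraph D).topologicalClosure)
  have hl : l.grad = g := rfl
  refine ⟨l, ?_⟩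
  rw [tendsto_iff_norm_sub_tendsto_zero] at hg ⊢
  simpa only [H10.norm_eq, map_sub, hl] using hg

/-- `H^{-1}(D)`, the dual space of `V = H¹₀(D)`. -/
abbrev HMinusOne [NeZero d] (D : BoundedOpenSet d) : Type := StrongDual ℝ (H10 D)

/-! ### The lognormal diffusion equation -/

/-- `w ∈ V` is the weak solution of `-div(exp(b) ∇w) = f` with homogeneous Dirichlet condition:
`∫_D exp(b) ∇w · ∇v = f(v)` for all `v ∈ V`. -/
def IsWeakSolution [NeZero d] {D : BoundedOpenSet d} (b : LInf D) (f : HMinusOne D)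
    (w : H10 D) : Prop :=
  ∀ v : H10 D, ∫ x, Real.exp (b x) * ⟪w.grad x, v.grad x⟫_ℝ ∂D.measure = f v

/-- `b = ∑_j y_j ψ_j`, as the limit in `L^∞(D)` of the partial sums. -/
def IsLogCoeff {D : BoundedOpenSet d} (ψ : ℕ → LInf D) (y : ℕ → ℝ) (b : LInf D) : Prop :=
  Tendsto (fun J : ℕ => ∑ j ∈ Finset.range J, y j • ψ j) atTop (𝓝 b)

open Classical in
/-- The solution map `y ↦ u(y)`: whenever `b(y) = ∑_j y_j ψ_j` converges in `L^∞(D)`, `u(y)` is the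
weak solution of `-div(exp(b(y)) ∇u(y)) = f`; for the other `y` the value is `0`. -/
def solutionMap [NeZero d] {D : BoundedOpenSet d} (ψ : ℕ → LInf D) (f : HMinusOne D)
    (y : ℕ → ℝ) : H10 D :=
  if h : ∃ w : H10 D, ∃ b : LInf D, IsLogCoeff ψ y b ∧ IsWeakSolution b f w
  then h.choose else 0

/-! ### Gaussian measure and Hermite expansions -/

/-- The tensorized standard Gaussian measure on `U = ℝ^ℕ`. -/
def gaussianMeasure : Measure (ℕ → ℝ) := Measure.infinitePi fun _ => gaussianReal 0 1

/-- The Hermite polynomial of degree `k`, normalized in `L²` of the standard Gaussian measure. -/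
def hermiteFun (k : ℕ) (t : ℝ) : ℝ :=
  Polynomial.aeval t (Polynomial.hermite k) / Real.sqrt (k.factorial)

/-- The tensorized Hermite polynomial `H_ν(y) = ∏_j H_{ν_j}(y_j)`; the factors with `ν_j = 0`
equal `1`. -/
def hermiteProd (ν : ℕ →₀ ℕ) (y : ℕ → ℝ) : ℝ := ν.prod fun j k => hermiteFun k (y j)

/-- The Hermite coefficient `u_ν = ∫_U u(y) H_ν(y) dγ(y)`. -/
def hermiteCoeff {V : Type*} [NormedAddCommGroup V] [NormedSpace ℝ V] (u : (ℕ → ℝ) → V)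
    (ν : ℕ →₀ ℕ) : V :=
  ∫ y, hermiteProd ν y • u y ∂gaussianMeasure

/-- The truncated expansion `u_Λ = ∑_{ν ∈ Λ} u_ν H_ν`. -/
def hermiteTruncation {V : Type*} [NormedAddCommGroup V] [NormedSpace ℝ V] (u : (ℕ → ℝ) → V)
    (Λ : Finset (ℕ →₀ ℕ)) (y : ℕ → ℝ) : V :=
  ∑ ν ∈ Λ, hermiteProd ν y • hermiteCoeff u ν

/-- `Λ` consists of `n` indices with the `n` largest values of `c` (ties broken arbitrarily). -/
def IsNLargest {ι : Type*} (c : ι → ℝ) (n : ℕ) (Λ : Finset ι) : Prop :=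
  Λ.card = n ∧ ∀ μ ∈ Λ, ∀ ν ∉ Λ, c ν ≤ c μ

end LognormalPDE

end

open LognormalPDE

/-!
The Hermite coefficients of the solution are bounded by derivatives of the solution map, and these
derivatives are controlled without any holomorphy.

Put `b = b(y)`. Perturbing the coefficient to `exp (b + ∑_j z_j ψ_j)` and expanding in `z` gives
Taylor coefficients `t_μ = ∂^μ u / μ!` of the solution, which solve a triangular system of elliptic
problems: `solutionTaylor` defines them as the coefficients of the inverse of a formal power series
of operators, and `hasDerivAt_solutionTaylor` identifies them with derivatives. Testing the system
with `t_μ`, applying Cauchy--Schwarz and a Schur test pointwise in `x ∈ D` (`schur_splits`) yields,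
for all `m` with entries at most `r` and weights `ρ` so small that
`exp (√r ‖∑_j ρ_j |ψ_j|‖) ≤ 3 / 2`,
`∑_{μ ≤ m} (μ! ∏_j ρ_j^{2 μ_j}) ‖t_μ‖² ≤ 2 ‖f‖² exp(‖b‖)²`
(`sum_taylorWeight_mul_norm_sq_le`). The smallness costs nothing, since the weights of the theorem
may be multiplied by a constant.

By Gaussian integration by parts, `u_ν` is an explicit multiple of the Hermite coefficient of index
`ν - μ` of `t_μ` for every `μ ≤ ν` (`hermiteCoeff_solutionTaylor`). With the choice
`μ_j = min(ν_j, r)`, Bessel's inequality for each `t_μ` and integration of the bound above give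
`∑_ν w_ν ‖u_ν‖² < ∞` with `w_ν = ∏_j binom(ν_j, min(ν_j, r)) ρ_j^{2 min(ν_j, r)}`
(`sum_hermiteWeight_mul_norm_sq_le`). Since `(ρ_j⁻¹)` is in `ℓ^q`, the powers `w_ν^{-q/2}` are
summable once `r q / 2 > 1` (`summable_hermiteWeight_rpow`), and Young's inequality gives
`(‖u_ν‖) ∈ ℓ^p`. The rate of the best `n`-term approximations follows from Parseval's identity
(`eLpNorm_sub_hermiteTruncation`), that is, from the completeness of the Hermite system on `ℝ^ℕ`,
together with Stechkin's lemma (`sqrt_tsum_sq_le_of_isNLargest`).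

Convergence of `∑_j y_j ψ_j` and integrability of every power of `exp ‖b(y)‖` follow from
`‖b(y)‖ ≤ C sup_j |y_j| / ρ_j` and the Gaussian tails (`ae_exists_isLogCoeff`,
`finiteMoments_exp_norm_logCoeff`).
-/

namespace LognormalPDE

/-! ### Functions with finite moments of all orders -/

/-- `g` belongs to `L^k` for all finite exponents `k`. -/
def FiniteMoments {Ω E : Type*} [MeasurableSpace Ω] [NormedAddCommGroup E] (μ : Measure Ω)
    (g : Ω → E) : Prop := ∀ k : ℝ≥0, MemLp g k μ

section FiniteMoments

variable {Ω E : Type*} [MeasurableSpace Ω] [NormedAddCommGroup E] {μ : Measure Ω}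

theorem holderTriple_double (k : ℝ≥0) :
    ENNReal.HolderTriple ((2 * k : ℝ≥0) : ℝ≥0∞) ((2 * k : ℝ≥0) : ℝ≥0∞) (k : ℝ≥0∞) where
  inv_add_inv_eq_inv := by
    rw [ENNReal.coe_mul, ENNReal.mul_inv (by simp) (by simp), ← add_mul, ENNReal.coe_ofNat,
      ENNReal.inv_two_add_inv_two, one_mul]

theorem FiniteMoments.smul [NormedSpace ℝ E] {f : Ω → ℝ} {g : Ω → E} (hf : FiniteMoments μ f)
    (hg : FiniteMoments μ g) : FiniteMoments μ (fun y => f y • g y) := fun k => by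
  have := holderTriple_double k
  exact MemLp.smul (hg (2 * k)) (hf (2 * k))

theorem FiniteMoments.mul {f g : Ω → ℝ} (hf : FiniteMoments μ f)
    (hg : FiniteMoments μ g) : FiniteMoments μ (fun y => f y * g y) := hf.smul hg

theorem FiniteMoments.const [IsFiniteMeasure μ] (c : E) : FiniteMoments μ (fun _ => c) :=
  fun _ => memLp_const c

theorem FiniteMoments.prod [IsFiniteMeasure μ] {ι : Type*} (s : Finset ι) {f : ι → Ω → ℝ}
    (hf : ∀ i ∈ s, FiniteMoments μ (f i)) : FiniteMoments μ (fun y => ∏ i ∈ s, f i y) := by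
  classical
  induction s using Finset.induction_on with
  | empty => simpa using FiniteMoments.const (1 : ℝ)
  | insert a s ha ih =>
    simp only [Finset.prod_insert ha]
    exact (hf a (by simp)).mul (ih fun i hi => hf i (by simp [hi]))

theorem FiniteMoments.pow [IsFiniteMeasure μ] {f : Ω → ℝ} (hf : FiniteMoments μ f) (n : ℕ) :
    FiniteMoments μ (fun y => f y ^ n) := by
  simpa using FiniteMoments.prod (Finset.range n) (f := fun _ => f) fun _ _ => hf

theorem FiniteMoments.sum [IsFiniteMeasure μ] {ι : Type*} (s : Finset ι) {f : ι → Ω → E}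
    (hf : ∀ i ∈ s, FiniteMoments μ (f i)) : FiniteMoments μ (fun y => ∑ i ∈ s, f i y) :=
  fun k => memLp_finsetSum s fun i hi => hf i hi k

theorem FiniteMoments.mono {F : Type*} [NormedAddCommGroup F] {f : Ω → F} {g : Ω → E}
    (hf : FiniteMoments μ f) (hg : AEStronglyMeasurable g μ) (h : ∀ᵐ y ∂μ, ‖g y‖ ≤ ‖f y‖) :
    FiniteMoments μ g := fun k => (hf k).mono hg h

theorem FiniteMoments.memLp_two {f : Ω → E} (hf : FiniteMoments μ f) : MemLp f 2 μ := by
  simpa using hf 2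

theorem FiniteMoments.integrable {f : Ω → E} (hf : FiniteMoments μ f) : Integrable f μ := by
  rw [← memLp_one_iff_integrable]; simpa using hf 1

theorem FiniteMoments.comp {Ω' : Type*} [MeasurableSpace Ω'] {ν : Measure Ω'} {φ : Ω' → Ω}
    {f : Ω → E} (hf : FiniteMoments μ f) (hφ : MeasurePreserving φ ν μ) :
    FiniteMoments ν (fun y => f (φ y)) := fun k => (hf k).comp_measurePreserving hφ

end FiniteMoments

/-! ### Hermite polynomials on the line -/

theorem derivative_hermite_succ (n : ℕ) :
    Polynomial.derivative (Polynomial.hermite (n + 1)) = (n + 1 : ℕ) * Polynomial.hermite n := by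
  induction n with
  | zero => simp
  | succ n ih =>
    have h := Polynomial.hermite_succ n
    rw [Polynomial.hermite_succ (n + 1), Polynomial.derivative_sub, Polynomial.derivative_mul,
      Polynomial.derivative_X, ih, Polynomial.derivative_mul, Polynomial.derivative_natCast]
    rw [h]
    push_cast
    ring

theorem hermiteFun_zero (t : ℝ) : hermiteFun 0 t = 1 := by
  simp [hermiteFun]

theorem sqrt_factorial_succ (n : ℕ) :
    Real.sqrt ((n + 1).factorial) = Real.sqrt (n + 1) * Real.sqrt (n.factorial) := by
  rw [Nat.factorial_succ, Nat.cast_mul, Real.sqrt_mul (by positivity)]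
  push_cast
  rfl

theorem sqrt_factorial_pos (n : ℕ) : 0 < Real.sqrt (n.factorial) :=
  Real.sqrt_pos.2 (by exact_mod_cast n.factorial_pos)

theorem hasDerivAt_hermiteFun_succ (n : ℕ) (t : ℝ) :
    HasDerivAt (hermiteFun (n + 1)) (Real.sqrt (n + 1) * hermiteFun n t) t := by
  have h := ((Polynomial.hermite (n + 1)).hasDerivAt_aeval t).div_const
    (Real.sqrt ((n + 1).factorial))
  refine h.congr_deriv ?_
  have h1 := sqrt_factorial_pos n
  have h2 : 0 < Real.sqrt (n + 1 : ℝ) := Real.sqrt_pos.2 (by positivity)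
  rw [derivative_hermite_succ, sqrt_factorial_succ, hermiteFun]
  have h3 : Real.sqrt (n + 1 : ℝ) * Real.sqrt (n + 1 : ℝ) = n + 1 :=
    Real.mul_self_sqrt (by positivity)
  simp only [map_mul, map_natCast]
  push_cast
  field_simp
  rw [sq, h3]
  ring

theorem hasDerivAt_hermiteFun (n : ℕ) (t : ℝ) :
    HasDerivAt (hermiteFun n) (Real.sqrt n * hermiteFun (n - 1) t) t := by
  cases n with
  | zero =>
    have : hermiteFun 0 = fun _ => 1 := funext hermiteFun_zero
    simpa [this] using hasDerivAt_const t (1 : ℝ)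
  | succ n => simpa using hasDerivAt_hermiteFun_succ n t

/-- The three-term recursion `t H_n = √(n+1) H_{n+1} + √n H_{n-1}`. -/
theorem mul_hermiteFun (n : ℕ) (t : ℝ) :
    t * hermiteFun n t = Real.sqrt (n + 1) * hermiteFun (n + 1) t +
      Real.sqrt n * hermiteFun (n - 1) t := by
  have h1 := sqrt_factorial_pos n
  have h2 : 0 < Real.sqrt (n + 1 : ℝ) := Real.sqrt_pos.2 (by positivity)
  have h3 : Real.sqrt n * hermiteFun (n - 1) t =
      Polynomial.aeval t (Polynomial.derivative (Polynomial.hermite n)) /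
        Real.sqrt (n.factorial) := by
    refine (hasDerivAt_hermiteFun n t).unique ?_
    exact ((Polynomial.hermite n).hasDerivAt_aeval t).div_const _
  rw [h3, hermiteFun, hermiteFun, Polynomial.hermite_succ, sqrt_factorial_succ]
  simp only [map_sub, map_mul, Polynomial.aeval_X]
  field_simp
  ring

theorem hasDerivAt_gaussianPDFReal (t : ℝ) :
    HasDerivAt (gaussianPDFReal 0 1) (-t * gaussianPDFReal 0 1 t) t := by
  have h : HasDerivAt (fun x : ℝ => -(x - 0) ^ 2 / (2 * ((1 : ℝ≥0) : ℝ))) (-t) t := by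
    have := (((hasDerivAt_id t).sub_const 0).pow 2).neg.div_const (2 * ((1 : ℝ≥0) : ℝ))
    refine this.congr_deriv ?_
    simp
    ring
  have h2 := h.exp.const_mul ((Real.sqrt (2 * Real.pi * ((1 : ℝ≥0) : ℝ)))⁻¹)
  refine h2.congr_deriv ?_
  rw [gaussianPDFReal]
  ring

theorem integrable_gaussianReal_iff {E : Type*} [NormedAddCommGroup E] [NormedSpace ℝ E]
    {g : ℝ → E} : Integrable g (gaussianReal 0 1) ↔
      Integrable (fun t => gaussianPDFReal 0 1 t • g t) := by
  rw [gaussianReal_of_var_ne_zero 0 one_ne_zero,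
    integrable_withDensity_iff_integrable_smul' (measurable_gaussianPDF 0 1)
      (Eventually.of_forall fun _ => gaussianPDF_lt_top)]
  simp only [toReal_gaussianPDF]

/-- Gaussian integration by parts: `√(n+1) 𝔼[H_{n+1} g] = 𝔼[H_n g']`. -/
theorem integral_hermiteFun_succ_smul {E : Type*} [NormedAddCommGroup E] [NormedSpace ℝ E]
    {g g' : ℝ → E} (n : ℕ) (hg : ∀ t, HasDerivAt g (g' t) t)
    (h0 : Integrable (fun t => hermiteFun n t • g t) (gaussianReal 0 1))
    (h1 : Integrable (fun t => hermiteFun (n + 1) t • g t) (gaussianReal 0 1))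
    (h2 : Integrable (fun t => hermiteFun n t • g' t) (gaussianReal 0 1)) :
    Real.sqrt (n + 1) • ∫ t, hermiteFun (n + 1) t • g t ∂gaussianReal 0 1 =
      ∫ t, hermiteFun n t • g' t ∂gaussianReal 0 1 := by
  -- `(H_n φ)' = -√(n+1) H_{n+1} φ` for the Gaussian density `φ`
  have hu : ∀ t, HasDerivAt (fun t => gaussianPDFReal 0 1 t * hermiteFun n t)
      (-(Real.sqrt (n + 1) * (gaussianPDFReal 0 1 t * hermiteFun (n + 1) t))) t := fun t => by
    refine ((hasDerivAt_gaussianPDFReal t).mul (hasDerivAt_hermiteFun n t)).congr_deriv ?_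
    linear_combination (-gaussianPDFReal 0 1 t) * mul_hermiteFun n t
  rw [integrable_gaussianReal_iff] at h0 h1 h2
  have key := integral_bilinear_hasDerivAt_right_eq_neg_left_of_integrable
    (L := ContinuousLinearMap.lsmul ℝ ℝ) (u := fun t => gaussianPDFReal 0 1 t * hermiteFun n t)
    (v := g) (fun t _ => hu t) (fun t _ => hg t) (by simpa [mul_smul] using h2)
    ((h1.smul (Real.sqrt (n + 1))).neg.congr (Eventually.of_forall fun t => by
      simp [mul_smul]))
    (by simpa [mul_smul] using h0)
  simp only [ContinuousLinearMap.lsmul_apply, neg_smul, integral_neg, neg_neg, mul_smul,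
    integral_smul] at key
  rw [integral_gaussianReal_eq_integral_smul one_ne_zero,
    integral_gaussianReal_eq_integral_smul one_ne_zero, key]

/-! ### The Gaussian measure on sequences -/

instance : IsProbabilityMeasure gaussianMeasure := by
  unfold gaussianMeasure; infer_instance

theorem measurePreserving_eval_gaussianMeasure (j : ℕ) :
    MeasurePreserving (fun y : ℕ → ℝ => y j) gaussianMeasure (gaussianReal 0 1) :=
  measurePreserving_eval_infinitePi (fun _ => gaussianReal 0 1) j

theorem measurable_update_prod (j : ℕ) :
    Measurable (fun z : (ℕ → ℝ) × ℝ => Function.update z.1 j z.2) := by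
  refine measurable_pi_lambda _ fun i => ?_
  by_cases h : i = j
  · subst h; simpa using measurable_snd
  · simp only [Function.update_of_ne h]
    exact (measurable_pi_apply i).comp measurable_fst

/-- Resampling one coordinate preserves the Gaussian measure. -/
theorem measurePreserving_update (j : ℕ) :
    MeasurePreserving (fun z : (ℕ → ℝ) × ℝ => Function.update z.1 j z.2)
      (gaussianMeasure.prod (gaussianReal 0 1)) gaussianMeasure where
  measurable := measurable_update_prod j
  map_eq := by
    have hm := measurable_update_prod j
    refine Measure.eq_infinitePi _ fun s t ht => ?_
    rw [Measure.map_apply hm (MeasurableSet.pi s.countable_toSet fun i _ => ht i)]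
    by_cases hj : j ∈ s
    · have : (fun z : (ℕ → ℝ) × ℝ => Function.update z.1 j z.2) ⁻¹' (Set.pi s t) =
          (Set.pi (s.erase j) t) ×ˢ (t j) := by
        ext z
        simp only [Set.mem_preimage, Set.mem_pi, Finset.mem_coe, Set.mem_prod, Finset.mem_erase]
        constructor
        · intro h
          exact ⟨fun i hi => by simpa [Function.update_of_ne hi.1] using h i hi.2,
            by simpa using h j hj⟩
        · rintro ⟨h1, h2⟩ i hi
          by_cases hij : i = j
          · subst hij; simpa using h2
          · simpa [Function.update_of_ne hij] using h1 i ⟨hij, hi⟩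
      rw [this, Measure.prod_prod, gaussianMeasure, Measure.infinitePi_pi _ fun i _ => ht i,
        Finset.prod_erase_mul _ _ hj]
    · have : (fun z : (ℕ → ℝ) × ℝ => Function.update z.1 j z.2) ⁻¹' (Set.pi s t) =
          (Set.pi s t) ×ˢ Set.univ := by
        ext z
        simp only [Set.mem_preimage, Set.mem_pi, Finset.mem_coe, Set.mem_prod, Set.mem_univ,
          and_true]
        refine forall₂_congr fun i hi => ?_
        rw [Function.update_of_ne (by rintro rfl; exact hj hi)]
      rw [this, Measure.prod_prod, gaussianMeasure, Measure.infinitePi_pi _ fun i _ => ht i,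
        measure_univ, mul_one]

theorem finiteMoments_exp_mul_abs (a : ℝ) :
    FiniteMoments (gaussianReal 0 1) (fun t => Real.exp (a * |t|)) := fun k => by
  have h : ∀ c : ℝ, MemLp (fun t => Real.exp (c * t)) k (gaussianReal 0 1) := fun c => by
    rcases eq_or_ne k 0 with rfl | hk
    · simpa using (by fun_prop : Measurable fun t : ℝ => Real.exp (c * t)).aestronglyMeasurable
    · rw [← integrable_norm_rpow_iff (by fun_prop) (by simpa using hk) (by simp)]
      simp only [Real.norm_eq_abs, Real.abs_exp, ← Real.exp_mul, ENNReal.coe_toReal]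
      simpa [mul_assoc, mul_comm, mul_left_comm] using
        integrable_exp_mul_gaussianReal (μ := 0) (v := 1) (c * k)
  refine ((h a).add (h (-a))).mono (by fun_prop) (Eventually.of_forall fun t => ?_)
  have h1 := Real.exp_pos (a * t)
  have h2 := Real.exp_pos (-a * t)
  simp only [Real.norm_eq_abs, Pi.add_apply, Real.abs_exp]
  rw [abs_of_pos (add_pos h1 h2)]
  rcases abs_choice t with h | h <;> rw [h]
  · linarith
  · rw [mul_neg, ← neg_mul]; linarith

theorem finiteMoments_coord (j : ℕ) : FiniteMoments gaussianMeasure (fun y => y j) :=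
  FiniteMoments.comp (f := id) (fun k => memLp_id_gaussianReal k)
    (measurePreserving_eval_gaussianMeasure j)

theorem finiteMoments_hermiteFun (n j : ℕ) :
    FiniteMoments gaussianMeasure (fun y => hermiteFun n (y j)) := by
  have : (fun y : ℕ → ℝ => hermiteFun n (y j)) = fun y => ∑ i ∈ Finset.range (n + 1),
      ((Polynomial.hermite n).coeff i / Real.sqrt n.factorial : ℝ) * (y j) ^ i := by
    ext y
    rw [hermiteFun, Polynomial.aeval_eq_sum_range, Polynomial.natDegree_hermite, Finset.sum_div]
    refine Finset.sum_congr rfl fun i _ => ?_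
    simp
    ring
  rw [this]
  exact FiniteMoments.sum _ fun i _ => (FiniteMoments.const _).mul ((finiteMoments_coord j).pow i)

theorem finiteMoments_hermiteProd (ν : ℕ →₀ ℕ) :
    FiniteMoments gaussianMeasure (hermiteProd ν) :=
  FiniteMoments.prod ν.support (f := fun j (y : ℕ → ℝ) => hermiteFun (ν j) (y j))
    fun j _ => finiteMoments_hermiteFun (ν j) j

theorem hermiteProd_zero (y : ℕ → ℝ) : hermiteProd 0 y = 1 := by
  simp [hermiteProd]

theorem hermiteProd_eq_mul_erase (ν : ℕ →₀ ℕ) (j : ℕ) (y : ℕ → ℝ) :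
    hermiteProd ν y = hermiteFun (ν j) (y j) * hermiteProd (ν.erase j) y := by
  exact (Finsupp.mul_prod_erase' ν j (fun j k => hermiteFun k (y j))
    fun i => hermiteFun_zero _).symm

theorem hermiteProd_erase_update (ν : ℕ →₀ ℕ) (j : ℕ) (y : ℕ → ℝ) (t : ℝ) :
    hermiteProd (ν.erase j) (Function.update y j t) = hermiteProd (ν.erase j) y := by
  refine Finset.prod_congr rfl fun i hi => ?_
  have : i ≠ j := by rintro rfl; simp at hi
  simp only [Function.update_of_ne this]

theorem hermiteProd_update (ν : ℕ →₀ ℕ) (j : ℕ) (y : ℕ → ℝ) (t : ℝ) :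
    hermiteProd ν (Function.update y j t) =
      hermiteFun (ν j) t * hermiteProd (ν.erase j) y := by
  rw [hermiteProd_eq_mul_erase ν j, hermiteProd_erase_update, Function.update_self]

theorem erase_add_single (ν : ℕ →₀ ℕ) (j k : ℕ) :
    (ν + Finsupp.single j k).erase j = ν.erase j := by
  rw [Finsupp.erase_add, Finsupp.erase_single, add_zero]

theorem erase_sub_single (ν : ℕ →₀ ℕ) (j k : ℕ) :
    (ν - Finsupp.single j k).erase j = ν.erase j := by
  ext i
  by_cases h : i = j
  · subst h; simp
  · simp [Finsupp.erase_ne h, Finsupp.single_eq_of_ne h]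

/-- The recursion `y_j H_ν = √(ν_j+1) H_{ν+e_j} + √ν_j H_{ν-e_j}`. -/
theorem coord_mul_hermiteProd (ν : ℕ →₀ ℕ) (j : ℕ) (y : ℕ → ℝ) :
    y j * hermiteProd ν y = Real.sqrt (ν j + 1) * hermiteProd (ν + Finsupp.single j 1) y +
      Real.sqrt (ν j) * hermiteProd (ν - Finsupp.single j 1) y := by
  rw [hermiteProd_eq_mul_erase ν j, hermiteProd_eq_mul_erase (ν + _) j,
    hermiteProd_eq_mul_erase (ν - _) j, erase_add_single, erase_sub_single, ← mul_assoc,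
    mul_hermiteFun]
  simp only [Finsupp.add_apply, Finsupp.single_eq_same, Finsupp.coe_tsub, Pi.sub_apply]
  ring

/-- Gaussian integration by parts in one of the coordinates, for the Hermite coefficients:
`√(ν_j+1) F_{ν+e_j} = (∂_j F)_ν`. -/
theorem hermiteCoeff_add_single {V : Type*} [NormedAddCommGroup V] [NormedSpace ℝ V]
    {F F' : (ℕ → ℝ) → V} (ν : ℕ →₀ ℕ) (j : ℕ)
    (hF : ∀ᵐ y ∂gaussianMeasure, ∀ t,
      HasDerivAt (fun s => F (Function.update y j s)) (F' (Function.update y j t)) t)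
    (h0 : FiniteMoments gaussianMeasure F) (h1 : FiniteMoments gaussianMeasure F') :
    Real.sqrt (ν j + 1) • hermiteCoeff F (ν + Finsupp.single j 1) = hermiteCoeff F' ν := by
  have hint : ∀ {G : (ℕ → ℝ) → V} (_ : FiniteMoments gaussianMeasure G) (μ : ℕ →₀ ℕ),
      Integrable (fun z : (ℕ → ℝ) × ℝ => hermiteProd (μ.erase j) z.1 •
        (hermiteFun (μ j) z.2 • G (Function.update z.1 j z.2)))
        (gaussianMeasure.prod (gaussianReal 0 1)) := fun {G} hG μ => by
    refine (((finiteMoments_hermiteProd μ).smul hG).comp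
      (measurePreserving_update j)).integrable.congr (Eventually.of_forall fun z => ?_)
    simp only [hermiteProd_update, smul_smul]
    rw [mul_comm]
  have hcoeff : ∀ {G : (ℕ → ℝ) → V} (_ : FiniteMoments gaussianMeasure G) (μ : ℕ →₀ ℕ),
      hermiteCoeff G μ = ∫ y, hermiteProd (μ.erase j) y • ∫ t, hermiteFun (μ j) t •
        G (Function.update y j t) ∂gaussianReal 0 1 ∂gaussianMeasure := fun {G} hG μ => by
    have hmp := measurePreserving_update j
    have hmeas := ((finiteMoments_hermiteProd μ).smul hG).integrable.aestronglyMeasurable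
    have hmap := integral_map (μ := gaussianMeasure.prod (gaussianReal 0 1))
      hmp.measurable.aemeasurable (f := fun y => hermiteProd μ y • G y)
      (by rw [hmp.map_eq]; exact hmeas)
    rw [hmp.map_eq] at hmap
    rw [hermiteCoeff, hmap]
    simp only [← integral_smul]
    rw [← integral_prod (fun z : (ℕ → ℝ) × ℝ => hermiteProd (μ.erase j) z.1 •
        (hermiteFun (μ j) z.2 • G (Function.update z.1 j z.2))) (hint hG μ)]
    refine integral_congr_ae (Eventually.of_forall fun z => ?_)
    simp only [hermiteProd_update, smul_smul]
    rw [mul_comm]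
  rw [hcoeff h0, hcoeff h1, ← integral_smul, erase_add_single]
  -- almost every slice is integrable; where the cofactor vanishes nothing has to be shown
  have hslice : ∀ {G : (ℕ → ℝ) → V} (_ : FiniteMoments gaussianMeasure G) (μ : ℕ →₀ ℕ),
      ∀ᵐ y ∂gaussianMeasure, hermiteProd (μ.erase j) y ≠ 0 → Integrable (fun t =>
        hermiteFun (μ j) t • G (Function.update y j t)) (gaussianReal 0 1) := fun {G} hG μ => by
    filter_upwards [(hint hG μ).prod_right_ae] with y hy hne
    exact (integrable_smul_iff hne _).1 hy
  refine integral_congr_ae ?_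
  filter_upwards [hF, hslice h0 ν, hslice h0 (ν + Finsupp.single j 1), hslice h1 ν] with y a b c e
  by_cases hz : hermiteProd (ν.erase j) y = 0
  · simp [hz]
  · rw [erase_add_single] at c
    have c' := c hz
    simp only [Finsupp.add_apply, Finsupp.single_eq_same] at c' ⊢
    rw [smul_comm, integral_hermiteFun_succ_smul (ν j) a (b hz) c' (e hz)]

theorem induction_add_single {P : (ℕ →₀ ℕ) → Prop} (h0 : P 0)
    (h1 : ∀ μ j, P μ → P (μ + Finsupp.single j 1)) (μ : ℕ →₀ ℕ) : P μ := by
  suffices h : ∀ ν, P ν → P (ν + μ) by simpa using h 0 h0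
  induction μ using Finsupp.induction_linear with
  | zero => simp
  | add f g hf hg => intro ν hν; rw [← add_assoc]; exact hg _ (hf _ hν)
  | single j k =>
    induction k with
    | zero => simp
    | succ k ih => intro ν hν; rw [Finsupp.single_add, ← add_assoc]; exact h1 _ _ (ih _ hν)

/-- The tensorized Hermite polynomials are orthonormal. -/
theorem integral_hermiteProd_mul (μ ν : ℕ →₀ ℕ) :
    ∫ y, hermiteProd μ y * hermiteProd ν y ∂gaussianMeasure = if μ = ν then 1 else 0 := by
  have hder : ∀ (ν : ℕ →₀ ℕ) (j : ℕ) (y : ℕ → ℝ) (t : ℝ),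
      HasDerivAt (fun s => hermiteProd ν (Function.update y j s))
        ((fun y => Real.sqrt (ν j) * hermiteProd (ν - Finsupp.single j 1) y)
          (Function.update y j t)) t := fun ν j y t => by
    simp only [hermiteProd_update, erase_sub_single]
    refine ((hasDerivAt_hermiteFun (ν j) t).mul_const _).congr_deriv ?_
    simp only [Finsupp.coe_tsub, Pi.sub_apply, Finsupp.single_eq_same]
    ring
  have step : ∀ (μ ν : ℕ →₀ ℕ) (j : ℕ), Real.sqrt (μ j + 1) *
      ∫ y, hermiteProd (μ + Finsupp.single j 1) y * hermiteProd ν y ∂gaussianMeasure =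
      Real.sqrt (ν j) *
      ∫ y, hermiteProd μ y * hermiteProd (ν - Finsupp.single j 1) y ∂gaussianMeasure :=
    fun μ ν j => by
    have := hermiteCoeff_add_single μ j (F := hermiteProd ν)
      (Eventually.of_forall fun y t => hder ν j y t) (finiteMoments_hermiteProd ν)
      ((FiniteMoments.const _).mul (finiteMoments_hermiteProd _))
    simp only [hermiteCoeff, smul_eq_mul] at this
    rw [this, ← integral_const_mul]
    congr 1 with y
    ring
  have hzero : ∀ ν : ℕ →₀ ℕ, ν ≠ 0 →
      ∫ y, hermiteProd ν y * hermiteProd 0 y ∂gaussianMeasure = 0 := fun ν hν => by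
    obtain ⟨j, hj⟩ := Finsupp.ne_iff.1 hν
    have hle : Finsupp.single j 1 ≤ ν := by
      rw [Finsupp.single_le_iff]; exact Nat.one_le_iff_ne_zero.2 hj
    have := step (ν - Finsupp.single j 1) 0 j
    rw [tsub_add_cancel_of_le hle] at this
    simp only [Finsupp.coe_zero, Pi.zero_apply, CharP.cast_eq_zero, Real.sqrt_zero,
      zero_mul] at this
    exact (mul_eq_zero.1 this).resolve_left (Real.sqrt_pos.2 (by positivity)).ne'
  induction μ using induction_add_single generalizing ν with
  | h0 =>
    by_cases hν : ν = 0
    · subst hν; simp [hermiteProd_zero]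
    · rw [if_neg (Ne.symm hν), ← hzero ν hν]
      simp only [mul_comm]
  | h1 μ j ih =>
    have h := step μ ν j
    have hpos : 0 < Real.sqrt (μ j + 1 : ℝ) := Real.sqrt_pos.2 (by positivity)
    rw [ih] at h
    by_cases hν : μ + Finsupp.single j 1 = ν
    · subst hν
      rw [add_tsub_cancel_right, if_pos rfl, mul_one] at h
      rw [if_pos rfl]
      refine mul_left_cancel₀ hpos.ne' (h.trans ?_)
      simp
    · rw [if_neg hν]
      refine mul_left_cancel₀ hpos.ne' (h.trans ?_)
      rw [mul_zero]
      by_cases hj : ν j = 0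
      · simp [hj]
      · have hle : Finsupp.single j 1 ≤ ν := by
          rw [Finsupp.single_le_iff]; exact Nat.one_le_iff_ne_zero.2 hj
        rw [if_neg, mul_zero]
        rintro rfl
        exact hν (tsub_add_cancel_of_le hle)

/-! ### Completeness of the Hermite polynomials -/

theorem finiteMoments_exp_sum_abs (s : Finset ℕ) (ξ : ℕ → ℝ) :
    FiniteMoments gaussianMeasure (fun y => Real.exp (∑ i ∈ s, |ξ i * y i|)) := by
  simp only [Real.exp_sum, abs_mul]
  exact FiniteMoments.prod s (f := fun i (y : ℕ → ℝ) => Real.exp (|ξ i| * |y i|)) fun i _ =>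
    (finiteMoments_exp_mul_abs |ξ i|).comp (measurePreserving_eval_gaussianMeasure i)

/-- The recursion for Hermite polynomials shows that a function all of whose Hermite coefficients
vanish is orthogonal to all polynomials. -/
theorem integral_mul_hermiteProd_mul_pow {g : (ℕ → ℝ) → ℝ} (hg : MemLp g 2 gaussianMeasure)
    (h : ∀ ν, ∫ y, hermiteProd ν y * g y ∂gaussianMeasure = 0) (s : Finset ℕ) (ξ : ℕ → ℝ)
    (n : ℕ) : ∀ ν, ∫ y, (∑ i ∈ s, ξ i * y i) ^ n * hermiteProd ν y * g y ∂gaussianMeasure = 0 := by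
  have hlin : FiniteMoments gaussianMeasure (fun y : ℕ → ℝ => ∑ i ∈ s, ξ i * y i) :=
    FiniteMoments.sum s fun i _ => (FiniteMoments.const _).mul (finiteMoments_coord i)
  induction n with
  | zero => simpa using h
  | succ n ih =>
    intro ν
    have hint : ∀ μ, Integrable (fun y => (∑ i ∈ s, ξ i * y i) ^ n * hermiteProd μ y * g y)
        gaussianMeasure := fun μ =>
      ((hlin.pow n).mul (finiteMoments_hermiteProd μ)).memLp_two.integrable_mul hg
    have : ∀ y : ℕ → ℝ, (∑ i ∈ s, ξ i * y i) ^ (n + 1) * hermiteProd ν y * g y =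
        ∑ i ∈ s, (ξ i * Real.sqrt (ν i + 1) *
            ((∑ i ∈ s, ξ i * y i) ^ n * hermiteProd (ν + Finsupp.single i 1) y * g y) +
          ξ i * Real.sqrt (ν i) *
            ((∑ i ∈ s, ξ i * y i) ^ n * hermiteProd (ν - Finsupp.single i 1) y * g y)) := by
      intro y
      rw [pow_succ, mul_assoc, mul_assoc, Finset.sum_mul, Finset.mul_sum]
      refine Finset.sum_congr rfl fun i _ => ?_
      have := coord_mul_hermiteProd ν i y
      linear_combination ((∑ i ∈ s, ξ i * y i) ^ n * ξ i * g y) * this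
    simp only [this]
    rw [integral_finsetSum]
    swap
    · exact fun i _ => ((hint _).const_mul _).add ((hint _).const_mul _)
    refine Finset.sum_eq_zero fun i _ => ?_
    rw [integral_add ((hint _).const_mul _) ((hint _).const_mul _), integral_const_mul,
      integral_const_mul, ih, ih, mul_zero, mul_zero, add_zero]

/-- Expanding the exponential shows that a function whose Hermite coefficients all vanish is orthogonal
to the characters of finitely many coordinates. -/
theorem integral_exp_mul_eq_zero {g : (ℕ → ℝ) → ℝ} (hg : MemLp g 2 gaussianMeasure)
    (h : ∀ ν, ∫ y, hermiteProd ν y * g y ∂gaussianMeasure = 0) (s : Finset ℕ) (ξ : ℕ → ℝ) :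
    ∫ y, Complex.exp ((∑ i ∈ s, ξ i * y i : ℝ) * Complex.I) * g y ∂gaussianMeasure = 0 := by
  have hlin : FiniteMoments gaussianMeasure (fun y : ℕ → ℝ => ∑ i ∈ s, ξ i * y i) :=
    FiniteMoments.sum s fun i _ => (FiniteMoments.const _).mul (finiteMoments_coord i)
  have hpoly : ∀ n : ℕ, ∫ y, (∑ i ∈ s, ξ i * y i) ^ n * g y ∂gaussianMeasure = 0 := fun n => by
    simpa [hermiteProd_zero] using integral_mul_hermiteProd_mul_pow hg h s ξ n 0
  have hsum := hasSum_integral_of_dominated_convergence (μ := gaussianMeasure)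
    (F := fun (n : ℕ) (y : ℕ → ℝ) =>
      ((((∑ i ∈ s, ξ i * y i) ^ n * g y : ℝ) : ℂ) * (Complex.I ^ n / n.factorial)))
    (f := fun y => Complex.exp ((∑ i ∈ s, ξ i * y i : ℝ) * Complex.I) * g y)
    (fun n y => (|∑ i ∈ s, ξ i * y i| ^ n / n.factorial) * |g y|)
    (fun n => by
      have := ((hlin.pow n).memLp_two.integrable_mul hg).aestronglyMeasurable
      exact (Complex.continuous_ofReal.comp_aestronglyMeasurable this).mul_const _)
    (fun n => Eventually.of_forall fun y => by
      rw [norm_mul, norm_div, norm_pow, Complex.norm_I, one_pow, Complex.norm_real,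
        Complex.norm_natCast, Real.norm_eq_abs, abs_mul, abs_pow]
      apply le_of_eq
      ring)
    (Eventually.of_forall fun y => (Real.summable_pow_div_factorial _).mul_right _)
    (by
      have : (fun y : ℕ → ℝ => ∑' n : ℕ, (|∑ i ∈ s, ξ i * y i| ^ n / n.factorial) * |g y|) =
          fun y => Real.exp |∑ i ∈ s, ξ i * y i| * |g y| := by
        ext y
        rw [tsum_mul_right, Real.exp_eq_exp_ℝ, NormedSpace.exp_eq_tsum_div]
      rw [this]
      refine ((finiteMoments_exp_sum_abs s ξ).memLp_two.integrable_mul hg.norm).mono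
        ((Real.continuous_exp.comp_aestronglyMeasurable
          hlin.integrable.aestronglyMeasurable.norm).mul hg.1.norm)
        (Eventually.of_forall fun y => ?_)
      simp only [Pi.mul_apply, norm_mul, Real.norm_eq_abs, Real.abs_exp, abs_abs]
      gcongr
      exact Finset.abs_sum_le_sum_abs _ _)
    (Eventually.of_forall fun y => by
      have := (NormedSpace.expSeries_div_hasSum_exp (𝔸 := ℂ)
        ((∑ i ∈ s, ξ i * y i : ℝ) * Complex.I)).mul_right (g y : ℂ)
      rw [← Complex.exp_eq_exp_ℂ] at this
      refine this.congr_fun fun n => ?_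
      push_cast
      ring)
  refine hsum.unique ?_
  have : ∀ n : ℕ, ∫ y, ((((∑ i ∈ s, ξ i * y i) ^ n * g y : ℝ) : ℂ) *
      (Complex.I ^ n / n.factorial)) ∂gaussianMeasure = 0 := fun n => by
    rw [integral_mul_const, integral_complex_ofReal, hpoly]
    simp
  simp only [this]
  exact hasSum_zero

/-- A square integrable scalar function with vanishing Hermite coefficients is zero: its positive
and negative parts are densities of measures with the same finite-dimensional characteristic
functions. -/
theorem ae_eq_zero_of_integral_hermiteProd_mul {g : (ℕ → ℝ) → ℝ}
    (hg : MemLp g 2 gaussianMeasure)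
    (h : ∀ ν, ∫ y, hermiteProd ν y * g y ∂gaussianMeasure = 0) : g =ᵐ[gaussianMeasure] 0 := by
  have hgi : Integrable g gaussianMeasure := hg.integrable (by norm_num)
  have hgm : ∀ c : ℝ, AEMeasurable (fun y => ENNReal.ofReal (c * g y)) gaussianMeasure :=
    fun c => (hg.1.aemeasurable.const_mul c).ennreal_ofReal
  let P : ℝ → Measure (ℕ → ℝ) := fun c =>
    gaussianMeasure.withDensity fun y => ENNReal.ofReal (c * g y)
  have hfin : ∀ c, IsFiniteMeasure (P c) := fun c => by
    refine isFiniteMeasure_withDensity ?_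
    rw [← lt_top_iff_ne_top]
    exact (hgi.const_mul c).lintegral_lt_top
  have hP : ∀ (c : ℝ) (f : (ℕ → ℝ) → ℂ), ∫ y, f y ∂P c =
      ∫ y, (max (c * g y) 0) • f y ∂gaussianMeasure := fun c f => by
    rw [integral_withDensity_eq_integral_toReal_smul₀ (hgm c) (by simp)]
    simp only [ENNReal.toReal_ofReal']
  have hproj : ∀ I : Finset ℕ, (P 1).map I.restrict = (P (-1)).map I.restrict := fun I => by
    have hr : Measurable (I.restrict : (ℕ → ℝ) → (I → ℝ)) := Finset.measurable_restrict I
    have i1 : IsFiniteMeasure ((P 1).map I.restrict) := Measure.isFiniteMeasure_map _ _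
    have i2 : IsFiniteMeasure ((P (-1)).map I.restrict) := Measure.isFiniteMeasure_map _ _
    refine Measure.ext_of_charFunDual (funext fun L => ?_)
    let ξ : ℕ → ℝ := fun i => if hi : i ∈ I then L (Pi.single ⟨i, hi⟩ 1) else 0
    have hL : ∀ y : ℕ → ℝ, L (I.restrict y) = ∑ i ∈ I, ξ i * y i := fun y => by
      have : I.restrict y = ∑ i : I, y i • (Pi.single i (1 : ℝ) : I → ℝ) := by
        ext j
        simp [Finset.sum_apply, Pi.single_apply]
      rw [this, map_sum, ← Finset.sum_coe_sort I]
      refine Finset.sum_congr rfl fun i _ => ?_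
      simp [ξ, mul_comm]
    have hmeas : ∀ Q : Measure (ℕ → ℝ), AEStronglyMeasurable
        (fun v : I → ℝ => Complex.exp ((L v : ℝ) * Complex.I)) (Q.map I.restrict) := fun Q =>
      (by fun_prop : Continuous fun v : I → ℝ =>
        Complex.exp ((L v : ℝ) * Complex.I)).aestronglyMeasurable
    have hbd : ∀ c : ℝ, Integrable (fun y => (max (c * g y) 0) •
        Complex.exp ((L (I.restrict y) : ℝ) * Complex.I)) gaussianMeasure := fun c => by
      refine ((hgi.const_mul c).pos_part).mono ?_ (Eventually.of_forall fun y => ?_)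
      · refine (hgi.const_mul c).pos_part.aestronglyMeasurable.smul ?_
        exact (by fun_prop : Continuous fun v : I → ℝ =>
          Complex.exp ((L v : ℝ) * Complex.I)).measurable.comp hr |>.aestronglyMeasurable
      · rw [norm_smul, Complex.norm_exp_ofReal_mul_I, mul_one]
    rw [charFunDual_apply, charFunDual_apply, integral_map hr.aemeasurable (hmeas _),
      integral_map hr.aemeasurable (hmeas _), hP, hP, ← sub_eq_zero,
      ← integral_sub (hbd 1) (hbd (-1)), ← integral_exp_mul_eq_zero hg h I ξ]
    refine integral_congr_ae (Eventually.of_forall fun y => ?_)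
    simp only [hL, one_mul, neg_mul, ← sub_smul]
    rw [Complex.real_smul, mul_comm]
    congr 2
    rcases le_total 0 (g y) with h0 | h0
    · rw [max_eq_left h0, max_eq_right (by linarith), sub_zero]
    · rw [max_eq_right h0, max_eq_left (by linarith)]; ring
  have hPP : P 1 = P (-1) := by
    refine IsProjectiveLimit.unique (P := fun I : Finset ℕ => (P 1).map I.restrict)
      (fun I => rfl) fun I => (hproj I).symm
  have hde := (withDensity_eq_iff (hgm 1) (hgm (-1))
    (hgi.const_mul 1).lintegral_lt_top.ne).1 hPP
  filter_upwards [hde] with y hy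
  rw [← ENNReal.toReal_eq_toReal_iff' (by simp) (by simp), ENNReal.toReal_ofReal',
    ENNReal.toReal_ofReal'] at hy
  rcases le_total 0 (g y) with h0 | h0
  · rw [max_eq_left (by linarith), max_eq_right (by linarith)] at hy
    simpa using hy
  · rw [max_eq_right (by linarith), max_eq_left (by linarith)] at hy
    simpa using hy.symm

section Hilbert

variable {V : Type*} [NormedAddCommGroup V] [InnerProductSpace ℝ V]

theorem integrable_hermiteProd_smul {w : (ℕ → ℝ) → V} (hw : MemLp w 2 gaussianMeasure)
    (ν : ℕ →₀ ℕ) : Integrable (fun y => hermiteProd ν y • w y) gaussianMeasure := by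
  rw [← memLp_one_iff_integrable]
  exact MemLp.smul (p := 2) (q := 2) hw (finiteMoments_hermiteProd ν).memLp_two

theorem memLp_hermiteProd_smul (ν : ℕ →₀ ℕ) (c : V) :
    MemLp (fun y => hermiteProd ν y • c) 2 gaussianMeasure :=
  ((finiteMoments_hermiteProd ν).smul (FiniteMoments.const c)).memLp_two

theorem norm_toLp_sq {w : (ℕ → ℝ) → V} (hw : MemLp w 2 gaussianMeasure) :
    ‖hw.toLp w‖ ^ 2 = ∫ y, ‖w y‖ ^ 2 ∂gaussianMeasure := by
  rw [← real_inner_self_eq_norm_sq, L2.inner_def]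
  refine integral_congr_ae ?_
  filter_upwards [hw.coeFn_toLp] with y hy
  rw [hy, real_inner_self_eq_norm_sq]

theorem memLp_hermiteTruncation (w : (ℕ → ℝ) → V) (Λ : Finset (ℕ →₀ ℕ)) :
    MemLp (hermiteTruncation w Λ) 2 gaussianMeasure :=
  memLp_finsetSum Λ fun ν _ => memLp_hermiteProd_smul ν _

variable [CompleteSpace V]

theorem inner_hermiteCoeff {w : (ℕ → ℝ) → V} (hw : MemLp w 2 gaussianMeasure)
    (ν : ℕ →₀ ℕ) (c : V) :
    ⟪c, hermiteCoeff w ν⟫_ℝ = ∫ y, hermiteProd ν y * ⟪c, w y⟫_ℝ ∂gaussianMeasure := by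
  rw [hermiteCoeff, ← integral_inner (integrable_hermiteProd_smul hw ν)]
  simp only [inner_smul_right]

theorem ae_eq_zero_of_hermiteCoeff {w : (ℕ → ℝ) → V} (hw : MemLp w 2 gaussianMeasure)
    (h : ∀ ν, hermiteCoeff w ν = 0) : w =ᵐ[gaussianMeasure] 0 := by
  obtain ⟨t, ht, hwt⟩ := hw.1.isSeparable_ae_range
  refine ae_eq_zero_of_forall_dual_of_isSeparable ℝ ht (fun c => ?_) hwt
  have hcw : MemLp (fun y => c (w y)) 2 gaussianMeasure := c.comp_memLp' hw
  refine ae_eq_zero_of_integral_hermiteProd_mul hcw fun ν => ?_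
  have := c.integral_comp_comm (integrable_hermiteProd_smul hw ν)
  simp only [map_smul, smul_eq_mul] at this
  rw [this, ← hermiteCoeff, h, map_zero]

theorem inner_toLp_hermiteProd_smul {w : (ℕ → ℝ) → V} (hw : MemLp w 2 gaussianMeasure)
    (ν : ℕ →₀ ℕ) (c : V) :
    ⟪(memLp_hermiteProd_smul ν c).toLp _, hw.toLp w⟫_ℝ = ⟪c, hermiteCoeff w ν⟫_ℝ := by
  rw [inner_hermiteCoeff hw, L2.inner_def]
  refine integral_congr_ae ?_
  filter_upwards [(memLp_hermiteProd_smul ν c).coeFn_toLp, hw.coeFn_toLp] with y h1 h2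
  rw [h1, h2, real_inner_smul_left]

theorem hermiteCoeff_hermiteProd_smul (μ ν : ℕ →₀ ℕ) (c : V) :
    hermiteCoeff (fun y => hermiteProd μ y • c) ν = if μ = ν then c else 0 := by
  simp only [hermiteCoeff, smul_smul]
  rw [integral_smul_const, integral_hermiteProd_mul]
  by_cases h : μ = ν
  · simp [h]
  · simp [h, Ne.symm h]

/-- The isometric embedding `c ↦ H_ν c` of `V` into `L²(γ; V)`. -/
noncomputable def hermiteEmbedding (ν : ℕ →₀ ℕ) : V →ₗᵢ[ℝ] Lp V 2 gaussianMeasure where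
  toFun c := (memLp_hermiteProd_smul ν c).toLp _
  map_add' c c' := by
    rw [← MemLp.toLp_add]
    exact MemLp.toLp_congr _ _ (Eventually.of_forall fun y => smul_add _ _ _)
  map_smul' a c := by
    rw [RingHom.id_apply, ← MemLp.toLp_const_smul]
    exact MemLp.toLp_congr _ _ (Eventually.of_forall fun y => smul_comm _ _ _)
  norm_map' c := by
    have : ‖(memLp_hermiteProd_smul ν c).toLp (fun y => hermiteProd ν y • c)‖ ^ 2 = ‖c‖ ^ 2 := by
      rw [← real_inner_self_eq_norm_sq, inner_toLp_hermiteProd_smul,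
        hermiteCoeff_hermiteProd_smul, if_pos rfl, real_inner_self_eq_norm_sq]
    exact (sq_eq_sq₀ (norm_nonneg _) (norm_nonneg _)).1 this

theorem hermiteEmbedding_apply (ν : ℕ →₀ ℕ) (c : V) :
    hermiteEmbedding ν c = (memLp_hermiteProd_smul ν c).toLp _ := rfl

theorem orthogonalFamily_hermiteEmbedding :
    OrthogonalFamily ℝ (fun _ : ℕ →₀ ℕ => V) (hermiteEmbedding (V := V)) := by
  intro μ ν hμν c c'
  rw [hermiteEmbedding_apply, hermiteEmbedding_apply, inner_toLp_hermiteProd_smul,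
    hermiteCoeff_hermiteProd_smul, if_neg hμν.symm, inner_zero_right]

/-- Bessel's inequality for Hermite expansions. -/
theorem sum_norm_sq_hermiteCoeff_le {w : (ℕ → ℝ) → V} (hw : MemLp w 2 gaussianMeasure)
    (s : Finset (ℕ →₀ ℕ)) :
    ∑ ν ∈ s, ‖hermiteCoeff w ν‖ ^ 2 ≤ ‖hw.toLp w‖ ^ 2 := by
  have h1 := orthogonalFamily_hermiteEmbedding.norm_sum (fun ν => hermiteCoeff w ν) s
  have h2 : ⟪∑ ν ∈ s, hermiteEmbedding ν (hermiteCoeff w ν), hw.toLp w⟫_ℝ =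
      ∑ ν ∈ s, ‖hermiteCoeff w ν‖ ^ 2 := by
    rw [sum_inner]
    refine Finset.sum_congr rfl fun ν _ => ?_
    rw [hermiteEmbedding_apply, inner_toLp_hermiteProd_smul, real_inner_self_eq_norm_sq]
  have h3 := norm_sub_sq_real (hw.toLp w) (∑ ν ∈ s, hermiteEmbedding ν (hermiteCoeff w ν))
  rw [real_inner_comm, h2, h1] at h3
  nlinarith [sq_nonneg ‖hw.toLp w - ∑ ν ∈ s, hermiteEmbedding ν (hermiteCoeff w ν)‖]

theorem summable_norm_sq_hermiteCoeff {w : (ℕ → ℝ) → V} (hw : MemLp w 2 gaussianMeasure) :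
    Summable fun ν => ‖hermiteCoeff w ν‖ ^ 2 :=
  summable_of_sum_le (fun _ => sq_nonneg _) (sum_norm_sq_hermiteCoeff_le hw)

/-- Parseval's identity for Hermite expansions. -/
theorem hasSum_norm_sq_hermiteCoeff {w : (ℕ → ℝ) → V} (hw : MemLp w 2 gaussianMeasure) :
    HasSum (fun ν => ‖hermiteCoeff w ν‖ ^ 2) (‖hw.toLp w‖ ^ 2) := by
  have hO := orthogonalFamily_hermiteEmbedding (V := V)
  have hS := (hO.summable_iff_norm_sq_summable fun ν => hermiteCoeff w ν).2
    (summable_norm_sq_hermiteCoeff hw)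
  obtain ⟨S, hS⟩ := hS
  have hzero : hw.toLp w - S = 0 := by
    have hR := Lp.memLp (hw.toLp w - S)
    have hR0 : ∀ ν, hermiteCoeff (hw.toLp w - S : Lp V 2 gaussianMeasure) ν = 0 := fun ν => by
      refine ext_inner_left ℝ fun c => ?_
      rw [← inner_toLp_hermiteProd_smul hR, Lp.toLp_coeFn, inner_sub_right,
        inner_toLp_hermiteProd_smul, inner_zero_right, sub_eq_zero]
      have h1 := hS.mapL (innerSL ℝ (hermiteEmbedding ν c))
      refine (HasSum.unique h1 ?_).symm
      have h2 : (fun μ => innerSL ℝ (hermiteEmbedding ν c)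
          (hermiteEmbedding μ (hermiteCoeff w μ))) =
          fun μ => if μ = ν then ⟪c, hermiteCoeff w ν⟫_ℝ else 0 := by
        ext μ
        by_cases h : μ = ν
        · subst h
          rw [if_pos rfl, innerSL_apply_apply, LinearIsometry.inner_map_map]
        · rw [if_neg h, innerSL_apply_apply, hO (Ne.symm h)]
      rw [h2]
      exact hasSum_ite_eq ν _
    exact (Lp.eq_zero_iff_ae_eq_zero).2 (ae_eq_zero_of_hermiteCoeff hR hR0)
  rw [sub_eq_zero.1 hzero]
  have := (hS.norm.pow 2)
  refine this.congr fun s => ?_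
  exact hO.norm_sum (fun ν => hermiteCoeff w ν) s

theorem hermiteCoeff_sub_hermiteTruncation {w : (ℕ → ℝ) → V} (hw : MemLp w 2 gaussianMeasure)
    (Λ : Finset (ℕ →₀ ℕ)) (ν : ℕ →₀ ℕ) :
    hermiteCoeff (fun y => w y - hermiteTruncation w Λ y) ν =
      if ν ∈ Λ then 0 else hermiteCoeff w ν := by
  have h1 : hermiteCoeff (fun y => w y - hermiteTruncation w Λ y) ν =
      hermiteCoeff w ν - hermiteCoeff (hermiteTruncation w Λ) ν := by
    simp only [hermiteCoeff, smul_sub]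
    exact integral_sub (integrable_hermiteProd_smul hw ν)
      (integrable_hermiteProd_smul (memLp_hermiteTruncation w Λ) ν)
  have h2 : hermiteCoeff (hermiteTruncation w Λ) ν =
      ∑ μ ∈ Λ, hermiteCoeff (fun y => hermiteProd μ y • hermiteCoeff w μ) ν := by
    conv_lhs => rw [hermiteCoeff]
    simp only [hermiteTruncation, Finset.smul_sum]
    exact integral_finsetSum _ fun μ _ => integrable_hermiteProd_smul (memLp_hermiteProd_smul μ _) ν
  simp only [h1, h2, hermiteCoeff_hermiteProd_smul, Finset.sum_ite_eq']
  split_ifs <;> simp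

/-- The `L²` error of a Hermite truncation is the `ℓ²` norm of the omitted coefficients. -/
theorem eLpNorm_sub_hermiteTruncation {w : (ℕ → ℝ) → V} (hw : MemLp w 2 gaussianMeasure)
    (Λ : Finset (ℕ →₀ ℕ)) :
    eLpNorm (fun y => w y - hermiteTruncation w Λ y) 2 gaussianMeasure =
      ENNReal.ofReal (Real.sqrt (∑' ν, if ν ∈ Λ then 0 else ‖hermiteCoeff w ν‖ ^ 2)) := by
  have hR : MemLp (fun y => w y - hermiteTruncation w Λ y) 2 gaussianMeasure :=
    hw.sub (memLp_hermiteTruncation w Λ)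
  have h := hasSum_norm_sq_hermiteCoeff hR
  simp only [hermiteCoeff_sub_hermiteTruncation hw] at h
  have h' : (fun ν => if ν ∈ Λ then 0 else ‖hermiteCoeff w ν‖ ^ 2) =
      fun ν => ‖if ν ∈ Λ then 0 else hermiteCoeff w ν‖ ^ 2 := by
    ext ν; split_ifs <;> simp
  rw [h', h.tsum_eq, Real.sqrt_sq (norm_nonneg _), Lp.norm_toLp, ENNReal.ofReal_toReal hR.2.ne]

end Hilbert

/-! ### Sums and products over multi-indices -/

theorem prod_add_single_mul {M : Type*} [CommMonoid M] {h : ℕ → ℕ → M} (h0 : ∀ j, h j 0 = 1)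
    (ν : ℕ →₀ ℕ) (j : ℕ) :
    (ν + Finsupp.single j 1).prod h * h j (ν j) = ν.prod h * h j (ν j + 1) := by
  rw [← Finsupp.mul_prod_erase' ν j h h0, ← Finsupp.mul_prod_erase' (ν + _) j h h0,
    erase_add_single]
  simp only [Finsupp.add_apply, Finsupp.single_eq_same]
  rw [mul_assoc, mul_comm, mul_comm (Finsupp.prod _ _)]

/-- Sums of products over multi-indices supported in `s` are bounded by products of sums. -/
theorem sum_finsupp_prod_le {h : ℕ → ℕ → ℝ} (hpos : ∀ j k, 0 ≤ h j k) (h0 : ∀ j, h j 0 = 1)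
    {B : ℕ → ℝ} (hB : ∀ j, ∀ K : Finset ℕ, ∑ k ∈ K, h j k ≤ B j) (s : Finset ℕ)
    (F : Finset (ℕ →₀ ℕ)) (hF : ∀ ν ∈ F, ν.support ⊆ s) :
    ∑ ν ∈ F, ν.prod h ≤ ∏ j ∈ s, B j := by
  classical
  have hp : ∀ ν : ℕ →₀ ℕ, 0 ≤ ν.prod h := fun ν => Finset.prod_nonneg fun j _ => hpos _ _
  induction s using Finset.induction_on generalizing F with
  | empty =>
    have : F ⊆ {0} := fun ν hν => by
      have := hF ν hν
      rw [Finset.subset_empty, Finsupp.support_eq_empty] at this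
      simp [this]
    refine (Finset.sum_le_sum_of_subset_of_nonneg this fun ν _ _ => hp ν).trans ?_
    simp
  | insert a s ha ih =>
    rw [Finset.prod_insert ha]
    have hinj : Function.Injective fun ν : ℕ →₀ ℕ => (ν a, ν.erase a) := fun μ ν hμν => by
      simp only [Prod.mk.injEq] at hμν
      rw [← Finsupp.single_add_erase a μ, ← Finsupp.single_add_erase a ν, hμν.1, hμν.2]
    have hsub : F.image (fun ν : ℕ →₀ ℕ => (ν a, ν.erase a)) ⊆
        F.image (fun ν => ν a) ×ˢ F.image (fun ν => ν.erase a) := by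
      intro x hx
      obtain ⟨ν, hν, rfl⟩ := Finset.mem_image.1 hx
      exact Finset.mem_product.2
        ⟨Finset.mem_image_of_mem _ hν, Finset.mem_image_of_mem (fun ν : ℕ →₀ ℕ => ν.erase a) hν⟩
    calc ∑ ν ∈ F, ν.prod h = ∑ ν ∈ F, h a (ν a) * (ν.erase a).prod h :=
          Finset.sum_congr rfl fun ν _ => (Finsupp.mul_prod_erase' ν a h h0).symm
      _ = ∑ x ∈ F.image (fun ν : ℕ →₀ ℕ => (ν a, ν.erase a)), h a x.1 * x.2.prod h :=
          (Finset.sum_image (f := fun x : ℕ × (ℕ →₀ ℕ) => h a x.1 * x.2.prod h)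
            fun x _ y _ hxy => hinj hxy).symm
      _ ≤ ∑ x ∈ F.image (fun ν => ν a) ×ˢ F.image (fun ν => ν.erase a), h a x.1 * x.2.prod h :=
          Finset.sum_le_sum_of_subset_of_nonneg hsub fun x _ _ => mul_nonneg (hpos _ _) (hp _)
      _ = (∑ k ∈ F.image (fun ν => ν a), h a k) *
            ∑ ν ∈ F.image (fun ν => ν.erase a), ν.prod h := by
          rw [Finset.sum_product, Finset.sum_mul_sum]
      _ ≤ B a * ∏ j ∈ s, B j := by
          have h1 := hB a (F.image fun ν => ν a)
          refine mul_le_mul h1 (ih _ fun ν hν => ?_) (Finset.sum_nonneg fun ν _ => hp ν)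
            ((Finset.sum_nonneg fun k _ => hpos a k).trans h1)
          obtain ⟨μ, hμ, rfl⟩ := Finset.mem_image.1 hν
          intro i hi
          rw [Finsupp.support_erase, Finset.mem_erase] at hi
          exact (Finset.mem_insert.1 (hF μ hμ hi.2)).resolve_left hi.1

/-- The decompositions `μ = τ + ν` of a multi-index. -/
noncomputable abbrev splits (μ : ℕ →₀ ℕ) : Finset ((ℕ →₀ ℕ) × (ℕ →₀ ℕ)) :=
  Finset.HasAntidiagonal.antidiagonal μ

theorem sum_splits_add_single_fst {M : Type*} [AddCommGroup M] [Module ℝ M]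
    (G : (ℕ →₀ ℕ) → (ℕ →₀ ℕ) → M) (μ : ℕ →₀ ℕ) (j : ℕ) :
    ∑ x ∈ splits (μ + Finsupp.single j 1), (x.1 j : ℝ) • G x.1 x.2 =
      ∑ x ∈ splits μ, (x.1 j + 1 : ℝ) • G (x.1 + Finsupp.single j 1) x.2 := by
  symm
  refine Finset.sum_of_injOn (fun x => (x.1 + Finsupp.single j 1, x.2)) ?_ ?_ ?_ ?_
  · rintro ⟨a, b⟩ _ ⟨c, e⟩ _ h
    simp only [Prod.mk.injEq, add_left_inj] at h
    exact Prod.ext h.1 h.2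
  · rintro ⟨a, b⟩ h
    simp only [Finset.mem_coe, Finset.HasAntidiagonal.mem_antidiagonal] at h ⊢
    rw [← h, add_right_comm]
  · rintro ⟨a, b⟩ h hn
    rw [Finset.HasAntidiagonal.mem_antidiagonal] at h
    have : a j = 0 := by
      by_contra hj
      have hle : Finsupp.single j 1 ≤ a := by
        rw [Finsupp.single_le_iff]; exact Nat.one_le_iff_ne_zero.2 hj
      refine hn ⟨(a - Finsupp.single j 1, b), ?_, ?_⟩
      · simp only [Finset.mem_coe, Finset.HasAntidiagonal.mem_antidiagonal]
        have h' := h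
        simp only at h'
        rw [← tsub_add_cancel_of_le hle, add_right_comm] at h'
        exact add_right_cancel h'
      · simp [tsub_add_cancel_of_le hle]
    simp [this]
  · rintro ⟨a, b⟩ _
    simp

theorem sum_splits_add_single_snd {M : Type*} [AddCommGroup M] [Module ℝ M]
    (G : (ℕ →₀ ℕ) → (ℕ →₀ ℕ) → M) (μ : ℕ →₀ ℕ) (j : ℕ) :
    ∑ x ∈ splits (μ + Finsupp.single j 1), (x.2 j : ℝ) • G x.1 x.2 =
      ∑ x ∈ splits μ, (x.2 j + 1 : ℝ) • G x.1 (x.2 + Finsupp.single j 1) := by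
  have h := sum_splits_add_single_fst (fun a b => G b a) μ j
  rw [splits, splits, ← Finset.HasAntidiagonal.map_swap_antidiagonal (n := μ + _),
    ← Finset.HasAntidiagonal.map_swap_antidiagonal (n := μ), Finset.sum_map, Finset.sum_map]
  exact h

theorem mem_splits_erase {μ : ℕ →₀ ℕ} {x : (ℕ →₀ ℕ) × (ℕ →₀ ℕ)}
    (hx : x ∈ (splits μ).erase (0, μ)) : x.1 ≠ 0 ∧ x.2 < μ := by
  rw [Finset.mem_erase, Finset.HasAntidiagonal.mem_antidiagonal] at hx
  have h1 : x.1 ≠ 0 := fun h0 => hx.1 (Prod.ext h0 (by simpa [h0] using hx.2))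
  refine ⟨h1, lt_of_le_of_ne (hx.2 ▸ le_add_self) fun h => h1 ?_⟩
  have := hx.2
  rw [h] at this
  exact add_eq_right.1 this

theorem sum_splits_erase {M : Type*} [AddCommMonoid M]
    (G : (ℕ →₀ ℕ) × (ℕ →₀ ℕ) → M) (μ : ℕ →₀ ℕ) :
    ∑ x ∈ splits μ, G x =
      G (0, μ) + ∑ x ∈ (splits μ).erase (0, μ), G x :=
  (Finset.add_sum_erase _ _ (by simp)).symm

/-- A Schur test for convolutions over multi-indices `≤ m`. -/
theorem schur_splits {κ a : (ℕ →₀ ℕ) → ℝ} (hκ : ∀ τ, 0 ≤ κ τ) (m : ℕ →₀ ℕ)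
    (hsum : ∑ τ ∈ (Finset.Iic m).erase 0, κ τ ≤ 1 / 2) :
    ∑ μ ∈ Finset.Iic m, ∑ x ∈ (splits μ).erase (0, μ), κ x.1 * (a x.2 * a μ) ≤
      1 / 2 * ∑ μ ∈ Finset.Iic m, a μ ^ 2 := by
  have hmem : ∀ μ ∈ Finset.Iic m, ∀ x ∈ (splits μ).erase (0, μ),
      x.1 ∈ (Finset.Iic m).erase 0 ∧ x.2 ∈ Finset.Iic m ∧ x.1 + x.2 = μ := by
    intro μ hμ x hx
    obtain ⟨h1, h2⟩ := mem_splits_erase hx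
    rw [Finset.mem_erase, Finset.HasAntidiagonal.mem_antidiagonal] at hx
    rw [Finset.mem_Iic] at hμ
    refine ⟨Finset.mem_erase.2 ⟨h1, Finset.mem_Iic.2 (le_trans ?_ hμ)⟩,
      Finset.mem_Iic.2 (h2.le.trans hμ), hx.2⟩
    rw [← hx.2]; exact le_self_add
  have e1 : ∑ μ ∈ Finset.Iic m, ∑ x ∈ (splits μ).erase (0, μ), κ x.1 * a μ ^ 2 ≤
      ∑ μ ∈ Finset.Iic m, 1 / 2 * a μ ^ 2 := by
    refine Finset.sum_le_sum fun μ hμ => ?_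
    rw [← Finset.sum_mul]
    refine mul_le_mul_of_nonneg_right (le_trans ?_ hsum) (sq_nonneg _)
    have hinj : Set.InjOn Prod.fst
        ((splits μ).erase (0, μ) : Set ((ℕ →₀ ℕ) × (ℕ →₀ ℕ))) := by
      intro x hx y hy hxy
      have h1 := (hmem μ hμ x hx).2.2
      have h2 := (hmem μ hμ y hy).2.2
      rw [hxy, ← h2] at h1
      exact Prod.ext hxy (add_left_cancel h1)
    rw [← Finset.sum_image (f := κ) hinj]
    refine Finset.sum_le_sum_of_subset_of_nonneg (fun τ hτ => ?_) fun τ _ _ => hκ τ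
    obtain ⟨x, hx, rfl⟩ := Finset.mem_image.1 hτ
    exact (hmem μ hμ x hx).1
  have e2 : ∑ μ ∈ Finset.Iic m, ∑ x ∈ (splits μ).erase (0, μ), κ x.1 * a x.2 ^ 2 ≤
      ∑ μ ∈ Finset.Iic m, 1 / 2 * a μ ^ 2 := by
    have : ∑ x ∈ (Finset.Iic m).erase 0 ×ˢ Finset.Iic m, κ x.1 * a x.2 ^ 2 ≤
        ∑ μ ∈ Finset.Iic m, 1 / 2 * a μ ^ 2 := by
      rw [Finset.sum_product_right]
      refine Finset.sum_le_sum fun ν _ => ?_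
      simp only [← Finset.sum_mul]
      exact mul_le_mul_of_nonneg_right hsum (sq_nonneg _)
    refine le_trans ?_ this
    rw [Finset.sum_sigma']
    have hinj : Set.InjOn (fun z : (_ : ℕ →₀ ℕ) × ((ℕ →₀ ℕ) × (ℕ →₀ ℕ)) => z.2)
        ((Finset.Iic m).sigma fun μ => (splits μ).erase (0, μ) :
          Finset ((_ : ℕ →₀ ℕ) × ((ℕ →₀ ℕ) × (ℕ →₀ ℕ)))) := by
      rintro ⟨μ, x⟩ hx ⟨ν, y⟩ hy hxy
      simp only [Finset.mem_coe, Finset.mem_sigma] at hx hy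
      have h1 := (hmem μ hx.1 x hx.2).2.2
      have h2 := (hmem ν hy.1 y hy.2).2.2
      simp only at hxy
      subst hxy
      rw [h1] at h2
      subst h2
      rfl
    rw [← Finset.sum_image (f := fun x : (ℕ →₀ ℕ) × (ℕ →₀ ℕ) => κ x.1 * a x.2 ^ 2) hinj]
    refine Finset.sum_le_sum_of_subset_of_nonneg (fun x hx => ?_)
      fun x _ _ => mul_nonneg (hκ _) (sq_nonneg _)
    obtain ⟨⟨μ, x⟩, hx', rfl⟩ := Finset.mem_image.1 hx
    rw [Finset.mem_sigma] at hx'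
    have := hmem μ hx'.1 x hx'.2
    exact Finset.mem_product.2 ⟨this.1, this.2.1⟩
  have e3 : ∑ μ ∈ Finset.Iic m, ∑ x ∈ (splits μ).erase (0, μ),
      κ x.1 * (a x.2 * a μ) ≤ ∑ μ ∈ Finset.Iic m, ∑ x ∈ (splits μ).erase (0, μ),
      (1 / 2 * (κ x.1 * a x.2 ^ 2) + 1 / 2 * (κ x.1 * a μ ^ 2)) := by
    refine Finset.sum_le_sum fun μ _ => Finset.sum_le_sum fun x _ => ?_
    nlinarith [mul_nonneg (hκ x.1) (sq_nonneg (a x.2 - a μ))]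
  refine e3.trans ?_
  simp only [Finset.sum_add_distrib, ← Finset.mul_sum] at e1 e2 ⊢
  linarith

/-! ### Inverses of formal power series depending on a parameter -/

section PowerSeries

variable {R : Type*} [NormedRing R]

theorem isUnit_coeff_zero {S : MvPowerSeries ℕ R}
    (hu : IsUnit (MvPowerSeries.coeff 0 S)) : IsUnit S := by
  rw [MvPowerSeries.isUnit_iff_constantCoeff, ← MvPowerSeries.coeff_zero_eq_constantCoeff_apply]
  exact hu

theorem sum_coeff_mul_coeff_inverse {S : MvPowerSeries ℕ R}
    (hu : IsUnit (MvPowerSeries.coeff 0 S)) (μ : ℕ →₀ ℕ) :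
    ∑ x ∈ splits μ,
      MvPowerSeries.coeff x.1 S * MvPowerSeries.coeff x.2 (Ring.inverse S) =
      if μ = 0 then 1 else 0 := by
  classical
  rw [← MvPowerSeries.coeff_mul, Ring.mul_inverse_cancel _ (isUnit_coeff_zero hu),
    MvPowerSeries.coeff_one]

theorem coeff_inverse {S : MvPowerSeries ℕ R}
    (hu : IsUnit (MvPowerSeries.coeff 0 S)) (μ : ℕ →₀ ℕ) :
    MvPowerSeries.coeff μ (Ring.inverse S) = Ring.inverse (MvPowerSeries.coeff 0 S) *
      ((if μ = 0 then 1 else 0) - ∑ x ∈ (splits μ).erase (0, μ),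
        MvPowerSeries.coeff x.1 S * MvPowerSeries.coeff x.2 (Ring.inverse S)) := by
  rw [← sum_coeff_mul_coeff_inverse hu μ, sum_splits_erase, add_sub_cancel_right,
    Ring.inverse_mul_cancel_left _ _ hu]

theorem continuous_coeff_inverse [HasSummableGeomSeries R] {X : Type*} [TopologicalSpace X]
    {S : X → MvPowerSeries ℕ R} (hu : ∀ t, IsUnit (MvPowerSeries.coeff 0 (S t)))
    (hS : ∀ τ, Continuous fun t => MvPowerSeries.coeff τ (S t)) (μ : ℕ →₀ ℕ) :
    Continuous fun t => MvPowerSeries.coeff μ (Ring.inverse (S t)) := by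
  induction μ using (Finsupp.lt_wf ℕ).induction with
  | _ μ ih =>
  simp only [fun t => coeff_inverse (hu t) μ]
  refine Continuous.mul ?_ (continuous_const.sub (continuous_finsetSum _ fun x hx =>
    (hS _).mul (ih _ (mem_splits_erase hx).2)))
  refine continuous_iff_continuousAt.2 fun t => ?_
  obtain ⟨u, hu⟩ := hu t
  refine ContinuousAt.comp (f := fun t => MvPowerSeries.coeff 0 (S t)) (g := Ring.inverse) ?_
    (hS 0).continuousAt
  rw [← hu]
  exact NormedRing.inverse_continuousAt u

/-- If `S_t` is the formal Taylor series at the point `t` (in the direction `j`) of a function, then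
its inverse is the formal Taylor series of the inverse function. -/
theorem hasDerivAt_coeff_inverse [NormedAlgebra ℝ R] [HasSummableGeomSeries R]
    {S : ℝ → MvPowerSeries ℕ R} (j : ℕ)
    (hu : ∀ t, IsUnit (MvPowerSeries.coeff 0 (S t)))
    (hS : ∀ τ t, HasDerivAt (fun t => MvPowerSeries.coeff τ (S t))
      ((τ j + 1 : ℝ) • MvPowerSeries.coeff (τ + Finsupp.single j 1) (S t)) t) (μ : ℕ →₀ ℕ)
    (t : ℝ) : HasDerivAt (fun t => MvPowerSeries.coeff μ (Ring.inverse (S t)))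
      ((μ j + 1 : ℝ) • MvPowerSeries.coeff (μ + Finsupp.single j 1) (Ring.inverse (S t))) t := by
  induction μ using (Finsupp.lt_wf ℕ).induction with
  | _ μ ih =>
  have hdiff : DifferentiableAt ℝ (fun t => MvPowerSeries.coeff μ (Ring.inverse (S t))) t := by
    simp only [fun t => coeff_inverse (hu t) μ]
    refine DifferentiableAt.mul ?_ (DifferentiableAt.sub (differentiableAt_const _)
      (DifferentiableAt.fun_sum fun x hx =>
        ((hS _ t).differentiableAt.mul (ih _ (mem_splits_erase hx).2).differentiableAt)))
    obtain ⟨u, hu⟩ := hu t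
    refine DifferentiableAt.comp t (f := fun t => MvPowerSeries.coeff 0 (S t))
      (g := Ring.inverse) ?_ (hS 0 t).differentiableAt
    rw [← hu]
    exact (hasFDerivAt_ringInverse (𝕜 := ℝ) u).differentiableAt
  obtain ⟨e, he⟩ : ∃ e, HasDerivAt (fun t => MvPowerSeries.coeff μ (Ring.inverse (S t))) e t :=
    ⟨_, hdiff.hasDerivAt⟩
  refine he.congr_deriv ?_
  -- differentiate the relation `∑ S_τ J_ν = δ` between the coefficients of `S` and `J = S⁻¹`
  have h1 : HasDerivAt (fun t => ∑ x ∈ splits μ,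
      MvPowerSeries.coeff x.1 (S t) * MvPowerSeries.coeff x.2 (Ring.inverse (S t)))
      (((0 : ℕ →₀ ℕ) j + 1 : ℝ) • MvPowerSeries.coeff (0 + Finsupp.single j 1) (S t) *
          MvPowerSeries.coeff μ (Ring.inverse (S t)) +
        MvPowerSeries.coeff 0 (S t) * e +
        ∑ x ∈ (splits μ).erase (0, μ),
          ((x.1 j + 1 : ℝ) • MvPowerSeries.coeff (x.1 + Finsupp.single j 1) (S t) *
            MvPowerSeries.coeff x.2 (Ring.inverse (S t)) +
          MvPowerSeries.coeff x.1 (S t) * ((x.2 j + 1 : ℝ) •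
            MvPowerSeries.coeff (x.2 + Finsupp.single j 1) (Ring.inverse (S t))))) t := by
    simp only [sum_splits_erase]
    exact ((hS 0 t).mul he).add (HasDerivAt.fun_sum fun x hx =>
      (hS x.1 t).mul (ih _ (mem_splits_erase hx).2))
  simp only [sum_coeff_mul_coeff_inverse (hu _)] at h1
  have h2 := h1.unique (hasDerivAt_const t _)
  -- compare with the same relation one order higher
  have h3 := sum_coeff_mul_coeff_inverse (hu t) (μ + Finsupp.single j 1)
  rw [if_neg (by simp)] at h3
  have h4 : ∑ x ∈ splits (μ + Finsupp.single j 1), ((x.1 j : ℝ) •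
      (MvPowerSeries.coeff x.1 (S t) * MvPowerSeries.coeff x.2 (Ring.inverse (S t))) +
      (x.2 j : ℝ) •
      (MvPowerSeries.coeff x.1 (S t) * MvPowerSeries.coeff x.2 (Ring.inverse (S t)))) = 0 := by
    rw [← smul_zero ((μ j : ℝ) + 1), ← h3, Finset.smul_sum]
    refine Finset.sum_congr rfl fun x hx => ?_
    rw [← add_smul]
    congr 1
    have := DFunLike.congr_fun (Finset.HasAntidiagonal.mem_antidiagonal.1 hx) j
    simp only [Finsupp.add_apply, Finsupp.single_eq_same] at this
    exact_mod_cast this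
  rw [Finset.sum_add_distrib, sum_splits_add_single_fst (fun a b =>
      MvPowerSeries.coeff a (S t) * MvPowerSeries.coeff b (Ring.inverse (S t))),
    sum_splits_add_single_snd (fun a b =>
      MvPowerSeries.coeff a (S t) * MvPowerSeries.coeff b (Ring.inverse (S t))),
    ← Finset.sum_add_distrib, sum_splits_erase] at h4
  simp only [smul_mul_assoc, mul_smul_comm] at h2 h4
  have h5 : MvPowerSeries.coeff 0 (S t) * e = MvPowerSeries.coeff 0 (S t) *
      ((μ j + 1 : ℝ) • MvPowerSeries.coeff (μ + Finsupp.single j 1) (Ring.inverse (S t))) := by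
    rw [mul_smul_comm]
    have := h2.trans h4.symm
    exact add_left_cancel (add_right_cancel this)
  exact (hu t).mul_left_cancel h5

end PowerSeries

/-! ### Coefficients in `L^∞(D)` -/

section Coefficients

variable {d : ℕ} {D : BoundedOpenSet d}

theorem ae_abs_le_norm (b : LInf D) : ∀ᵐ x ∂D.measure, |b x| ≤ ‖b‖ := by
  have h := (Lp.memLp b).2.ne
  filter_upwards [ae_le_eLpNormEssSup (f := b) (μ := D.measure)] with x hx
  rw [← eLpNorm_exponent_top, ← ENNReal.ofReal_toReal h, ← Lp.norm_def,
    Real.enorm_eq_ofReal_abs] at hx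
  exact (ENNReal.ofReal_le_ofReal_iff (norm_nonneg _)).1 hx

theorem norm_le_of_ae_abs_le {b : LInf D} {C : ℝ} (hC : 0 ≤ C)
    (h : ∀ᵐ x ∂D.measure, |b x| ≤ C) : ‖b‖ ≤ C := by
  rw [Lp.norm_def, eLpNorm_exponent_top]
  refine ENNReal.toReal_le_of_le_ofReal hC (eLpNormEssSup_le_of_ae_bound ?_)
  simpa using h

/-- The function `∏_j ψ_j^{τ_j} / τ_j!`. -/
noncomputable def taylorMonomial (ψ : ℕ → LInf D) (τ : ℕ →₀ ℕ) (x : EuclideanSpace ℝ (Fin d)) : ℝ :=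
  τ.prod fun j k => ψ j x ^ k / k.factorial

theorem taylorMonomial_zero (ψ : ℕ → LInf D) (x : EuclideanSpace ℝ (Fin d)) :
    taylorMonomial ψ 0 x = 1 := by simp [taylorMonomial]

theorem mul_taylorMonomial (ψ : ℕ → LInf D) (τ : ℕ →₀ ℕ) (j : ℕ)
    (x : EuclideanSpace ℝ (Fin d)) :
    ψ j x * taylorMonomial ψ τ x =
      (τ j + 1) * taylorMonomial ψ (τ + Finsupp.single j 1) x := by
  have h : ∀ ν : ℕ →₀ ℕ, taylorMonomial ψ ν x =
      ψ j x ^ ν j / (ν j).factorial * taylorMonomial ψ (ν.erase j) x := fun ν =>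
    (Finsupp.mul_prod_erase' ν j (fun j k => ψ j x ^ k / (k.factorial : ℝ)) (by simp)).symm
  rw [h τ, h (τ + Finsupp.single j 1), erase_add_single]
  simp only [Finsupp.add_apply, Finsupp.single_eq_same, Nat.factorial_succ, pow_succ]
  push_cast
  field_simp

theorem abs_taylorMonomial (ψ : ℕ → LInf D) (τ : ℕ →₀ ℕ) (x : EuclideanSpace ℝ (Fin d)) :
    |taylorMonomial ψ τ x| = τ.prod fun j k => |ψ j x| ^ k / k.factorial := by
  rw [taylorMonomial, Finsupp.prod, Finset.abs_prod]
  refine Finset.prod_congr rfl fun j _ => ?_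
  rw [abs_div, abs_pow, Nat.abs_cast]

theorem aestronglyMeasurable_taylorMonomial (ψ : ℕ → LInf D) (τ : ℕ →₀ ℕ) :
    AEStronglyMeasurable (taylorMonomial ψ τ) D.measure := by
  refine Finset.aestronglyMeasurable_fun_prod _ fun j _ => ?_
  exact ((Lp.aestronglyMeasurable (ψ j)).pow _).mul_const _

theorem exists_ae_abs_taylorMonomial_le (ψ : ℕ → LInf D) (τ : ℕ →₀ ℕ) :
    ∃ C : ℝ, 0 ≤ C ∧ ∀ᵐ x ∂D.measure, |taylorMonomial ψ τ x| ≤ C := by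
  refine ⟨τ.prod fun j k => ‖ψ j‖ ^ k / k.factorial,
    Finset.prod_nonneg fun j _ => by positivity, ?_⟩
  have : ∀ᵐ x ∂D.measure, ∀ j, |ψ j x| ≤ ‖ψ j‖ := ae_all_iff.2 fun j => ae_abs_le_norm (ψ j)
  filter_upwards [this] with x hx
  rw [abs_taylorMonomial]
  refine Finset.prod_le_prod (fun j _ => by positivity) fun j _ => ?_
  exact div_le_div_of_nonneg_right (pow_le_pow_left₀ (abs_nonneg _) (hx j) _) (by positivity)

theorem memLp_exp_mul_taylorMonomial (ψ : ℕ → LInf D) (b : LInf D) (τ : ℕ →₀ ℕ) :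
    MemLp (fun x => Real.exp (b x) * taylorMonomial ψ τ x) ∞ D.measure := by
  obtain ⟨C, hC, h⟩ := exists_ae_abs_taylorMonomial_le ψ τ
  refine memLp_top_of_bound ((Real.continuous_exp.comp_aestronglyMeasurable
    (Lp.aestronglyMeasurable b)).mul (aestronglyMeasurable_taylorMonomial ψ τ))
    (Real.exp ‖b‖ * C) ?_
  filter_upwards [h, ae_abs_le_norm b] with x h1 h2
  rw [norm_mul, Real.norm_eq_abs, Real.norm_eq_abs, Real.abs_exp]
  have := (le_abs_self _).trans h2
  gcongr

/-- The Taylor coefficients `e^b ∏_j ψ_j^{τ_j} / τ_j!` of `z ↦ exp (b + ∑_j z_j ψ_j)`. -/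
noncomputable def taylorCoeff (ψ : ℕ → LInf D) (b : LInf D) (τ : ℕ →₀ ℕ) : LInf D :=
  (memLp_exp_mul_taylorMonomial ψ b τ).toLp _

theorem coeFn_taylorCoeff (ψ : ℕ → LInf D) (b : LInf D) (τ : ℕ →₀ ℕ) :
    taylorCoeff ψ b τ =ᵐ[D.measure] fun x => Real.exp (b x) * taylorMonomial ψ τ x :=
  MemLp.coeFn_toLp _

theorem continuous_taylorCoeff (ψ : ℕ → LInf D) (τ : ℕ →₀ ℕ) :
    Continuous fun b => taylorCoeff ψ b τ := by
  obtain ⟨C, hC, hm⟩ := exists_ae_abs_taylorMonomial_le ψ τ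
  refine continuous_iff_continuousAt.2 fun b => ?_
  have hbd : ∀ᶠ b' in 𝓝 b, ‖taylorCoeff ψ b' τ - taylorCoeff ψ b τ‖ ≤
      Real.exp ‖b‖ * (2 * ‖b' - b‖) * C := by
    filter_upwards [Metric.ball_mem_nhds b one_pos] with b' hb'
    rw [Metric.mem_ball, dist_eq_norm] at hb'
    refine norm_le_of_ae_abs_le (by positivity) ?_
    filter_upwards [Lp.coeFn_sub (taylorCoeff ψ b' τ) (taylorCoeff ψ b τ), coeFn_taylorCoeff ψ b τ,
      coeFn_taylorCoeff ψ b' τ, hm, ae_abs_le_norm b, ae_abs_le_norm (b' - b),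
      Lp.coeFn_sub b' b] with x h1 h2 h3 h4 h5 h6 h7
    rw [h7, Pi.sub_apply] at h6
    rw [h1, Pi.sub_apply, h2, h3, ← sub_mul, abs_mul]
    have e1 : Real.exp (b' x) - Real.exp (b x) =
        Real.exp (b x) * (Real.exp (b' x - b x) - 1) := by
      rw [mul_sub, ← Real.exp_add]; ring_nf
    have e2 := Real.abs_exp_sub_one_le (x := b' x - b x) (h6.trans hb'.le)
    have e3 := (le_abs_self _).trans h5
    rw [e1, abs_mul, Real.abs_exp]
    have e4 : |Real.exp (b' x - b x) - 1| ≤ 2 * ‖b' - b‖ := by linarith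
    gcongr
  rw [ContinuousAt, tendsto_iff_norm_sub_tendsto_zero]
  refine squeeze_zero' (Eventually.of_forall fun _ => norm_nonneg _) hbd ?_
  have : Continuous fun b' => Real.exp ‖b‖ * (2 * ‖b' - b‖) * C := by fun_prop
  simpa using this.tendsto b

theorem hasDerivAt_taylorCoeff (ψ : ℕ → LInf D) (b : LInf D) (j : ℕ) (τ : ℕ →₀ ℕ) (t : ℝ) :
    HasDerivAt (fun t : ℝ => taylorCoeff ψ (b + t • ψ j) τ)
      ((τ j + 1 : ℝ) • taylorCoeff ψ (b + t • ψ j) (τ + Finsupp.single j 1)) t := by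
  obtain ⟨C, hC, hm⟩ := exists_ae_abs_taylorMonomial_le ψ τ
  set b₀ := b + t • ψ j with hb₀
  rw [hasDerivAt_iff_isLittleO_nhds_zero]
  have hbd : (fun h : ℝ => taylorCoeff ψ (b + (t + h) • ψ j) τ - taylorCoeff ψ b₀ τ -
      h • ((τ j + 1 : ℝ) • taylorCoeff ψ b₀ (τ + Finsupp.single j 1))) =O[𝓝 0]
      fun h : ℝ => h ^ 2 := by
    have hδ : (0 : ℝ) < 1 / (‖ψ j‖ + 1) := by positivity
    refine Asymptotics.IsBigO.of_bound (Real.exp ‖b₀‖ * ‖ψ j‖ ^ 2 * C) ?_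
    filter_upwards [Metric.ball_mem_nhds (0 : ℝ) hδ] with h hh
    rw [mem_ball_zero_iff, Real.norm_eq_abs, lt_div_iff₀ (by positivity)] at hh
    have hh' : |h| * ‖ψ j‖ ≤ 1 := by nlinarith [abs_nonneg h]
    refine norm_le_of_ae_abs_le (by positivity) ?_
    filter_upwards [Lp.coeFn_sub (taylorCoeff ψ (b + (t + h) • ψ j) τ - taylorCoeff ψ b₀ τ)
        (h • ((τ j + 1 : ℝ) • taylorCoeff ψ b₀ (τ + Finsupp.single j 1))),
      Lp.coeFn_sub (taylorCoeff ψ (b + (t + h) • ψ j) τ) (taylorCoeff ψ b₀ τ),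
      Lp.coeFn_smul h ((τ j + 1 : ℝ) • taylorCoeff ψ b₀ (τ + Finsupp.single j 1)),
      Lp.coeFn_smul (τ j + 1 : ℝ) (taylorCoeff ψ b₀ (τ + Finsupp.single j 1)),
      coeFn_taylorCoeff ψ b₀ τ, coeFn_taylorCoeff ψ (b + (t + h) • ψ j) τ,
      coeFn_taylorCoeff ψ b₀ (τ + Finsupp.single j 1), hm, ae_abs_le_norm b₀,
      ae_abs_le_norm (ψ j), Lp.coeFn_add b₀ (h • ψ j), Lp.coeFn_smul h (ψ j)]
      with x h1 h2 h3 h4 h5 h6 h7 h8 h9 h10 h11 h12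
    have hb : b + (t + h) • ψ j = b₀ + h • ψ j := by rw [hb₀, add_smul, add_assoc]
    rw [hb] at h6
    rw [h1, Pi.sub_apply, h2, h3, Pi.smul_apply, h4, Pi.smul_apply, Pi.sub_apply, hb, h6, h5, h7,
      h11, Pi.add_apply, h12, Pi.smul_apply]
    simp only [smul_eq_mul]
    have e1 : Real.exp (b₀ x + h * ψ j x) * taylorMonomial ψ τ x -
        Real.exp (b₀ x) * taylorMonomial ψ τ x - h * ((τ j + 1) *
          (Real.exp (b₀ x) * taylorMonomial ψ (τ + Finsupp.single j 1) x)) =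
        Real.exp (b₀ x) * (Real.exp (h * ψ j x) - 1 - h * ψ j x) * taylorMonomial ψ τ x := by
      rw [Real.exp_add]
      linear_combination (h * Real.exp (b₀ x)) * mul_taylorMonomial ψ τ j x
    have e2 : |h * ψ j x| ≤ |h| * ‖ψ j‖ := by rw [abs_mul]; gcongr
    have e3 := Real.abs_exp_sub_one_sub_id_le (e2.trans hh')
    have e4 : (h * ψ j x) ^ 2 ≤ (|h| * ‖ψ j‖) ^ 2 := by
      rw [← sq_abs]; gcongr
    have e5 := (le_abs_self _).trans h9
    rw [e1, abs_mul, abs_mul, Real.abs_exp, Real.norm_eq_abs, abs_pow]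
    calc Real.exp (b₀ x) * |Real.exp (h * ψ j x) - 1 - h * ψ j x| * |taylorMonomial ψ τ x|
        ≤ Real.exp ‖b₀‖ * (|h| * ‖ψ j‖) ^ 2 * C := by
          have := e3.trans e4
          gcongr
      _ = _ := by ring
  refine hbd.trans_isLittleO ?_
  simpa using Asymptotics.isLittleO_pow_id (𝕜 := ℝ) (n := 2) one_lt_two

/-- Multiplication of `L²` vector fields by bounded functions. -/
noncomputable def mulOp : LInf D →L[ℝ] L2Vec D →L[ℝ] L2Vec D :=
  (ContinuousLinearMap.lsmul ℝ ℝ : ℝ →L[ℝ] EuclideanSpace ℝ (Fin d) →L[ℝ] _).holderL D.measure ∞ 2 2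

theorem coeFn_mulOp (c : LInf D) (w : L2Vec D) :
    mulOp c w =ᵐ[D.measure] fun x => c x • w x :=
  ContinuousLinearMap.coeFn_holder (ContinuousLinearMap.lsmul ℝ ℝ) c w

theorem integrable_mul_inner (c : LInf D) (w v : L2Vec D) :
    Integrable (fun x => c x * ⟪w x, v x⟫_ℝ) D.measure := by
  refine (L2.integrable_inner (𝕜 := ℝ) (mulOp c w) v).congr ?_
  filter_upwards [coeFn_mulOp c w] with x hx
  rw [hx, real_inner_smul_left]

theorem norm_sq_eq_integral {V : Type*} [NormedAddCommGroup V] [InnerProductSpace ℝ V]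
    (G : V →ₗᵢ[ℝ] L2Vec D) (w : V) : ‖w‖ ^ 2 = ∫ x, ‖G w x‖ ^ 2 ∂D.measure := by
  rw [← G.norm_map, norm_sq_L2]

end Coefficients

/-! ### The diffusion operator with a bounded coefficient -/

section Operator

variable {d : ℕ} {D : BoundedOpenSet d}
  {V : Type*} [NormedAddCommGroup V] [InnerProductSpace ℝ V] [CompleteSpace V]

/-- The operator `-div (c ∇ ·)` from `V` to `V* ≅ V`, that is, `G* c G`, where the isometric
embedding `G` of the Hilbert space `V` into `L²(D; ℝ^d)` stands for the gradient. -/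
noncomputable def diffusionOp (G : V →ₗᵢ[ℝ] L2Vec D) : LInf D →L[ℝ] V →L[ℝ] V :=
  ((ContinuousLinearMap.compL ℝ V (L2Vec D) V
      (ContinuousLinearMap.adjoint G.toContinuousLinearMap)).comp
    ((ContinuousLinearMap.compL ℝ V (L2Vec D) (L2Vec D)).flip G.toContinuousLinearMap)).comp mulOp

variable (G : V →ₗᵢ[ℝ] L2Vec D) (ψ : ℕ → LInf D) (b : LInf D) (g : V)

theorem inner_diffusionOp (c : LInf D) (w v : V) :
    ⟪diffusionOp G c w, v⟫_ℝ = ∫ x, c x * ⟪G w x, G v x⟫_ℝ ∂D.measure := by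
  have : diffusionOp G c w = ContinuousLinearMap.adjoint
    G.toContinuousLinearMap (mulOp c (G w)) := rfl
  rw [this, ContinuousLinearMap.adjoint_inner_left, L2.inner_def]
  refine integral_congr_ae ?_
  filter_upwards [coeFn_mulOp c (G w)] with x hx
  rw [hx, real_inner_smul_left]
  rfl

/-- The operator of the lognormal equation is coercive, with constant `e^{-‖b‖}`. -/
theorem coercive_diffusionOp (w : V) :
    Real.exp (-‖b‖) * ‖w‖ ^ 2 ≤ ⟪diffusionOp G (taylorCoeff ψ b 0) w, w⟫_ℝ := by
  rw [inner_diffusionOp, norm_sq_eq_integral G, ← integral_const_mul]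
  have h1 : Integrable (fun x => ‖G w x‖ ^ 2) D.measure := by
    simpa using L2.integrable_inner (𝕜 := ℝ) (G w) (G w)
  refine integral_mono_ae (h1.const_mul _) (integrable_mul_inner _ _ _) ?_
  filter_upwards [coeFn_taylorCoeff ψ b 0, ae_abs_le_norm b] with x h2 h3
  rw [h2, taylorMonomial_zero, mul_one, real_inner_self_eq_norm_sq]
  have := (abs_le.1 h3).1
  gcongr

theorem isUnit_diffusionOp : IsUnit (diffusionOp G (taylorCoeff ψ b 0)) := by
  have hB : IsCoercive ((innerSL ℝ).comp (diffusionOp G (taylorCoeff ψ b 0))) := by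
    refine ⟨Real.exp (-‖b‖), Real.exp_pos _, fun w => ?_⟩
    have := coercive_diffusionOp G ψ b w
    simpa [mul_assoc, sq] using this
  refine ⟨ContinuousLinearEquiv.toUnit hB.continuousLinearEquivOfBilin, ?_⟩
  ext1 w
  refine ext_inner_right ℝ fun v => ?_
  exact hB.continuousLinearEquivOfBilin_apply w v

theorem inner_diffusionOp_taylorCoeff_zero (w v : V) :
    ⟪diffusionOp G (taylorCoeff ψ b 0) w, v⟫_ℝ =
      ∫ x, Real.exp (b x) * ⟪G w x, G v x⟫_ℝ ∂D.measure := by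
  rw [inner_diffusionOp]
  refine integral_congr_ae ?_
  filter_upwards [coeFn_taylorCoeff ψ b 0] with x hx
  rw [hx, taylorMonomial_zero, mul_one]

/-- The formal power series in `z` whose coefficients are the diffusion operators with coefficients
`e^b ∏_j ψ_j^{τ_j} / τ_j!`. -/
noncomputable def operatorSeries : MvPowerSeries ℕ (V →L[ℝ] V) :=
  fun τ => diffusionOp G (taylorCoeff ψ b τ)

theorem isUnit_coeff_operatorSeries :
    IsUnit (MvPowerSeries.coeff 0 (operatorSeries G ψ b)) := isUnit_diffusionOp G ψ b

/-- The Taylor coefficients in `z` of the solution with coefficient `exp (b + ∑_j z_j ψ_j)` and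
right-hand side `g`, that is, the partial derivatives `∂^μ u / μ!` of the solution map. They are
defined as the coefficients of the inverse of the formal power series of the operator. -/
noncomputable def solutionTaylor (μ : ℕ →₀ ℕ) : V :=
  MvPowerSeries.coeff μ (Ring.inverse (operatorSeries G ψ b)) g

theorem sum_splits_diffusionOp (μ : ℕ →₀ ℕ) :
    ∑ x ∈ splits μ, diffusionOp G (taylorCoeff ψ b x.1) (solutionTaylor G ψ b g x.2) =
      if μ = 0 then g else 0 := by
  have h := congrArg (fun A : V →L[ℝ] V => A g)
    (sum_coeff_mul_coeff_inverse (isUnit_coeff_operatorSeries G ψ b) μ)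
  simp only [sum_apply] at h
  rw [show (if μ = 0 then g else 0) = (if μ = 0 then (1 : V →L[ℝ] V) else 0) g by
    split_ifs <;> rfl, ← h]
  rfl

theorem diffusionOp_solutionTaylor_zero :
    diffusionOp G (taylorCoeff ψ b 0) (solutionTaylor G ψ b g 0) = g := by
  simpa [splits] using sum_splits_diffusionOp G ψ b g 0

theorem diffusionOp_injective : Function.Injective (diffusionOp G (taylorCoeff ψ b 0)) := by
  obtain ⟨u, hu⟩ := isUnit_diffusionOp G ψ b
  have hinj : ∀ v : V, (↑u⁻¹ : V →L[ℝ] V) ((u : V →L[ℝ] V) v) = v :=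
    fun v => congrArg (fun A : V →L[ℝ] V => A v) u.inv_mul
  rw [← hu]
  exact Function.LeftInverse.injective hinj

theorem continuous_solutionTaylor (μ : ℕ →₀ ℕ) :
    Continuous fun b => solutionTaylor G ψ b g μ := by
  have := continuous_coeff_inverse (S := operatorSeries G ψ)
    (fun b => isUnit_coeff_operatorSeries G ψ b)
    (fun τ => (diffusionOp G).continuous.comp (continuous_taylorCoeff ψ τ)) μ
  exact this.clm_apply continuous_const

theorem hasDerivAt_solutionTaylor (μ : ℕ →₀ ℕ) (j : ℕ) (t : ℝ) :
    HasDerivAt (fun t : ℝ => solutionTaylor G ψ (b + t • ψ j) g μ)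
      ((μ j + 1 : ℝ) • solutionTaylor G ψ (b + t • ψ j) g (μ + Finsupp.single j 1)) t := by
  have := hasDerivAt_coeff_inverse (S := fun t : ℝ => operatorSeries G ψ (b + t • ψ j)) j
    (fun t => isUnit_coeff_operatorSeries G ψ _) (fun τ t => by
      have h := (diffusionOp G).hasFDerivAt (x := taylorCoeff ψ (b + t • ψ j) τ)
        |>.comp_hasDerivAt t (hasDerivAt_taylorCoeff ψ b j τ t)
      rw [map_smul] at h
      exact h) μ t
  exact this.clm_apply (hasDerivAt_const t _) |>.congr_deriv (by simp [solutionTaylor])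

theorem norm_solutionTaylor_zero_le : ‖solutionTaylor G ψ b g 0‖ ≤ Real.exp ‖b‖ * ‖g‖ := by
  have h1 := coercive_diffusionOp G ψ b (solutionTaylor G ψ b g 0)
  rw [diffusionOp_solutionTaylor_zero] at h1
  have h2 := real_inner_le_norm g (solutionTaylor G ψ b g 0)
  rcases (norm_nonneg (solutionTaylor G ψ b g 0)).eq_or_lt with h0 | h0
  · rw [← h0]; positivity
  · have h3 : Real.exp (-‖b‖) * ‖solutionTaylor G ψ b g 0‖ ≤ ‖g‖ := by
      refine le_of_mul_le_mul_right ?_ h0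
      calc _ = Real.exp (-‖b‖) * ‖solutionTaylor G ψ b g 0‖ ^ 2 := by ring
        _ ≤ _ := h1.trans h2
    rwa [Real.exp_neg, inv_mul_le_iff₀ (Real.exp_pos _)] at h3

end Operator

/-! ### The weighted estimate of the derivatives -/

/-- The weight `∏_j μ_j! ρ_j^{2 μ_j}` of the Taylor coefficient of order `μ`. -/
noncomputable def taylorWeight (ρ : ℕ → ℝ) (μ : ℕ →₀ ℕ) : ℝ :=
  μ.prod fun j k => (k.factorial : ℝ) * ρ j ^ (2 * k)

theorem taylorWeight_zero (ρ : ℕ → ℝ) : taylorWeight ρ 0 = 1 := by simp [taylorWeight]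

theorem taylorWeight_pos {ρ : ℕ → ℝ} (hρ : ∀ j, 0 < ρ j) (μ : ℕ →₀ ℕ) : 0 < taylorWeight ρ μ :=
  Finset.prod_pos fun j _ => mul_pos (by positivity) (pow_pos (hρ j) _)

theorem taylorWeight_add_single {ρ : ℕ → ℝ} (hρ : ∀ j, 0 < ρ j) (μ : ℕ →₀ ℕ) (j : ℕ) :
    taylorWeight ρ (μ + Finsupp.single j 1) = (μ j + 1) * ρ j ^ 2 * taylorWeight ρ μ := by
  have h := prod_add_single_mul (h := fun j k => (k.factorial : ℝ) * ρ j ^ (2 * k)) (by simp) μ j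
  have hpos : 0 < ((μ j).factorial : ℝ) * ρ j ^ (2 * μ j) :=
    mul_pos (by positivity) (pow_pos (hρ j) _)
  refine mul_right_cancel₀ hpos.ne' (h.trans ?_)
  simp only [Nat.factorial_succ, taylorWeight, Nat.mul_add, pow_add]
  push_cast
  ring

/-- Passing from the weight of `ν` to that of `ν + τ` costs a factor at most `r` for each factorial; this
is where the bound `r` on the order of differentiation in each variable enters. -/
theorem taylorWeight_add_le {ρ : ℕ → ℝ} (hρ : ∀ j, 0 < ρ j) {r : ℕ} (ν τ : ℕ →₀ ℕ)
    (h : ∀ j, (ν + τ) j ≤ r) :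
    taylorWeight ρ (ν + τ) ≤
      taylorWeight ρ ν * (τ.prod fun j k => (Real.sqrt r * ρ j) ^ k) ^ 2 := by
  induction τ using induction_add_single with
  | h0 => simp
  | h1 τ j ih =>
    have hle : ∀ i, (ν + τ) i ≤ r := fun i => le_trans (by
      rw [← add_assoc, Finsupp.add_apply _ (Finsupp.single j 1)]; exact le_self_add) (h i)
    have hj := h j
    rw [← add_assoc, Finsupp.add_apply, Finsupp.single_eq_same] at hj
    have hj' : ((ν + τ) j + 1 : ℝ) ≤ r := by exact_mod_cast hj
    have e1 : ((τ + Finsupp.single j 1).prod fun j k => (Real.sqrt r * ρ j) ^ k) =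
        (τ.prod fun j k => (Real.sqrt r * ρ j) ^ k) * (Real.sqrt r * ρ j) := by
      rw [Finsupp.prod_add_index' (by simp) (by intros; rw [pow_add]), Finsupp.prod_single_index
        (by simp), pow_one]
    rw [← add_assoc, taylorWeight_add_single hρ, e1, mul_pow, mul_pow, Real.sq_sqrt (by positivity)]
    calc ((ν + τ) j + 1) * ρ j ^ 2 * taylorWeight ρ (ν + τ)
        ≤ r * ρ j ^ 2 *
          (taylorWeight ρ ν * (τ.prod fun j k => (Real.sqrt r * ρ j) ^ k) ^ 2) := by
          have := (taylorWeight_pos hρ (ν + τ)).le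
          have := ih hle
          gcongr
      _ = _ := by ring

theorem sqrt_taylorWeight_add_le {ρ : ℕ → ℝ} (hρ : ∀ j, 0 < ρ j) {r : ℕ} (ν τ : ℕ →₀ ℕ)
    (h : ∀ j, (ν + τ) j ≤ r) :
    Real.sqrt (taylorWeight ρ (ν + τ)) ≤
      Real.sqrt (taylorWeight ρ ν) * τ.prod fun j k => (Real.sqrt r * ρ j) ^ k := by
  have hpos : 0 ≤ τ.prod fun j k => (Real.sqrt r * ρ j) ^ k :=
    Finset.prod_nonneg fun j _ => pow_nonneg (mul_nonneg (Real.sqrt_nonneg _) (hρ j).le) _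
  refine (Real.sqrt_le_sqrt (taylorWeight_add_le hρ ν τ h)).trans_eq ?_
  rw [Real.sqrt_mul (taylorWeight_pos hρ ν).le, Real.sqrt_sq hpos]

theorem sum_pow_div_factorial_le_exp {a : ℝ} (ha : 0 ≤ a) (K : Finset ℕ) :
    ∑ k ∈ K, a ^ k / k.factorial ≤ Real.exp a := by
  rw [Real.exp_eq_exp_ℝ]
  exact sum_le_hasSum K (fun k _ => by positivity) (NormedSpace.expSeries_div_hasSum_exp a)

theorem sum_prod_pow_div_factorial_le {a : ℕ → ℝ} (ha : ∀ j, 0 ≤ a j) (m : ℕ →₀ ℕ) {B : ℝ}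
    (hB : Real.exp (∑ j ∈ m.support, a j) ≤ 1 + B) :
    ∑ τ ∈ (Finset.Iic m).erase 0, (τ.prod fun j k => a j ^ k / k.factorial) ≤ B := by
  have h := sum_finsupp_prod_le (h := fun j k => a j ^ k / k.factorial)
    (fun j k => div_nonneg (pow_nonneg (ha j) _) (by positivity)) (by simp)
    (B := fun j => Real.exp (a j)) (fun j K => sum_pow_div_factorial_le_exp (ha j) K) m.support
    (Finset.Iic m) fun ν hν => Finsupp.support_mono (Finset.mem_Iic.1 hν)
  rw [← Real.exp_sum, ← Finset.add_sum_erase _ _ (Finset.mem_Iic.2 (zero_le : 0 ≤ m))] at h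
  simp only [Finsupp.prod_zero_index] at h
  linarith

section Energy

variable {d : ℕ} {D : BoundedOpenSet d}
  {V : Type*} [NormedAddCommGroup V] [InnerProductSpace ℝ V] [CompleteSpace V]
  (G : V →ₗᵢ[ℝ] L2Vec D) (ψ : ℕ → LInf D) (b : LInf D) (g : V)

/-- The equations for the Taylor coefficients, tested with the Taylor coefficients themselves. -/
theorem inner_diffusionOp_solutionTaylor (μ : ℕ →₀ ℕ) :
    ⟪diffusionOp G (taylorCoeff ψ b 0) (solutionTaylor G ψ b g μ), solutionTaylor G ψ b g μ⟫_ℝ =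
      (if μ = 0 then ⟪g, solutionTaylor G ψ b g 0⟫_ℝ else 0) -
      ∑ x ∈ (splits μ).erase (0, μ),
        ⟪diffusionOp G (taylorCoeff ψ b x.1) (solutionTaylor G ψ b g x.2),
          solutionTaylor G ψ b g μ⟫_ℝ := by
  have h := congrArg (fun w => ⟪w, solutionTaylor G ψ b g μ⟫_ℝ) (sum_splits_diffusionOp G ψ b g μ)
  simp only [sum_splits_erase, inner_add_left, sum_inner] at h
  rw [eq_sub_iff_add_eq, h]
  split_ifs with h0
  · rw [h0]
  · rw [inner_zero_left]

/-- The key estimate: for weights `ρ` such that `∑_j ρ_j |ψ_j| ≤ K` is small, the weighted energies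
of the mixed derivatives of the solution are controlled by the energy of the solution. Multiplying
the equation for the derivative of order `μ` by this derivative, and summing over `μ`, leaves
lower order terms to which the Schur test applies pointwise in `x`. -/
theorem sum_taylorWeight_mul_energy_le {ρ : ℕ → ℝ} (hρ : ∀ j, 0 < ρ j) {r : ℕ} {m : ℕ →₀ ℕ}
    (hm : ∀ j, m j ≤ r) {K : ℝ}
    (hK : ∀ᵐ x ∂D.measure, ∀ s : Finset ℕ, ∑ j ∈ s, ρ j * |ψ j x| ≤ K)
    (hexp : Real.exp (Real.sqrt r * K) ≤ 3 / 2) :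
    ∑ μ ∈ Finset.Iic m, taylorWeight ρ μ *
      ⟪diffusionOp G (taylorCoeff ψ b 0) (solutionTaylor G ψ b g μ), solutionTaylor G ψ b g μ⟫_ℝ ≤
    2 * ⟪g, solutionTaylor G ψ b g 0⟫_ℝ := by
  set T := solutionTaylor G ψ b g with hT
  set c := taylorCoeff ψ b with hc
  have hident : ∑ μ ∈ Finset.Iic m, taylorWeight ρ μ * ⟪diffusionOp G (c 0) (T μ), T μ⟫_ℝ =
      ⟪g, T 0⟫_ℝ + ∑ μ ∈ Finset.Iic m, ∑ x ∈ (splits μ).erase (0, μ),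
        -(taylorWeight ρ μ * ⟪diffusionOp G (c x.1) (T x.2), T μ⟫_ℝ) := by
    simp only [hT, hc, inner_diffusionOp_solutionTaylor, mul_sub, Finset.sum_sub_distrib,
      Finset.sum_neg_distrib, Finset.mul_sum, mul_ite, mul_zero, Finset.sum_ite_eq',
      Finset.mem_Iic, zero_le, if_true, taylorWeight_zero, one_mul]
    ring
  have hmain : ∑ μ ∈ Finset.Iic m, ∑ x ∈ (splits μ).erase (0, μ),
        -(taylorWeight ρ μ * ⟪diffusionOp G (c x.1) (T x.2), T μ⟫_ℝ) ≤
      1 / 2 * ∑ μ ∈ Finset.Iic m, taylorWeight ρ μ * ⟪diffusionOp G (c 0) (T μ), T μ⟫_ℝ := by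
    simp only [inner_diffusionOp, ← integral_const_mul, ← integral_neg]
    have hi : ∀ (w : ℝ) (τ μ ν : ℕ →₀ ℕ),
        Integrable (fun x => w * (c τ x * ⟪G (T ν) x, G (T μ) x⟫_ℝ)) D.measure :=
      fun w τ μ ν => (integrable_mul_inner _ _ _).const_mul w
    have hin : ∀ (w : ℝ) (τ μ ν : ℕ →₀ ℕ),
        Integrable (fun x => -(w * (c τ x * ⟪G (T ν) x, G (T μ) x⟫_ℝ))) D.measure :=
      fun w τ μ ν => (hi w τ μ ν).neg
    have e1 : ∀ μ, ∑ x ∈ (splits μ).erase (0, μ),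
        ∫ y, -(taylorWeight ρ μ * (c x.1 y * ⟪G (T x.2) y, G (T μ) y⟫_ℝ)) ∂D.measure =
        ∫ y, ∑ x ∈ (splits μ).erase (0, μ),
          -(taylorWeight ρ μ * (c x.1 y * ⟪G (T x.2) y, G (T μ) y⟫_ℝ)) ∂D.measure := fun μ =>
      (integral_finsetSum _ fun x _ => hin _ _ _ _).symm
    simp only [e1]
    rw [← integral_finsetSum _ fun μ _ => integrable_finsetSum _ fun x _ => hin _ _ _ _,
      ← integral_finsetSum _ fun μ _ => hi _ _ _ _, ← integral_const_mul]
    refine integral_mono_ae (integrable_finsetSum _ fun μ _ => integrable_finsetSum _ fun x _ =>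
      hin _ _ _ _) ((integrable_finsetSum _ fun μ _ => hi _ _ _ _).const_mul _) ?_
    have hall : ∀ᵐ y ∂D.measure, ∀ τ, c τ y = Real.exp (b y) * taylorMonomial ψ τ y :=
      ae_all_iff.2 fun τ => coeFn_taylorCoeff ψ b τ
    filter_upwards [hall, hK] with y hy hKy
    simp only [hy, taylorMonomial_zero, mul_one, real_inner_self_eq_norm_sq]
    have hs := schur_splits (κ := fun τ => τ.prod fun j k =>
        (Real.sqrt r * (ρ j * |ψ j y|)) ^ k / k.factorial)
      (a := fun μ => Real.sqrt (taylorWeight ρ μ) * ‖G (T μ) y‖)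
      (fun τ => Finset.prod_nonneg fun j _ => div_nonneg (pow_nonneg (mul_nonneg
        (Real.sqrt_nonneg _) (mul_nonneg (hρ j).le (abs_nonneg _))) _) (by positivity)) m
      (sum_prod_pow_div_factorial_le (fun j => mul_nonneg
        (Real.sqrt_nonneg _) (mul_nonneg (hρ j).le (abs_nonneg _))) m (by
          rw [← Finset.mul_sum]
          refine le_trans (Real.exp_le_exp.2 ?_) (hexp.trans (by norm_num))
          exact mul_le_mul_of_nonneg_left (hKy _) (Real.sqrt_nonneg _)))
    have hs' := mul_le_mul_of_nonneg_left hs (Real.exp_pos (b y)).le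
    refine le_trans (le_trans ?_ hs') (le_of_eq ?_)
    · rw [Finset.mul_sum]
      refine Finset.sum_le_sum fun μ hμ => ?_
      rw [Finset.mul_sum]
      refine Finset.sum_le_sum fun x hx => ?_
      have hsum : x.1 + x.2 = μ :=
        Finset.HasAntidiagonal.mem_antidiagonal.1 (Finset.mem_of_mem_erase hx)
      have hle : ∀ j, (x.2 + x.1) j ≤ r := fun j => by
        rw [add_comm, hsum]; exact (Finset.mem_Iic.1 hμ j).trans (hm j)
      have h1 := sqrt_taylorWeight_add_le hρ x.2 x.1 hle
      rw [add_comm, hsum] at h1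
      have h2 := abs_real_inner_le_norm (G (T x.2) y) (G (T μ) y)
      have h3 : (x.1.prod fun j k => (Real.sqrt r * (ρ j * |ψ j y|)) ^ k / k.factorial) =
          (x.1.prod fun j k => (Real.sqrt r * ρ j) ^ k) * |taylorMonomial ψ x.1 y| := by
        rw [abs_taylorMonomial, Finsupp.prod, Finsupp.prod, Finsupp.prod, ← Finset.prod_mul_distrib]
        refine Finset.prod_congr rfl fun j _ => ?_
        rw [← mul_assoc, mul_pow, mul_div_assoc]
      rw [h3]
      have hw : taylorWeight ρ μ = Real.sqrt (taylorWeight ρ μ) * Real.sqrt (taylorWeight ρ μ) :=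
        (Real.mul_self_sqrt (taylorWeight_pos hρ μ).le).symm
      calc -(taylorWeight ρ μ * (Real.exp (b y) * taylorMonomial ψ x.1 y *
            ⟪G (T x.2) y, G (T μ) y⟫_ℝ))
          ≤ |taylorWeight ρ μ * (Real.exp (b y) * taylorMonomial ψ x.1 y *
            ⟪G (T x.2) y, G (T μ) y⟫_ℝ)| := neg_le_abs _
        _ = Real.sqrt (taylorWeight ρ μ) * (Real.sqrt (taylorWeight ρ μ) * (Real.exp (b y) *
            |taylorMonomial ψ x.1 y| * |⟪G (T x.2) y, G (T μ) y⟫_ℝ|)) := by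
            rw [abs_mul, abs_mul, abs_mul, Real.abs_exp, abs_of_pos (taylorWeight_pos hρ μ)]
            nth_rewrite 1 [hw]
            ring
        _ ≤ Real.sqrt (taylorWeight ρ μ) * ((Real.sqrt (taylorWeight ρ x.2) *
            x.1.prod fun j k => (Real.sqrt r * ρ j) ^ k) * (Real.exp (b y) *
            |taylorMonomial ψ x.1 y| * (‖G (T x.2) y‖ * ‖G (T μ) y‖))) := by
            gcongr
            exact (Real.sqrt_nonneg _).trans h1
        _ = _ := by ring
    · rw [Finset.mul_sum, Finset.mul_sum, Finset.mul_sum]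
      refine Finset.sum_congr rfl fun μ _ => ?_
      rw [mul_pow, Real.sq_sqrt (taylorWeight_pos hρ μ).le]
      ring
  rw [hident] at hmain ⊢
  linarith

/-- The weighted bound for the derivatives of the solution, from the energy estimate and coercivity. -/
theorem sum_taylorWeight_mul_norm_sq_le {ρ : ℕ → ℝ} (hρ : ∀ j, 0 < ρ j) {r : ℕ} {m : ℕ →₀ ℕ}
    (hm : ∀ j, m j ≤ r) {K : ℝ}
    (hK : ∀ᵐ x ∂D.measure, ∀ s : Finset ℕ, ∑ j ∈ s, ρ j * |ψ j x| ≤ K)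
    (hexp : Real.exp (Real.sqrt r * K) ≤ 3 / 2) :
    ∑ μ ∈ Finset.Iic m, taylorWeight ρ μ * ‖solutionTaylor G ψ b g μ‖ ^ 2 ≤
      2 * ‖g‖ ^ 2 * Real.exp ‖b‖ ^ 2 := by
  have h1 := sum_taylorWeight_mul_energy_le G ψ b g hρ hm hK hexp
  have h2 : ⟪g, solutionTaylor G ψ b g 0⟫_ℝ ≤ ‖g‖ * (Real.exp ‖b‖ * ‖g‖) :=
    (real_inner_le_norm _ _).trans
      (mul_le_mul_of_nonneg_left (norm_solutionTaylor_zero_le G ψ b g) (norm_nonneg _))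
  have h3 : Real.exp (-‖b‖) *
      ∑ μ ∈ Finset.Iic m, taylorWeight ρ μ * ‖solutionTaylor G ψ b g μ‖ ^ 2 ≤
      2 * (‖g‖ * (Real.exp ‖b‖ * ‖g‖)) := by
    refine le_trans ?_ (h1.trans (mul_le_mul_of_nonneg_left h2 zero_le_two))
    rw [Finset.mul_sum]
    refine Finset.sum_le_sum fun μ _ => ?_
    rw [mul_left_comm]
    exact mul_le_mul_of_nonneg_left (coercive_diffusionOp G ψ b _) (taylorWeight_pos hρ μ).le
  rw [Real.exp_neg, inv_mul_le_iff₀ (Real.exp_pos _)] at h3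
  refine h3.trans_eq ?_
  ring

end Energy

/-! ### The random logarithm of the diffusion coefficient -/

section LogCoeff

variable {d : ℕ} {D : BoundedOpenSet d} {ψ : ℕ → LInf D}

open Classical in
/-- The limit `b(y) = ∑_j y_j ψ_j` in `L^∞(D)`, with value `0` where the series diverges. -/
noncomputable def logCoeff (ψ : ℕ → LInf D) (y : ℕ → ℝ) : LInf D :=
  if h : ∃ b, IsLogCoeff ψ y b then h.choose else 0

theorem isLogCoeff_logCoeff {y : ℕ → ℝ} (h : ∃ b, IsLogCoeff ψ y b) :
    IsLogCoeff ψ y (logCoeff ψ y) := by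
  rw [logCoeff, dif_pos h]
  exact h.choose_spec

theorem IsLogCoeff.eq_logCoeff {y : ℕ → ℝ} {b : LInf D} (h : IsLogCoeff ψ y b) :
    b = logCoeff ψ y :=
  tendsto_nhds_unique h (isLogCoeff_logCoeff ⟨b, h⟩)

theorem IsLogCoeff.update {y : ℕ → ℝ} {b : LInf D} (h : IsLogCoeff ψ y b) (j : ℕ) (t : ℝ) :
    IsLogCoeff ψ (Function.update y j t) (b + (t - y j) • ψ j) := by
  refine (Tendsto.add_const ((t - y j) • ψ j) h).congr' ?_
  filter_upwards [eventually_gt_atTop j] with J hJ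
  have hj : j ∈ Finset.range J := Finset.mem_range.2 hJ
  rw [← Finset.add_sum_erase _ _ hj, ← Finset.add_sum_erase _ _ hj, Function.update_self,
    sub_smul]
  have : ∑ i ∈ (Finset.range J).erase j, Function.update y j t i • ψ i =
      ∑ i ∈ (Finset.range J).erase j, y i • ψ i := by
    refine Finset.sum_congr rfl fun i hi => ?_
    rw [Function.update_of_ne (Finset.ne_of_mem_erase hi)]
  rw [this]
  abel

theorem logCoeff_update {y : ℕ → ℝ} (h : ∃ b, IsLogCoeff ψ y b) (j : ℕ) (t : ℝ) :
    logCoeff ψ (Function.update y j t) = (logCoeff ψ y - y j • ψ j) + t • ψ j := by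
  rw [← ((isLogCoeff_logCoeff h).update j t).eq_logCoeff, sub_smul]
  abel

theorem norm_sum_smul_le {ρ : ℕ → ℝ} {C M : ℝ} (hM : 0 ≤ M) (hC0 : 0 ≤ C)
    (hC : ∀ᵐ x ∂D.measure, ∀ s : Finset ℕ, ∑ j ∈ s, ρ j * |ψ j x| ≤ C) {y : ℕ → ℝ}
    {s : Finset ℕ} (hy : ∀ j ∈ s, |y j| ≤ M * ρ j) : ‖∑ j ∈ s, y j • ψ j‖ ≤ M * C := by
  refine norm_le_of_ae_abs_le (mul_nonneg hM hC0) ?_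
  have hsum : ∀ᵐ x ∂D.measure, (∑ j ∈ s, y j • ψ j : LInf D) x = ∑ j ∈ s, y j * ψ j x := by
    have h1 := Lp.coeFn_finsetSum s fun j => y j • ψ j
    have h2 : ∀ᵐ x ∂D.measure, ∀ j, (y j • ψ j : LInf D) x = y j * ψ j x :=
      ae_all_iff.2 fun j => Lp.coeFn_smul (y j) (ψ j)
    filter_upwards [h1, h2] with x h1 h2
    rw [h1, Finset.sum_apply]
    exact Finset.sum_congr rfl fun j _ => h2 j
  filter_upwards [hsum, hC] with x h1 h2
  rw [h1]
  calc |∑ j ∈ s, y j * ψ j x| ≤ ∑ j ∈ s, |y j * ψ j x| := Finset.abs_sum_le_sum_abs _ _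
    _ ≤ ∑ j ∈ s, M * (ρ j * |ψ j x|) := by
        refine Finset.sum_le_sum fun j hj => ?_
        rw [abs_mul, ← mul_assoc]
        exact mul_le_mul_of_nonneg_right (hy j hj) (abs_nonneg _)
    _ = M * ∑ j ∈ s, ρ j * |ψ j x| := by rw [Finset.mul_sum]
    _ ≤ M * C := mul_le_mul_of_nonneg_left (h2 s) hM

/-- If `|y_j| / ρ_j → 0`, the partial sums of `∑_j y_j ψ_j` are Cauchy in `L^∞(D)`. -/
theorem exists_isLogCoeff {ρ : ℕ → ℝ} (hρ : ∀ j, 0 < ρ j) {C : ℝ} (hC0 : 0 ≤ C)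
    (hC : ∀ᵐ x ∂D.measure, ∀ s : Finset ℕ, ∑ j ∈ s, ρ j * |ψ j x| ≤ C) {y : ℕ → ℝ}
    (hy : Tendsto (fun j => |y j| / ρ j) atTop (𝓝 0)) : ∃ b, IsLogCoeff ψ y b := by
  have hs : Summable fun j => y j • ψ j := by
    rw [summable_iff_vanishing_norm]
    intro ε hε
    have hM : 0 < ε / (C + 1) := by positivity
    obtain ⟨N, hN⟩ := eventually_atTop.1 (hy.eventually (gt_mem_nhds hM))
    refine ⟨Finset.range N, fun t ht => ?_⟩
    refine (norm_sum_smul_le hM.le hC0 hC (s := t) fun j hj => ?_).trans_lt ?_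
    · have : N ≤ j := by
        by_contra h
        exact Finset.disjoint_left.1 ht hj (Finset.mem_range.2 (not_le.1 h))
      exact ((div_lt_iff₀ (hρ j)).1 (hN j this)).le
    · rw [div_mul_eq_mul_div, div_lt_iff₀ (by positivity)]
      nlinarith
  exact ⟨_, hs.hasSum.tendsto_sum_nat⟩

theorem norm_le_of_isLogCoeff {ρ : ℕ → ℝ} {C M : ℝ} (hM : 0 ≤ M) (hC0 : 0 ≤ C)
    (hC : ∀ᵐ x ∂D.measure, ∀ s : Finset ℕ, ∑ j ∈ s, ρ j * |ψ j x| ≤ C) {y : ℕ → ℝ}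
    (hy : ∀ j, |y j| ≤ M * ρ j) {b : LInf D} (hb : IsLogCoeff ψ y b) : ‖b‖ ≤ M * C :=
  le_of_tendsto hb.norm (Eventually.of_forall fun _ =>
    norm_sum_smul_le hM hC0 hC fun j _ => hy j)

/-- Exponential moments of the sequence `|y_j| / ρ_j`; the factor `ρ_j^{-q}` splits off from the
expectation of the `j`-th term, and what remains is bounded uniformly in `j`, because the `y_j` are
identically distributed. -/
theorem lintegral_tsum_rpow_mul_exp_lt_top {ρ : ℕ → ℝ} (hρ : ∀ j, 0 < ρ j) {q : ℝ} (hq : 0 < q)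
    (hsum : Summable fun j => (ρ j)⁻¹ ^ q) {A : ℝ} (hA : ∀ j, (ρ j)⁻¹ ≤ A) {κ : ℝ} (hκ : 0 ≤ κ) :
    ∫⁻ y : ℕ → ℝ, ∑' j, ENNReal.ofReal ((|y j| / ρ j) ^ q * Real.exp (κ * (|y j| / ρ j)))
      ∂gaussianMeasure < ⊤ := by
  rw [lintegral_tsum fun j => by fun_prop]
  set Z := ∫⁻ t, ENNReal.ofReal (Real.exp ((q + κ * A) * |t|)) ∂gaussianReal 0 1 with hZ
  have hZtop : Z < ⊤ := (finiteMoments_exp_mul_abs (q + κ * A)).integrable.lintegral_lt_top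
  have hle : ∀ j, ∫⁻ y : ℕ → ℝ, ENNReal.ofReal ((|y j| / ρ j) ^ q *
      Real.exp (κ * (|y j| / ρ j))) ∂gaussianMeasure ≤ ENNReal.ofReal ((ρ j)⁻¹ ^ q) * Z := by
    intro j
    rw [hZ, ← (measurePreserving_eval_gaussianMeasure j).lintegral_comp (by fun_prop),
      ← lintegral_const_mul _ (by fun_prop)]
    refine lintegral_mono fun y => ?_
    rw [← ENNReal.ofReal_mul (by have := (hρ j).le; positivity)]
    refine ENNReal.ofReal_le_ofReal ?_
    have h1 : (|y j| / ρ j) ^ q ≤ (ρ j)⁻¹ ^ q * Real.exp (q * |y j|) := by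
      rw [div_eq_inv_mul, Real.mul_rpow (inv_nonneg.2 (hρ j).le) (abs_nonneg _), mul_comm q,
        Real.exp_mul]
      have h2 : |y j| ≤ Real.exp |y j| := by linarith [Real.add_one_le_exp |y j|]
      have h3 := (inv_nonneg.2 (hρ j).le)
      gcongr
    have h2 : κ * (|y j| / ρ j) ≤ κ * A * |y j| := by
      rw [mul_assoc, div_eq_inv_mul]
      exact mul_le_mul_of_nonneg_left (mul_le_mul_of_nonneg_right (hA j) (abs_nonneg _)) hκ
    calc (|y j| / ρ j) ^ q * Real.exp (κ * (|y j| / ρ j))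
        ≤ ((ρ j)⁻¹ ^ q * Real.exp (q * |y j|)) * Real.exp (κ * A * |y j|) := by
          have h3 := (inv_nonneg.2 (hρ j).le)
          gcongr
      _ = _ := by rw [mul_assoc, ← Real.exp_add, add_mul]
  refine (ENNReal.tsum_le_tsum hle).trans_lt ?_
  rw [ENNReal.tsum_mul_right]
  refine ENNReal.mul_lt_top ?_ hZtop
  rw [← ENNReal.ofReal_tsum_of_nonneg
    (fun j => Real.rpow_nonneg (inv_nonneg.2 (hρ j).le) _) hsum]
  exact ENNReal.ofReal_lt_top

theorem exists_inv_le {ρ : ℕ → ℝ} (hρ : ∀ j, 0 < ρ j) {q : ℝ} (hq : 0 < q)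
    (hsum : Summable fun j => (ρ j)⁻¹ ^ q) : ∃ A : ℝ, 1 ≤ A ∧ ∀ j, (ρ j)⁻¹ ≤ A := by
  refine ⟨max 1 ((∑' j, (ρ j)⁻¹ ^ q) ^ q⁻¹), le_max_left _ _, fun j => le_max_of_le_right ?_⟩
  have h0 := fun j => Real.rpow_nonneg (inv_nonneg.2 (hρ j).le) q
  have := Real.rpow_le_rpow (h0 j) (hsum.le_tsum j fun i _ => h0 i) (inv_nonneg.2 hq.le)
  rwa [Real.rpow_rpow_inv (inv_nonneg.2 (hρ j).le) hq.ne'] at this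

theorem ae_exists_isLogCoeff {ρ : ℕ → ℝ} (hρ : ∀ j, 0 < ρ j) {q : ℝ} (hq : 0 < q)
    (hsum : Summable fun j => (ρ j)⁻¹ ^ q) {C : ℝ} (hC0 : 0 ≤ C)
    (hC : ∀ᵐ x ∂D.measure, ∀ s : Finset ℕ, ∑ j ∈ s, ρ j * |ψ j x| ≤ C) :
    ∀ᵐ y ∂gaussianMeasure, ∃ b, IsLogCoeff ψ y b := by
  obtain ⟨A, -, hA⟩ := exists_inv_le hρ hq hsum
  have h := lintegral_tsum_rpow_mul_exp_lt_top hρ hq hsum hA le_rfl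
  have hfin := ae_lt_top (Measurable.tsum fun j => by fun_prop) h.ne
  filter_upwards [hfin] with y hy
  refine exists_isLogCoeff hρ hC0 hC ?_
  have hnn : ∀ j, 0 ≤ |y j| / ρ j := fun j => div_nonneg (abs_nonneg _) (hρ j).le
  simp only [zero_mul, Real.exp_zero, mul_one] at hy
  have h1 : Summable fun j => (|y j| / ρ j) ^ q := by
    have := ENNReal.summable_toReal hy.ne
    refine this.congr fun j => ?_
    rw [ENNReal.toReal_ofReal (Real.rpow_nonneg (hnn j) _)]
  have h2 := h1.tendsto_atTop_zero.rpow_const (p := q⁻¹) (Or.inr (inv_nonneg.2 hq.le))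
  rw [Real.zero_rpow (inv_ne_zero hq.ne')] at h2
  refine h2.congr fun j => ?_
  rw [Real.rpow_rpow_inv (hnn j) hq.ne']

theorem aestronglyMeasurable_logCoeff (h : ∀ᵐ y ∂gaussianMeasure, ∃ b, IsLogCoeff ψ y b) :
    AEStronglyMeasurable (logCoeff ψ) gaussianMeasure := by
  refine aestronglyMeasurable_of_tendsto_ae atTop
    (f := fun (J : ℕ) (y : ℕ → ℝ) => ∑ j ∈ Finset.range J, y j • ψ j) (fun J => ?_) ?_
  · exact (by fun_prop : Continuous fun y : ℕ → ℝ =>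
      ∑ j ∈ Finset.range J, y j • ψ j).aestronglyMeasurable
  · filter_upwards [h] with y hy
    exact isLogCoeff_logCoeff hy

/-- All exponential moments of `‖b(y)‖` are finite. -/
theorem finiteMoments_exp_norm_logCoeff {ρ : ℕ → ℝ} (hρ : ∀ j, 0 < ρ j) {q : ℝ} (hq : 0 < q)
    (hsum : Summable fun j => (ρ j)⁻¹ ^ q) {C : ℝ} (hC0 : 0 < C)
    (hC : ∀ᵐ x ∂D.measure, ∀ s : Finset ℕ, ∑ j ∈ s, ρ j * |ψ j x| ≤ C) :
    FiniteMoments gaussianMeasure (fun y => Real.exp ‖logCoeff ψ y‖) := by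
  have hconv := ae_exists_isLogCoeff hρ hq hsum hC0.le hC
  have hmeas := aestronglyMeasurable_logCoeff hconv
  have hmeas' : AEStronglyMeasurable (fun y => Real.exp ‖logCoeff ψ y‖) gaussianMeasure :=
    Real.continuous_exp.comp_aestronglyMeasurable hmeas.norm
  intro k
  rcases eq_or_ne k 0 with rfl | hk0
  · simpa using hmeas'
  have hk : (0 : ℝ) < k := by positivity
  refine (integrable_norm_rpow_iff hmeas' (by simpa using hk0) (by simp)).1 ?_
  simp only [Real.norm_eq_abs, Real.abs_exp, ← Real.exp_mul, ENNReal.coe_toReal]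
  obtain ⟨A, -, hA⟩ := exists_inv_le hρ hq hsum
  set κ : ℝ := k * C with hκ
  have hκ0 : 0 < κ := by positivity
  have hΦ := lintegral_tsum_rpow_mul_exp_lt_top hρ hq hsum hA hκ0.le
  set Φ : (ℕ → ℝ) → ℝ≥0∞ := fun y =>
    ∑' j, ENNReal.ofReal ((|y j| / ρ j) ^ q * Real.exp (κ * (|y j| / ρ j))) with hΦdef
  have hΦm : Measurable Φ := Measurable.tsum fun j => by fun_prop
  have hfin := ae_lt_top hΦm hΦ.ne
  have hint : Integrable (fun y => Real.exp κ + (Φ y).toReal) gaussianMeasure :=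
    (integrable_const _).add (integrable_toReal_of_lintegral_ne_top hΦm.aemeasurable hΦ.ne)
  refine hint.mono (Real.continuous_exp.comp_aestronglyMeasurable
    (hmeas.norm.mul_const _)) ?_
  filter_upwards [hconv, hfin] with y hy hfy
  have hnn : ∀ j, 0 ≤ |y j| / ρ j := fun j => div_nonneg (abs_nonneg _) (hρ j).le
  set L := Real.exp κ + (Φ y).toReal with hL
  have hLpos : 0 < L := add_pos_of_pos_of_nonneg (Real.exp_pos _) ENNReal.toReal_nonneg
  have hL1 : 1 ≤ L := by
    have := Real.one_le_exp hκ0.le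
    have : 0 ≤ (Φ y).toReal := ENNReal.toReal_nonneg
    linarith
  have hj : ∀ j, Real.exp (κ * (|y j| / ρ j)) ≤ L := fun j => by
    rcases le_total (|y j| / ρ j) 1 with h1 | h1
    · have : Real.exp (κ * (|y j| / ρ j)) ≤ Real.exp κ :=
        Real.exp_le_exp.2 (mul_le_of_le_one_right hκ0.le h1)
      have h2 : 0 ≤ (Φ y).toReal := ENNReal.toReal_nonneg
      linarith
    · have h2 : (|y j| / ρ j) ^ q * Real.exp (κ * (|y j| / ρ j)) ≤ (Φ y).toReal := by
        rw [← ENNReal.ofReal_le_iff_le_toReal hfy.ne]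
        exact ENNReal.le_tsum (f := fun j => ENNReal.ofReal ((|y j| / ρ j) ^ q *
          Real.exp (κ * (|y j| / ρ j)))) j
      have h3 := Real.one_le_rpow h1 hq.le
      have h4 := Real.exp_pos (κ * (|y j| / ρ j))
      have h5 := Real.exp_pos κ
      nlinarith
  have hM : ‖logCoeff ψ y‖ ≤ Real.log L / κ * C := by
    refine norm_le_of_isLogCoeff (div_nonneg (Real.log_nonneg hL1) hκ0.le) hC0.le hC
      (fun j => ?_) (isLogCoeff_logCoeff hy)
    rw [← div_le_iff₀ (hρ j), le_div_iff₀ hκ0, mul_comm]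
    exact (Real.le_log_iff_exp_le hLpos).2 (hj j)
  have hM' : ‖logCoeff ψ y‖ * k ≤ Real.log L := by
    rw [hκ] at hM
    calc ‖logCoeff ψ y‖ * k ≤ Real.log L / (k * C) * C * k := by gcongr
      _ = Real.log L := by field_simp
  rw [Real.norm_eq_abs, Real.abs_exp, Real.norm_eq_abs, abs_of_pos hLpos]
  exact (Real.le_log_iff_exp_le hLpos).1 hM'

end LogCoeff

/-! ### Weighted summability of the Hermite coefficients -/

/-- The factorial `∏_j μ_j!` of a multi-index. -/
noncomputable def multiFactorial (μ : ℕ →₀ ℕ) : ℝ := μ.prod fun _ k => (k.factorial : ℝ)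

theorem multiFactorial_pos (μ : ℕ →₀ ℕ) : 0 < multiFactorial μ :=
  Finset.prod_pos fun j _ => by positivity

theorem multiFactorial_add_single (μ : ℕ →₀ ℕ) (j : ℕ) :
    multiFactorial (μ + Finsupp.single j 1) = (μ j + 1) * multiFactorial μ := by
  have h := prod_add_single_mul (h := fun _ k => (k.factorial : ℝ)) (by simp) μ j
  have hpos : 0 < ((μ j).factorial : ℝ) := by positivity
  refine mul_right_cancel₀ hpos.ne' (h.trans ?_)
  simp only [Nat.factorial_succ, multiFactorial]
  push_cast
  ring

/-- The part `min(ν_j, r)` of a multi-index, the order of differentiation that is used to bound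
the Hermite coefficient of index `ν`. -/
noncomputable def truncate (r : ℕ) (ν : ℕ →₀ ℕ) : ℕ →₀ ℕ :=
  ν.mapRange (fun k => min k r) (Nat.zero_min r)

theorem truncate_le (r : ℕ) (ν : ℕ →₀ ℕ) : truncate r ν ≤ ν := fun _ => min_le_left _ _

theorem truncate_mono (r : ℕ) {μ ν : ℕ →₀ ℕ} (h : μ ≤ ν) : truncate r μ ≤ truncate r ν :=
  fun j => min_le_min_right r (h j)

/-- The weight `∏_j binom(ν_j, min(ν_j, r)) ρ_j^{2 min(ν_j, r)}` of the Hermite coefficient of index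
`ν`. The binomial coefficients grow like `ν_j^r`, which makes negative powers of the weight summable
over the multi-indices of unbounded degree. -/
noncomputable def hermiteWeight (ρ : ℕ → ℝ) (r : ℕ) (ν : ℕ →₀ ℕ) : ℝ :=
  ν.prod fun j k => (k.choose (min k r) : ℝ) * ρ j ^ (2 * min k r)

theorem hermiteWeight_pos {ρ : ℕ → ℝ} (hρ : ∀ j, 0 < ρ j) (r : ℕ) (ν : ℕ →₀ ℕ) :
    0 < hermiteWeight ρ r ν :=
  Finset.prod_pos fun j _ => mul_pos
    (by exact_mod_cast Nat.choose_pos (min_le_left _ _)) (pow_pos (hρ j) _)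

theorem hermiteWeight_mul (ρ : ℕ → ℝ) (r : ℕ) (ν : ℕ →₀ ℕ) :
    hermiteWeight ρ r ν * (multiFactorial (ν - truncate r ν) *
      multiFactorial (truncate r ν) ^ 2) =
      taylorWeight ρ (truncate r ν) * multiFactorial ν := by
  have e1 : multiFactorial (ν - truncate r ν) =
      ∏ j ∈ ν.support, ((ν j - min (ν j) r).factorial : ℝ) := by
    refine Finsupp.prod_of_support_subset _ (Finsupp.support_mono tsub_le_self) _ ?_
    simp
  have e2 : multiFactorial (truncate r ν) = ∏ j ∈ ν.support, ((min (ν j) r).factorial : ℝ) :=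
    Finsupp.prod_of_support_subset _ (Finsupp.support_mono (truncate_le r ν)) _ (by simp)
  have e3 : taylorWeight ρ (truncate r ν) =
      ∏ j ∈ ν.support, ((min (ν j) r).factorial : ℝ) * ρ j ^ (2 * min (ν j) r) :=
    Finsupp.prod_of_support_subset _ (Finsupp.support_mono (truncate_le r ν)) _ (by simp)
  rw [e1, e2, e3, hermiteWeight, multiFactorial, Finsupp.prod, Finsupp.prod,
    ← Finset.prod_pow, ← Finset.prod_mul_distrib, ← Finset.prod_mul_distrib,
    ← Finset.prod_mul_distrib]
  refine Finset.prod_congr rfl fun j _ => ?_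
  have h : ((ν j).choose (min (ν j) r) : ℝ) * (min (ν j) r).factorial *
      (ν j - min (ν j) r).factorial = (ν j).factorial := by
    exact_mod_cast Nat.choose_mul_factorial_mul_factorial (min_le_left (ν j) r)
  linear_combination (ρ j ^ (2 * min (ν j) r) * (min (ν j) r).factorial) * h

section Coefficients

variable {d : ℕ} {D : BoundedOpenSet d}
  {V : Type*} [NormedAddCommGroup V] [InnerProductSpace ℝ V] [CompleteSpace V]
  (G : V →ₗᵢ[ℝ] L2Vec D) {ψ : ℕ → LInf D} (g : V)

theorem aestronglyMeasurable_solutionTaylor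
    (hconv : ∀ᵐ y ∂gaussianMeasure, ∃ b, IsLogCoeff ψ y b) (μ : ℕ →₀ ℕ) :
    AEStronglyMeasurable (fun y => solutionTaylor G ψ (logCoeff ψ y) g μ) gaussianMeasure :=
  (continuous_solutionTaylor G ψ g μ).comp_aestronglyMeasurable
    (aestronglyMeasurable_logCoeff hconv)

variable {ρ : ℕ → ℝ} (hρ : ∀ j, 0 < ρ j) {r : ℕ} {K : ℝ}
  (hK : ∀ᵐ x ∂D.measure, ∀ s : Finset ℕ, ∑ j ∈ s, ρ j * |ψ j x| ≤ K)
  (hexp : Real.exp (Real.sqrt r * K) ≤ 3 / 2)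
  (hconv : ∀ᵐ y ∂gaussianMeasure, ∃ b, IsLogCoeff ψ y b)
  (hmom : FiniteMoments gaussianMeasure fun y => Real.exp ‖logCoeff ψ y‖)

include hρ hK hexp hconv hmom

/-- Each derivative of the solution, of order at most `r` in each variable, is bounded by a multiple of
`exp ‖b(y)‖`. -/
theorem finiteMoments_solutionTaylor {μ : ℕ →₀ ℕ} (hμ : ∀ j, μ j ≤ r) :
    FiniteMoments gaussianMeasure fun y => solutionTaylor G ψ (logCoeff ψ y) g μ := by
  have hw := taylorWeight_pos hρ μ
  refine ((FiniteMoments.const (Real.sqrt (2 * ‖g‖ ^ 2 / taylorWeight ρ μ))).mul hmom).mono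
    (aestronglyMeasurable_solutionTaylor G g hconv μ) (Eventually.of_forall fun y => ?_)
  have h1 := sum_taylorWeight_mul_norm_sq_le G ψ (logCoeff ψ y) g hρ hμ hK hexp
  have h2 := (Finset.single_le_sum (fun ν _ => mul_nonneg (taylorWeight_pos hρ ν).le
    (sq_nonneg ‖solutionTaylor G ψ (logCoeff ψ y) g ν‖)) (Finset.mem_Iic.2 le_rfl)).trans h1
  have h3 : 0 ≤ Real.sqrt (2 * ‖g‖ ^ 2 / taylorWeight ρ μ) * Real.exp ‖logCoeff ψ y‖ := by
    positivity
  rw [Real.norm_eq_abs, abs_of_nonneg h3]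
  refine (sq_le_sq₀ (norm_nonneg _) h3).1 ?_
  rw [mul_pow, Real.sq_sqrt (by positivity), div_mul_eq_mul_div, le_div_iff₀ hw]
  linarith

/-- The Hermite coefficients of the derivatives of the solution, by iterated integration by
parts. -/
theorem hermiteCoeff_solutionTaylor (μ : ℕ →₀ ℕ) (hμ : ∀ j, μ j ≤ r) (ν : ℕ →₀ ℕ) :
    (Real.sqrt (multiFactorial ν) * multiFactorial μ) •
      hermiteCoeff (fun y => solutionTaylor G ψ (logCoeff ψ y) g μ) ν =
    Real.sqrt (multiFactorial (ν + μ)) •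
      hermiteCoeff (fun y => solutionTaylor G ψ (logCoeff ψ y) g 0) (ν + μ) := by
  induction μ using induction_add_single generalizing ν with
  | h0 => simp [multiFactorial]
  | h1 μ j ih =>
    have hμ' : ∀ i, μ i ≤ r := fun i => le_trans (by
      rw [Finsupp.add_apply]; exact le_self_add) (hμ i)
    have hibp := hermiteCoeff_add_single ν j
      (F := fun y => solutionTaylor G ψ (logCoeff ψ y) g μ)
      (F' := fun y => (μ j + 1 : ℝ) •
        solutionTaylor G ψ (logCoeff ψ y) g (μ + Finsupp.single j 1))
      (by
        filter_upwards [hconv] with y hy t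
        simp only [logCoeff_update hy]
        exact hasDerivAt_solutionTaylor G ψ _ g μ j t)
      (finiteMoments_solutionTaylor G g hρ hK hexp hconv hmom hμ')
      ((FiniteMoments.const _).smul
        (finiteMoments_solutionTaylor G g hρ hK hexp hconv hmom hμ))
    have hsmul : hermiteCoeff (fun y => (μ j + 1 : ℝ) •
        solutionTaylor G ψ (logCoeff ψ y) g (μ + Finsupp.single j 1)) ν = (μ j + 1 : ℝ) •
        hermiteCoeff (fun y => solutionTaylor G ψ (logCoeff ψ y) g (μ + Finsupp.single j 1)) ν := by
      simp only [hermiteCoeff]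
      rw [← integral_smul]
      exact integral_congr_ae (Eventually.of_forall fun y => smul_comm _ _ _)
    rw [hsmul] at hibp
    have h2 := ih hμ' (ν + Finsupp.single j 1)
    rw [multiFactorial_add_single ν, Real.sqrt_mul (by positivity), add_assoc,
      add_comm (Finsupp.single j 1)] at h2
    rw [← h2, multiFactorial_add_single, show Real.sqrt (multiFactorial ν) *
        ((μ j + 1) * multiFactorial μ) =
      Real.sqrt (multiFactorial ν) * multiFactorial μ * (μ j + 1) by ring, mul_smul, ← hibp,
      smul_smul]
    congr 1
    ring

/-- The weights match the factors in the integration by parts of order `truncate r ν`. -/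
theorem hermiteWeight_mul_norm_sq (ν : ℕ →₀ ℕ) :
    hermiteWeight ρ r ν *
      ‖hermiteCoeff (fun y => solutionTaylor G ψ (logCoeff ψ y) g 0) ν‖ ^ 2 =
    taylorWeight ρ (truncate r ν) *
      ‖hermiteCoeff (fun y => solutionTaylor G ψ (logCoeff ψ y) g (truncate r ν))
        (ν - truncate r ν)‖ ^ 2 := by
  have h := congrArg (fun v => ‖v‖ ^ 2) (hermiteCoeff_solutionTaylor G g hρ hK hexp hconv hmom
    (truncate r ν) (fun j => min_le_right _ _) (ν - truncate r ν))
  simp only [tsub_add_cancel_of_le (truncate_le r ν), norm_smul, mul_pow, Real.norm_eq_abs,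
    sq_abs, Real.sq_sqrt (multiFactorial_pos _).le] at h
  have hpos : 0 < multiFactorial (ν - truncate r ν) * multiFactorial (truncate r ν) ^ 2 :=
    mul_pos (multiFactorial_pos _) (pow_pos (multiFactorial_pos _) 2)
  refine mul_right_cancel₀ hpos.ne' ?_
  have hw := hermiteWeight_mul ρ r ν
  linear_combination (‖hermiteCoeff (fun y => solutionTaylor G ψ (logCoeff ψ y) g 0) ν‖ ^ 2) * hw -
    taylorWeight ρ (truncate r ν) * h

/-- The weighted `ℓ²` bound for the Hermite coefficients. -/
theorem sum_hermiteWeight_mul_norm_sq_le (F : Finset (ℕ →₀ ℕ)) :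
    ∑ ν ∈ F, hermiteWeight ρ r ν *
      ‖hermiteCoeff (fun y => solutionTaylor G ψ (logCoeff ψ y) g 0) ν‖ ^ 2 ≤
    ∫ y, 2 * ‖g‖ ^ 2 * Real.exp ‖logCoeff ψ y‖ ^ 2 ∂gaussianMeasure := by
  classical
  set T : (ℕ →₀ ℕ) → (ℕ → ℝ) → V := fun μ y => solutionTaylor G ψ (logCoeff ψ y) g μ with hT
  set m := truncate r (F.sup id) with hm
  have hmr : ∀ j, m j ≤ r := fun j => min_le_right _ _
  have hmaps : ∀ ν ∈ F, truncate r ν ∈ Finset.Iic m := fun ν hν =>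
    Finset.mem_Iic.2 (truncate_mono r (Finset.le_sup (f := id) hν))
  have hmem : ∀ μ ∈ Finset.Iic m, MemLp (T μ) 2 gaussianMeasure := fun μ hμ =>
    (finiteMoments_solutionTaylor G g hρ hK hexp hconv hmom
      fun j => (Finset.mem_Iic.1 hμ j).trans (hmr j)).memLp_two
  have hfiber : ∀ μ ∈ Finset.Iic m, ∑ ν ∈ F with truncate r ν = μ,
      taylorWeight ρ (truncate r ν) * ‖hermiteCoeff (T (truncate r ν)) (ν - truncate r ν)‖ ^ 2 ≤
      taylorWeight ρ μ * ∫ y, ‖T μ y‖ ^ 2 ∂gaussianMeasure := fun μ hμ => by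
    have e1 : ∑ ν ∈ F with truncate r ν = μ,
        taylorWeight ρ (truncate r ν) * ‖hermiteCoeff (T (truncate r ν)) (ν - truncate r ν)‖ ^ 2 =
        taylorWeight ρ μ * ∑ ν ∈ F with truncate r ν = μ, ‖hermiteCoeff (T μ) (ν - μ)‖ ^ 2 := by
      rw [Finset.mul_sum]
      refine Finset.sum_congr rfl fun ν hν => ?_
      rw [(Finset.mem_filter.1 hν).2]
    have hinj : Set.InjOn (fun ν => ν - μ) (F.filter fun ν => truncate r ν = μ) := by
      intro ν hν ν' hν' h
      have h1 : μ ≤ ν := (Finset.mem_filter.1 hν).2 ▸ truncate_le r ν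
      have h2 : μ ≤ ν' := (Finset.mem_filter.1 hν').2 ▸ truncate_le r ν'
      rw [← tsub_add_cancel_of_le h1, ← tsub_add_cancel_of_le h2]
      exact congrArg (· + μ) h
    rw [e1, ← norm_toLp_sq (hmem μ hμ),
      ← Finset.sum_image (f := fun ν => ‖hermiteCoeff (T μ) ν‖ ^ 2) hinj]
    exact mul_le_mul_of_nonneg_left (sum_norm_sq_hermiteCoeff_le (hmem μ hμ) _)
      (taylorWeight_pos hρ μ).le
  have hi : ∀ μ ∈ Finset.Iic m,
      Integrable (fun y => taylorWeight ρ μ * ‖T μ y‖ ^ 2) gaussianMeasure := fun μ hμ =>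
    ((hmem μ hμ).integrable_norm_pow (by norm_num)).const_mul _
  calc ∑ ν ∈ F, hermiteWeight ρ r ν * ‖hermiteCoeff (T 0) ν‖ ^ 2
      = ∑ ν ∈ F, taylorWeight ρ (truncate r ν) *
          ‖hermiteCoeff (T (truncate r ν)) (ν - truncate r ν)‖ ^ 2 :=
        Finset.sum_congr rfl fun ν _ => hermiteWeight_mul_norm_sq G g hρ hK hexp hconv hmom ν
    _ = ∑ μ ∈ Finset.Iic m, ∑ ν ∈ F with truncate r ν = μ, taylorWeight ρ (truncate r ν) *
          ‖hermiteCoeff (T (truncate r ν)) (ν - truncate r ν)‖ ^ 2 :=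
        (Finset.sum_fiberwise_of_maps_to hmaps _).symm
    _ ≤ ∑ μ ∈ Finset.Iic m, taylorWeight ρ μ * ∫ y, ‖T μ y‖ ^ 2 ∂gaussianMeasure :=
        Finset.sum_le_sum hfiber
    _ = ∫ y, ∑ μ ∈ Finset.Iic m, taylorWeight ρ μ * ‖T μ y‖ ^ 2 ∂gaussianMeasure := by
        rw [integral_finsetSum _ hi]
        simp only [integral_const_mul]
    _ ≤ _ := integral_mono (integrable_finsetSum _ hi)
        ((hmom.pow 2).integrable.const_mul _)
        fun y => sum_taylorWeight_mul_norm_sq_le G ψ (logCoeff ψ y) g hρ hmr hK hexp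

end Coefficients

/-! ### Summability of the weights -/

theorem summable_choose_min_rpow {r : ℕ} {a : ℝ} (ha : 0 < a) (h : 1 < r * a) :
    Summable fun k : ℕ => (k.choose (min k r) : ℝ) ^ (-a) := by
  rw [← summable_nat_add_iff r]
  have hs : Summable fun k : ℕ => ((r.factorial : ℝ)) ^ a * ((k + 1 : ℕ) : ℝ) ^ (-(r * a)) :=
    ((summable_nat_add_iff 1).2 (Real.summable_nat_rpow.2 (neg_lt_neg h))).mul_left _
  refine Summable.of_nonneg_of_le (fun k => by positivity) (fun k => ?_) hs
  have h1 := Nat.pow_le_choose (α := ℝ) r (k + r)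
  rw [min_eq_right (Nat.le_add_left r k)]
  have h2 : ((k + r + 1 - r : ℕ) : ℝ) = ((k + 1 : ℕ) : ℝ) := by congr 1; omega
  rw [h2] at h1
  have h3 := Real.rpow_le_rpow_of_nonpos (by positivity) h1 (neg_nonpos.2 ha.le)
  refine h3.trans_eq ?_
  rw [Real.div_rpow (by positivity) (by positivity), ← Real.rpow_natCast, ← Real.rpow_mul
    (by positivity), Real.rpow_neg (by positivity : (0 : ℝ) ≤ r.factorial), div_inv_eq_mul,
    mul_comm, mul_neg]

/-- The sum over all multi-indices is bounded by a product over `j` of factors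
`1 + O(ρ_j^{-q}) ≤ exp(O(ρ_j^{-q}))`. -/
theorem summable_hermiteWeight_rpow {ρ : ℕ → ℝ} (hρ : ∀ j, 0 < ρ j) {q : ℝ} (hq : 0 < q)
    (hsum : Summable fun j => (ρ j)⁻¹ ^ q) {r : ℕ} (hr : 1 < r * (q / 2)) :
    Summable fun ν => hermiteWeight ρ r ν ^ (-(q / 2)) := by
  obtain ⟨A, hA1, hA⟩ := exists_inv_le hρ hq hsum
  have hc := summable_choose_min_rpow (half_pos hq) hr
  set Z := ∑' k : ℕ, (k.choose (min k r) : ℝ) ^ (-(q / 2)) with hZ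
  have hZ0 : 0 ≤ Z := tsum_nonneg fun k => by positivity
  set h : ℕ → ℕ → ℝ := fun j k =>
    ((k.choose (min k r) : ℝ) * ρ j ^ (2 * min k r)) ^ (-(q / 2)) with hh
  have hinv : ∀ j, 0 ≤ (ρ j)⁻¹ := fun j => (inv_pos.2 (hρ j)).le
  have hA0 : (0 : ℝ) ≤ A := zero_le_one.trans hA1
  have hpos : ∀ j k, 0 ≤ h j k := fun j k =>
    Real.rpow_nonneg (mul_nonneg (by positivity) (pow_nonneg (hρ j).le _)) _
  have hval : ∀ j k, h j k = (k.choose (min k r) : ℝ) ^ (-(q / 2)) *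
      ((ρ j)⁻¹ ^ q) ^ (min k r) := fun j k => by
    rw [hh]
    simp only
    rw [Real.mul_rpow (by positivity) (pow_nonneg (hρ j).le _)]
    congr 1
    rw [← Real.rpow_natCast, ← Real.rpow_mul (hρ j).le, Real.inv_rpow (hρ j).le,
      ← Real.rpow_neg (hρ j).le, ← Real.rpow_natCast, ← Real.rpow_mul (hρ j).le]
    congr 1
    push_cast
    ring
  have hbound : ∀ j k, k ≠ 0 → h j k ≤
      (A ^ q) ^ r * (ρ j)⁻¹ ^ q * (k.choose (min k r) : ℝ) ^ (-(q / 2)) := fun j k hk => by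
    rw [hval, mul_comm]
    refine mul_le_mul_of_nonneg_right ?_ (by positivity)
    have hA1' : 1 ≤ A ^ q := Real.one_le_rpow hA1 hq.le
    have hr0 : r ≠ 0 := by rintro rfl; norm_num at hr
    obtain ⟨n, hn⟩ : ∃ n, min k r = n + 1 := ⟨min k r - 1, by omega⟩
    rw [hn, pow_succ]
    have h1 : (ρ j)⁻¹ ^ q ≤ A ^ q := Real.rpow_le_rpow (hinv j) (hA j) hq.le
    have h0 : 0 ≤ (ρ j)⁻¹ ^ q := Real.rpow_nonneg (hinv j) _
    refine mul_le_mul_of_nonneg_right ?_ h0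
    exact (pow_le_pow_left₀ h0 h1 n).trans (pow_le_pow_right₀ hA1' (by omega))
  have hB : ∀ j, ∀ N : Finset ℕ, ∑ k ∈ N, h j k ≤ Real.exp ((A ^ q) ^ r * (ρ j)⁻¹ ^ q * Z) := by
    intro j N
    have hjn : 0 ≤ (A ^ q) ^ r * (ρ j)⁻¹ ^ q := mul_nonneg
      (pow_nonneg (Real.rpow_nonneg hA0 _) _) (Real.rpow_nonneg (hinv j) _)
    calc ∑ k ∈ N, h j k ≤ ∑ k ∈ insert 0 N, h j k :=
          Finset.sum_le_sum_of_subset_of_nonneg (Finset.subset_insert _ _) fun k _ _ => hpos j k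
      _ = h j 0 + ∑ k ∈ (insert 0 N).erase 0, h j k :=
          (Finset.add_sum_erase _ _ (Finset.mem_insert_self _ _)).symm
      _ ≤ 1 + ∑ k ∈ (insert 0 N).erase 0,
          (A ^ q) ^ r * (ρ j)⁻¹ ^ q * (k.choose (min k r) : ℝ) ^ (-(q / 2)) := by
          refine add_le_add (le_of_eq (by simp [hh])) (Finset.sum_le_sum fun k hk => ?_)
          exact hbound j k (Finset.ne_of_mem_erase hk)
      _ ≤ 1 + (A ^ q) ^ r * (ρ j)⁻¹ ^ q * Z := by
          rw [← Finset.mul_sum]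
          refine add_le_add le_rfl (mul_le_mul_of_nonneg_left ?_ hjn)
          exact hc.sum_le_tsum _ fun k _ => by positivity
      _ ≤ _ := by rw [add_comm]; exact Real.add_one_le_exp _
  refine summable_of_sum_le (c := Real.exp (∑' j, (A ^ q) ^ r * (ρ j)⁻¹ ^ q * Z))
    (fun ν => Real.rpow_nonneg (hermiteWeight_pos hρ r ν).le _) fun F => ?_
  have hprod : ∀ ν : ℕ →₀ ℕ, hermiteWeight ρ r ν ^ (-(q / 2)) = ν.prod h := fun ν => by
    rw [hermiteWeight, Finsupp.prod, Finsupp.prod, ← Real.finsetProd_rpow]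
    exact fun j _ => mul_nonneg (by positivity) (pow_nonneg (hρ j).le _)
  simp only [hprod]
  have hsub : ∀ ν ∈ F, ν.support ⊆ F.biUnion Finsupp.support := fun ν hν =>
    Finset.subset_biUnion_of_mem Finsupp.support hν
  refine (sum_finsupp_prod_le hpos (by simp [hh]) hB _ F hsub).trans ?_
  rw [← Real.exp_sum]
  refine Real.exp_le_exp.2 (((hsum.mul_left _).mul_right Z).sum_le_tsum _ fun j _ => ?_)
  exact mul_nonneg (mul_nonneg (pow_nonneg (Real.rpow_nonneg hA0 _) _)
    (Real.rpow_nonneg (hinv j) _)) hZ0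

/-! ### Best `n`-term approximation of sequences -/

/-- Interpolation between a weighted `ℓ²` bound and the summability of a power of the weights;
Young's inequality is enough. -/
theorem summable_rpow_of_weighted {ι : Type*} {c w : ι → ℝ} {p : ℝ} (hp0 : 0 < p) (hp2 : p < 2)
    (hc : ∀ i, 0 ≤ c i) (hw : ∀ i, 0 < w i) (h1 : Summable fun i => w i * c i ^ 2)
    (h2 : Summable fun i => w i ^ (-(p / (2 - p)))) : Summable fun i => c i ^ p := by
  refine Summable.of_nonneg_of_le (fun i => Real.rpow_nonneg (hc i) _) (fun i => ?_) (h1.add h2)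
  have hwc : 0 ≤ w i * c i ^ 2 := mul_nonneg (hw i).le (sq_nonneg _)
  have hwp : 0 ≤ w i ^ (-(p / (2 - p))) := Real.rpow_nonneg (hw i).le _
  have hp2' : 0 < 2 - p := by linarith
  have h := Real.geom_mean_le_arith_mean2_weighted (w₁ := p / 2) (w₂ := 1 - p / 2)
    (by linarith) (by linarith) hwc hwp (by ring)
  have e : (w i * c i ^ 2) ^ (p / 2) * (w i ^ (-(p / (2 - p)))) ^ (1 - p / 2) = c i ^ p := by
    rw [Real.mul_rpow (hw i).le (sq_nonneg _), ← Real.rpow_natCast (c i), ← Real.rpow_mul (hc i),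
      ← Real.rpow_mul (hw i).le, mul_right_comm, ← Real.rpow_add (hw i)]
    have e1 : p / 2 + -(p / (2 - p)) * (1 - p / 2) = 0 := by field_simp; ring
    have e2 : ((2 : ℕ) : ℝ) * (p / 2) = p := by push_cast; ring
    rw [e1, e2, Real.rpow_zero, one_mul]
  rw [e] at h
  refine h.trans (add_le_add ?_ ?_)
  · exact mul_le_of_le_one_left hwc (by linarith)
  · exact mul_le_of_le_one_left hwp (by linarith)

/-- Greedy choice: a nonnegative family that tends to `0` attains its maximum off any finite set. -/
theorem exists_isNLargest {ι : Type*} [Infinite ι] {c : ι → ℝ} (hc : ∀ i, 0 ≤ c i)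
    (h : Tendsto c cofinite (𝓝 0)) (n : ℕ) : ∃ Λ : Finset ι, IsNLargest c n Λ := by
  classical
  induction n with
  | zero => exact ⟨∅, by simp [IsNLargest]⟩
  | succ n ih =>
    obtain ⟨Λ, hcard, hΛ⟩ := ih
    obtain ⟨i, hi, hmax⟩ : ∃ i ∉ Λ, ∀ j ∉ Λ, c j ≤ c i := by
      by_cases hz : ∀ j ∉ Λ, c j = 0
      · obtain ⟨i, hi⟩ := Infinite.exists_notMem_finset Λ
        exact ⟨i, hi, fun j hj => by rw [hz i hi, hz j hj]⟩
      · push Not at hz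
        obtain ⟨k, hk, hk0⟩ := hz
        have hkpos : 0 < c k := lt_of_le_of_ne (hc k) (Ne.symm hk0)
        have hfin : {j | ¬ c j < c k}.Finite := h.eventually (gt_mem_nhds hkpos)
        have hfin' : ({j | ¬ c j < c k} \ Λ : Set ι).Finite := hfin.subset Set.sdiff_subset
        obtain ⟨i, hi, hmax⟩ := Set.exists_max_image _ c hfin' ⟨k, by simp, hk⟩
        refine ⟨i, hi.2, fun j hj => ?_⟩
        by_cases hjk : c j < c k
        · exact hjk.le.trans (not_lt.1 hi.1)
        · exact hmax j ⟨hjk, hj⟩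
    refine ⟨insert i Λ, by rw [Finset.card_insert_of_notMem hi, hcard], ?_⟩
    intro μ hμ ν hν
    rw [Finset.mem_insert, not_or] at hν
    rcases Finset.mem_insert.1 hμ with rfl | hμ
    · exact hmax ν hν.2
    · exact hΛ μ hμ ν hν.2

/-- Stechkin's lemma: the terms that are not among the `n` largest satisfy `c_i^p ≤ ‖c‖_p^p / n`. -/
theorem sqrt_tsum_sq_le_of_isNLargest {ι : Type*} [DecidableEq ι] {c : ι → ℝ} {p : ℝ}
    (hp0 : 0 < p) (hp2 : p < 2)
    (hc : ∀ i, 0 ≤ c i) (hs : Summable fun i => c i ^ p) {n : ℕ} (hn : 1 ≤ n) {Λ : Finset ι}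
    (hΛ : IsNLargest c n Λ) :
    Real.sqrt (∑' i, if i ∈ Λ then 0 else c i ^ 2) ≤
      (∑' i, c i ^ p) ^ (1 / p) * (n : ℝ) ^ (-(1 / p - 1 / 2)) := by
  set A := ∑' i, c i ^ p with hA
  have hnonneg : ∀ i, 0 ≤ c i ^ p := fun i => Real.rpow_nonneg (hc i) _
  have hA0 : 0 ≤ A := tsum_nonneg hnonneg
  have hn0 : (0 : ℝ) < n := by exact_mod_cast hn
  have hsmall : ∀ i ∉ Λ, c i ^ p ≤ A / n := fun i hi => by
    rw [le_div_iff₀ hn0, mul_comm]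
    calc (n : ℝ) * c i ^ p = ∑ _j ∈ Λ, c i ^ p := by rw [Finset.sum_const, hΛ.1, nsmul_eq_mul]
      _ ≤ ∑ j ∈ Λ, c j ^ p := Finset.sum_le_sum fun j hj =>
          Real.rpow_le_rpow (hc i) (hΛ.2 j hj i hi) hp0.le
      _ ≤ A := hs.sum_le_tsum _ fun j _ => hnonneg j
  have hexp : 0 < 2 / p - 1 := by rw [sub_pos, lt_div_iff₀ hp0]; linarith
  have hterm : ∀ i, (if i ∈ Λ then 0 else c i ^ 2) ≤ c i ^ p * (A / n) ^ (2 / p - 1) := fun i => by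
    split_ifs with hi
    · exact mul_nonneg (hnonneg i) (Real.rpow_nonneg (div_nonneg hA0 hn0.le) _)
    · have e : c i ^ 2 = c i ^ p * (c i ^ p) ^ (2 / p - 1) := by
        rw [← Real.rpow_mul (hc i), ← Real.rpow_add_of_nonneg (hc i) hp0.le (by positivity),
          ← Real.rpow_natCast]
        congr 1
        push_cast
        field_simp
        ring
      rw [e]
      exact mul_le_mul_of_nonneg_left
        (Real.rpow_le_rpow (hnonneg i) (hsmall i hi) hexp.le) (hnonneg i)
  have hsum := hs.mul_right ((A / n) ^ (2 / p - 1))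
  have hsum' : Summable fun i => if i ∈ Λ then 0 else c i ^ 2 :=
    Summable.of_nonneg_of_le (fun i => by split_ifs <;> positivity) hterm hsum
  have hle : ∑' i, (if i ∈ Λ then 0 else c i ^ 2) ≤ A * (A / n) ^ (2 / p - 1) := by
    rw [hA, ← tsum_mul_right]
    exact hsum'.tsum_le_tsum hterm hsum
  refine Real.sqrt_le_iff.2 ⟨by positivity, hle.trans_eq ?_⟩
  rw [mul_pow, ← Real.rpow_natCast, ← Real.rpow_natCast, ← Real.rpow_mul hA0,
    ← Real.rpow_mul hn0.le, Real.div_rpow hA0 hn0.le, div_eq_mul_inv, ← Real.rpow_neg hn0.le,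
    ← mul_assoc]
  congr 1
  · nth_rewrite 1 [← Real.rpow_one A]
    rw [← Real.rpow_add_of_nonneg hA0 zero_le_one hexp.le]
    congr 1
    push_cast
    ring
  · congr 1
    push_cast
    ring

/-! ### The solution map of the lognormal equation -/

/-- The hypothesis on the weighted series, made available for all finite partial sums at once and
for weights that are rescaled by `ε`. -/
theorem ae_sum_mul_abs_le_of_rescaled {d : ℕ} {D : BoundedOpenSet d}
    {ψ : ℕ → LInf D} {ρ : ℕ → ℝ} (hρ : ∀ j, 0 < ρ j) {C : ℝ≥0}
    (hC : ∀ᵐ x ∂D.measure, ∑' j, ENNReal.ofReal (ρ j * |ψ j x|) ≤ (C : ℝ≥0∞)) {ε : ℝ}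
    (hε : 0 ≤ ε) :
    ∀ᵐ x ∂D.measure, ∀ s : Finset ℕ, ∑ j ∈ s, ε * ρ j * |ψ j x| ≤ ε * (C + 1) := by
  filter_upwards [hC] with x hx s
  have hnn : ∀ j ∈ s, 0 ≤ ρ j * |ψ j x| := fun j _ => mul_nonneg (hρ j).le (abs_nonneg _)
  have h := (ENNReal.sum_le_tsum s).trans hx
  rw [← ENNReal.ofReal_sum_of_nonneg hnn, ← ENNReal.ofReal_coe_nnreal,
    ENNReal.ofReal_le_ofReal_iff C.coe_nonneg] at h
  simp only [mul_assoc, ← Finset.mul_sum]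
  exact mul_le_mul_of_nonneg_left (by linarith) hε

section SolutionMap

variable {d : ℕ} [NeZero d] {D : BoundedOpenSet d}

/-- The gradient, an isometric embedding of `H¹₀(D)` into `L²(D; ℝ^d)`. -/
noncomputable def gradIsometry (D : BoundedOpenSet d) : H10 D →ₗᵢ[ℝ] L2Vec D where
  toLinearMap := H10.grad
  norm_map' v := (H10.norm_eq v).symm

/-- The Riesz representative of an element of `H^{-1}(D)`. -/
noncomputable def rieszRep (f : HMinusOne D) : H10 D := (InnerProductSpace.toDual ℝ (H10 D)).symm f

/-- Lax--Milgram: the equation has exactly one weak solution, the Taylor coefficient of order `0`. -/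
theorem isWeakSolution_iff (ψ : ℕ → LInf D) {b : LInf D} {f : HMinusOne D} {w : H10 D} :
    IsWeakSolution b f w ↔ w = solutionTaylor (gradIsometry D) ψ b (rieszRep f) 0 := by
  have h : IsWeakSolution b f w ↔
      diffusionOp (gradIsometry D) (taylorCoeff ψ b 0) w = rieszRep f := by
    have hv : ∀ v : H10 D, ⟪rieszRep f, v⟫_ℝ = f v := fun v =>
      InnerProductSpace.toDual_symm_apply
    constructor
    · intro h
      refine ext_inner_right ℝ fun v => ?_
      rw [inner_diffusionOp_taylorCoeff_zero, hv]
      exact h v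
    · intro h v
      rw [← hv, ← h, inner_diffusionOp_taylorCoeff_zero]
      rfl
  rw [h]
  constructor
  · intro hw
    refine diffusionOp_injective (gradIsometry D) ψ b ?_
    rw [hw, diffusionOp_solutionTaylor_zero]
  · rintro rfl
    exact diffusionOp_solutionTaylor_zero _ _ _ _

theorem solutionMap_eq {ψ : ℕ → LInf D} (f : HMinusOne D) {y : ℕ → ℝ}
    (hy : ∃ b, IsLogCoeff ψ y b) :
    solutionMap ψ f y = solutionTaylor (gradIsometry D) ψ (logCoeff ψ y) (rieszRep f) 0 := by
  have h : ∃ w : H10 D, ∃ b : LInf D, IsLogCoeff ψ y b ∧ IsWeakSolution b f w :=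
    ⟨_, _, isLogCoeff_logCoeff hy, (isWeakSolution_iff ψ).2 rfl⟩
  rw [solutionMap, dif_pos h]
  obtain ⟨b, hb, hw⟩ := h.choose_spec
  rw [← hb.eq_logCoeff]
  exact (isWeakSolution_iff ψ).1 hw

end SolutionMap

end LognormalPDE


open LognormalPDE
theorem theorem1p2 {d : ℕ} [NeZero d] (D : BoundedOpenSet d)
    (f : HMinusOne D) (ψ : ℕ → LInf D) (p q : ℝ) (hp0 : 0 < p) (hp2 : p < 2)
    (hq : q = 2 * p / (2 - p)) (ρ : ℕ → ℝ) (hρ : ∀ j, 0 < ρ j)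
    (hsup : ∃ C : ℝ≥0, ∀ᵐ x ∂D.measure, ∑' j, ENNReal.ofReal (ρ j * |ψ j x|) ≤ (C : ℝ≥0∞))
    (hsum : Summable fun j => (ρ j)⁻¹ ^ q) :
    -- the solution map is well defined almost everywhere
    (∀ᵐ y ∂gaussianMeasure, ∃ b : LInf D, IsLogCoeff ψ y b ∧
      IsWeakSolution b f (solutionMap ψ f y) ∧
      ∀ w : H10 D, IsWeakSolution b f w → w = solutionMap ψ f y) ∧
    -- it has finite moments of all orders
    (∀ k : ℝ≥0, MemLp (solutionMap ψ f) (k : ℝ≥0∞) gaussianMeasure) ∧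
    -- its Hermite coefficients are `p`-summable
    (Summable fun ν : ℕ →₀ ℕ => ‖hermiteCoeff (solutionMap ψ f) ν‖ ^ p) ∧
    -- best `n`-term Hermite truncations exist and converge with rate `n ^ (-s)`, `s = 1/p - 1/2`
    1 / p - 1 / 2 = 1 / q ∧
    (∀ n : ℕ, ∃ Λ : Finset (ℕ →₀ ℕ),
      IsNLargest (fun ν => ‖hermiteCoeff (solutionMap ψ f) ν‖) n Λ) ∧
    ∃ C : ℝ, ∀ n : ℕ, 1 ≤ n → ∀ Λ : Finset (ℕ →₀ ℕ),
      IsNLargest (fun ν => ‖hermiteCoeff (solutionMap ψ f) ν‖) n Λ →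
      eLpNorm (fun y => solutionMap ψ f y - hermiteTruncation (solutionMap ψ f) Λ y) 2
        gaussianMeasure ≤ ENNReal.ofReal (C * (n : ℝ) ^ (-(1 / p - 1 / 2))) := by
  obtain ⟨C, hC⟩ := hsup
  have hp2' : 0 < 2 - p := by linarith
  have hq0 : 0 < q := by rw [hq]; positivity
  obtain ⟨r, hr⟩ : ∃ r : ℕ, 1 < r * (q / 2) := by
    obtain ⟨r, hr⟩ := exists_nat_gt (1 / (q / 2))
    exact ⟨r, by rwa [div_lt_iff₀ (by positivity)] at hr⟩
  -- Rescaling the weights by a small `ε` makes `exp (√r * K)` close to `1`.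
  obtain ⟨ε, hε, hexp⟩ : ∃ ε : ℝ, 0 < ε ∧ Real.exp (Real.sqrt r * (ε * (C + 1))) ≤ 3 / 2 := by
    refine ⟨Real.log (3 / 2) / (Real.sqrt r * (C + 1) + 1), ?_, ?_⟩
    · have := Real.log_pos (by norm_num : (1 : ℝ) < 3 / 2)
      positivity
    · rw [← Real.le_log_iff_exp_le (by norm_num)]
      have hl := Real.log_pos (by norm_num : (1 : ℝ) < 3 / 2)
      have h1 : 0 ≤ Real.sqrt r * ((C : ℝ) + 1) := by positivity
      rw [show Real.sqrt r * (Real.log (3 / 2) / (Real.sqrt r * (C + 1) + 1) * (C + 1)) =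
        Real.log (3 / 2) * (Real.sqrt r * (C + 1)) / (Real.sqrt r * (C + 1) + 1) by ring,
        div_le_iff₀ (by positivity)]
      nlinarith
  have hK := ae_sum_mul_abs_le_of_rescaled hρ hC hε.le
  have hK0 : 0 < ε * ((C : ℝ) + 1) := by positivity
  have hρ' : ∀ j, 0 < ε * ρ j := fun j => mul_pos hε (hρ j)
  have hsum' : Summable fun j => (ε * ρ j)⁻¹ ^ q := by
    refine (hsum.mul_left (ε⁻¹ ^ q)).congr fun j => ?_
    rw [mul_inv, Real.mul_rpow (by positivity) (inv_pos.2 (hρ j)).le]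
  have hconv := ae_exists_isLogCoeff hρ' hq0 hsum' hK0.le hK
  have hmom := finiteMoments_exp_norm_logCoeff hρ' hq0 hsum' hK0 hK
  have hae : (fun y => solutionTaylor (gradIsometry D) ψ (logCoeff ψ y) (rieszRep f) 0)
      =ᵐ[gaussianMeasure] solutionMap ψ f := by
    filter_upwards [hconv] with y hy using (solutionMap_eq f hy).symm
  have hmem : ∀ k : ℝ≥0, MemLp (solutionMap ψ f) (k : ℝ≥0∞) gaussianMeasure := fun k =>
    (memLp_congr_ae hae).1 (finiteMoments_solutionTaylor (gradIsometry D) (rieszRep f) hρ' hK hexp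
      hconv hmom (fun _ => Nat.zero_le r) k)
  have hcoeff : ∀ ν, hermiteCoeff (fun y => solutionTaylor (gradIsometry D) ψ (logCoeff ψ y)
      (rieszRep f) 0) ν = hermiteCoeff (solutionMap ψ f) ν := fun ν =>
    integral_congr_ae (hae.mono fun y hy => by simp only [hy])
  have hweighted : Summable fun ν =>
      hermiteWeight (fun j => ε * ρ j) r ν * ‖hermiteCoeff (solutionMap ψ f) ν‖ ^ 2 := by
    have h := sum_hermiteWeight_mul_norm_sq_le (gradIsometry D) (rieszRep f) hρ' hK hexp hconv hmom
    simp only [hcoeff] at h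
    exact summable_of_sum_le
      (fun ν => mul_nonneg (hermiteWeight_pos hρ' r ν).le (sq_nonneg _)) h
  have hlp : Summable fun ν : ℕ →₀ ℕ => ‖hermiteCoeff (solutionMap ψ f) ν‖ ^ p := by
    refine summable_rpow_of_weighted hp0 hp2 (fun ν => norm_nonneg _) (hermiteWeight_pos hρ' r)
      hweighted ?_
    have e : p / (2 - p) = q / 2 := by rw [hq]; ring
    rw [e]
    exact summable_hermiteWeight_rpow hρ' hq0 hsum' hr
  have h2 : MemLp (solutionMap ψ f) 2 gaussianMeasure := by simpa using hmem 2
  refine ⟨?_, hmem, hlp, ?_, fun n => ?_, ?_⟩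
  · filter_upwards [hconv] with y hy
    refine ⟨logCoeff ψ y, isLogCoeff_logCoeff hy, ?_, fun w hw => ?_⟩
    · rw [isWeakSolution_iff ψ, solutionMap_eq f hy]
    · rw [(isWeakSolution_iff ψ).1 hw, solutionMap_eq f hy]
  · rw [hq]
    field_simp
  · refine exists_isNLargest (fun ν => norm_nonneg _) ?_ n
    have h := (Real.continuous_sqrt.tendsto 0).comp
      (summable_norm_sq_hermiteCoeff h2).tendsto_cofinite_zero
    rw [Real.sqrt_zero] at h
    exact h.congr fun ν => Real.sqrt_sq (norm_nonneg _)
  · refine ⟨(∑' ν, ‖hermiteCoeff (solutionMap ψ f) ν‖ ^ p) ^ (1 / p), fun n hn Λ hΛ => ?_⟩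
    rw [eLpNorm_sub_hermiteTruncation h2]
    exact ENNReal.ofReal_le_ofReal
      (sqrt_tsum_sq_le_of_isNLargest hp0 hp2 (fun ν => norm_nonneg _) hlp hn hΛ)
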